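/- Notation. All fields are real vector fields on $\mathbb R^3$, and $\alpha,\mu>0$. Let $\|v\|_{H^1_\alpha}^2=\|v\|_{L^2}^2+\alpha\|\nabla v\|_{L^2}^2$. Let $V$ be the space of divergence-free $v\in H^1(\mathbb R^3)^3$, and $V_2=\{v\in V:\operatorname{curl}(v-\alpha\Delta v)\in L^2\}$ with $\|v\|_{V_2}^2=\|v\|_{H^1_\alpha}^2+\|\operatorname{curl}(v-\alpha\Delta v)\|_{L^2}^2$. With $\widehat v(\xi)=\int e^{-i\xi\cdot x}v(x)\,dx$ put $$E_v(\rho)=\int_{|\xi|\le\rho}|\widehat v(\xi)|^2\,d\xi,\qquad r^*_+(v)=\sup\Bigl\{r\in\mathbb R:\ \limsup_{\rho\to0^+}\rho^{-2r-3}E_v(\rho)<\infty\Bigr\}\in[-\tfrac32,\infty].$$ A weak solution on $[0,\infty)$ of the second-grade fluid equations $$\partial_t(u-\alpha\Delta u)-\mu\Delta u+\operatorname{curl}(u-\alpha\Delta u)\times u+\nabla p=0,\quad \operatorname{div}u=0,\quad u(0)=u_0,$$ is a $u\in L^\infty(0,T;V_2)$ with $u'\in L^\infty(0,T;V)$ for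 all $T>0$ (taken as its continuous representative), with $u(0)=u_0$, such that for a.e. $t>0$ and every divergence-free $\varphi\in C_c^\infty(\mathbb R^3)^3$ $$(u',\varphi)+\alpha(\nabla u',\nabla\varphi)+\mu(\nabla u,\nabla\varphi)+b(u,u,\varphi)-\alpha\,b(u,\Delta u,\varphi)+\alpha\,b(\varphi,\Delta u,u)=0,$$ where $b(u,v,w)=\sum_{i,j}\int u_j\,\partial_jv_i\,w_i\,dx$. Theorem. For all $\alpha,\mu>0$ there is $\varepsilon>0$ such that the following holds. Let $u_0\in H^4(\mathbb R^3)^3$ with $\operatorname{div}u_0=0$ and $\|u_0\|_{V_2}<\varepsilon$, and let $r^*_+=r^*_+(u_0)$. Let $u$ be any weak solution with initial data $u_0$, and let $\overline u$ be the solution of the linear pseudo-parabolic problem $\partial_t(\overline u-\alpha\Delta\overline u)-\mu\Delta\overline u=0$, $\operatorname{div}\overline u=0$, $\overline u(0)=u_0$. Then $$\|u(t)-\overline u(t)\|_{H^1_\alpha}^2\le C\,(t+1)^{-\min\{\frac52+\frac32r^*_+,\ \frac52\}}\qquad\text{for all }t\ge0,$$ where $C>0$ depends only on $\|u_0\|_{H^1_\alpha}$,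 $\alpha$, $\mu$, $r^*_+$ and the low-frequency profile $\rho\mapsto E_{u_0}(\rho)$ that defines $r^*_+$ (for $r^*_+=\infty$ the exponent is $-\frac52$). In particular $\|u(t)-\overline u(t)\|_{H^1_\alpha}\to0$ as $t\to\infty$, i.e. $u$ is asymptotically equivalent to $\overline u$. -/

import Mathlib

open MeasureTheory Filter Set Topology
open scoped SchwartzMap LineDeriv Laplacian FourierTransform ContDiff

noncomputable section

namespace SecondGrade

/-- Three-dimensional Euclidean space. -/
abbrev Space : Type := EuclideanSpace ℝ (Fin 3)

/-- Scalar square integrable functions on `Space`. They are taken complex valued so that the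
Fourier transform and the tempered distributions of Mathlib apply; the velocity fields are
required to be real valued in `MemV`. -/
abbrev L2 : Type := Lp ℂ 2 (volume : Measure Space)

/-- Square integrable vector fields on `Space`, given by their three components. -/
abbrev Field : Type := Fin 3 → L2

/-- The tempered distribution given by a square integrable function. -/
def toDist (f : L2) : 𝓢'(Space, ℂ) := Lp.toTemperedDistribution f

/-- The distributional partial derivative in the `j`-th coordinate direction. -/
def pd (j : Fin 3) (T : 𝓢'(Space, ℂ)) : 𝓢'(Space, ℂ) :=
  ∂_{(EuclideanSpace.single j (1 : ℝ) : Space)} T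

open Classical in
/-- The square integrable function that represents the tempered distribution `T`. It is unique
if it exists, and it is only used for distributions that have one (the value is `0` otherwise). -/
def rep (T : 𝓢'(Space, ℂ)) : L2 :=
  if h : ∃ g : L2, toDist g = T then h.choose else 0

/-- `∂ⱼ f` as a square integrable function, for `f` in `H¹`. -/
def dL2 (j : Fin 3) (f : L2) : L2 := rep (pd j (toDist f))

/-- `∂ⱼ Δ f` as a square integrable function, for `f` in `H³`. -/
def dLapL2 (j : Fin 3) (f : L2) : L2 := rep (pd j (Δ (toDist f)))

/-- The Sobolev space `Hˢ` of vector fields. -/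
def MemH (s : ℝ) (v : Field) : Prop :=
  ∀ i, TemperedDistribution.MemSobolev s 2 (toDist (v i))

/-- The distributional divergence. -/
def divergence (v : Field) : 𝓢'(Space, ℂ) := ∑ j, pd j (toDist (v j))

/-- The curl of a vector valued distribution. -/
def curl (T : Fin 3 → 𝓢'(Space, ℂ)) : Fin 3 → 𝓢'(Space, ℂ) :=
  ![pd 1 (T 2) - pd 2 (T 1), pd 2 (T 0) - pd 0 (T 2), pd 0 (T 1) - pd 1 (T 0)]

/-- The distribution `curl (v - α Δ v)`. -/
def curlFiltered (α : ℝ) (v : Field) : Fin 3 → 𝓢'(Space, ℂ) :=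
  curl fun i => toDist (v i) - (α : ℂ) • Δ (toDist (v i))

/-- The vector field takes real values. -/
def IsRealValued (v : Field) : Prop := ∀ i, ∀ᵐ x : Space, (v i x).im = 0

/-- The space `V` of (real) divergence-free `H¹` vector fields on `Space`. -/
def MemV (v : Field) : Prop := IsRealValued v ∧ MemH 1 v ∧ divergence v = 0

/-- The space `V₂` of those `v` in `V` for which `curl (v - α Δ v)` is square integrable. -/
def MemV2 (α : ℝ) (v : Field) : Prop :=
  MemV v ∧ ∀ i, ∃ g : L2, toDist g = curlFiltered α v i

/-- `‖v‖²_{H¹_α} = ‖v‖²_{L²} + α ‖∇v‖²_{L²}`. -/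
def normSqH1 (α : ℝ) (v : Field) : ℝ :=
  (∑ i, ‖v i‖ ^ 2) + α * (∑ i, ∑ j, ‖dL2 j (v i)‖ ^ 2)

/-- `‖v‖_{H¹_α}`. -/
def normH1 (α : ℝ) (v : Field) : ℝ := Real.sqrt (normSqH1 α v)

/-- `‖v‖_{V₂}`, where
`‖v‖²_{V₂} = ‖v‖²_{L²} + α ‖∇v‖²_{L²} + ‖curl (v - α Δ v)‖²_{L²}`. -/
def normV2 (α : ℝ) (v : Field) : ℝ :=
  Real.sqrt (normSqH1 α v + ∑ i, ‖rep (curlFiltered α v i)‖ ^ 2)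

/-- `∫_{|ξ| ≤ ρ} |v̂(ξ)|² dξ` with the normalization `v̂(ξ) = ∫ exp(-i ξ·x) v(x) dx`; Mathlib's
transform has the kernel `exp(-2πi ξ·x)`, which is the reason for the dilation by `1 / (2π)`. -/
def lowFreqMass (v : Field) (ρ : ℝ) : ℝ :=
  ∫ ξ in Metric.closedBall (0 : Space) ρ,
    ∑ i, ‖(𝓕 (v i) : L2) ((2 * Real.pi)⁻¹ • ξ)‖ ^ 2

/-- The upper decay indicator
`P_r(v)₊ = limsup_{ρ → 0⁺} ρ^{-2r-3} ∫_{|ξ| ≤ ρ} |v̂(ξ)|² dξ`, in `[0, ∞]`. -/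
def upperDecayIndicator (r : ℝ) (v : Field) : ENNReal :=
  limsup (fun ρ : ℝ => ENNReal.ofReal (ρ ^ (-2 * r - 3) * lowFreqMass v ρ)) (𝓝[>] 0)

/-- The upper decay character `r*₊(v) = sup {r ∈ ℝ : P_r(v)₊ < ∞}`, in `[-∞, ∞]`. -/
def upperDecayCharacter (v : Field) : EReal :=
  sSup ((fun r : ℝ => (r : EReal)) '' {r : ℝ | upperDecayIndicator r v < ⊤})

/-- The exponent `min {5/2 + (3/2) r, 5/2}` (which is `5/2` for `r = ∞`). -/
def decayRate (r : EReal) : ℝ :=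
  (min (((5 / 2 : ℝ) : EReal) + ((3 / 2 : ℝ) : EReal) * r) ((5 / 2 : ℝ) : EReal)).toReal

/-- On `[0, ∞)` the curve `u` is an indefinite Bochner integral of `u'` in `L²`, so that `u'` is
its weak time derivative and `u` is the continuous representative. -/
def IsTimeDeriv (u u' : ℝ → Field) : Prop :=
  AEStronglyMeasurable u' (volume.restrict (Ioi (0 : ℝ))) ∧
  (∀ T > 0, IntegrableOn u' (Ioo 0 T)) ∧
  ∀ t ≥ 0, u t = u 0 + ∫ s in (0 : ℝ)..t, u' s

/-- `w ∈ L^∞(0,T;V)` for every `T > 0`. -/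
def LocBoundedV (α : ℝ) (w : ℝ → Field) : Prop :=
  ∀ T > 0, ∃ M : ℝ, ∀ᵐ t ∂(volume.restrict (Ioo 0 T)), MemV (w t) ∧ normH1 α (w t) ≤ M

/-- `w ∈ L^∞(0,T;V₂)` for every `T > 0`. -/
def LocBoundedV2 (α : ℝ) (w : ℝ → Field) : Prop :=
  ∀ T > 0, ∃ M : ℝ, ∀ᵐ t ∂(volume.restrict (Ioo 0 T)), MemV2 α (w t) ∧ normV2 α (w t) ≤ M

/-- The classical partial derivative of a test function. -/
def dTest (j : Fin 3) (φ : Space → ℝ) (x : Space) : ℝ :=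
  fderiv ℝ φ x (EuclideanSpace.single j (1 : ℝ))

/-- Smooth compactly supported divergence-free vector fields. -/
structure IsTestField (φ : Fin 3 → Space → ℝ) : Prop where
  smooth : ∀ i, ContDiff ℝ ∞ (φ i)
  compact : ∀ i, HasCompactSupport (φ i)
  divFree : ∀ x, ∑ j, dTest j (φ j) x = 0

/-- The `L²` pairing of `v` with a test field. -/
def pair (v : Field) (φ : Fin 3 → Space → ℝ) : ℂ :=
  ∑ i, ∫ x, v i x * (φ i x : ℂ)

/-- The `L²` pairing of the gradients of `v` and of a test field. -/
def gradPair (v : Field) (φ : Fin 3 → Space → ℝ) : ℂ :=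
  ∑ i, ∑ j, ∫ x, dL2 j (v i) x * (dTest j (φ i) x : ℂ)

/-- The trilinear form `b(u,v,w) = ∑ᵢⱼ ∫ uⱼ (∂ⱼ vᵢ) wᵢ dx`; the argument `Dv j i` stands for
`∂ⱼ vᵢ`. -/
def trilinear (u : Fin 3 → Space → ℂ) (Dv : Fin 3 → Fin 3 → Space → ℂ)
    (w : Fin 3 → Space → ℂ) : ℂ :=
  ∑ i, ∑ j, ∫ x, u j x * Dv j i x * w i x

/-- Weak solutions on `[0, ∞)`, with initial value `u₀`, of the second-grade fluid equations
`∂ₜ(u - αΔu) - μΔu + curl(u - αΔu) × u + ∇p = 0`, `div u = 0`. -/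
def IsWeakSolution (α μ : ℝ) (u₀ : Field) (u : ℝ → Field) : Prop :=
  u 0 = u₀ ∧ LocBoundedV2 α u ∧
  ∃ u' : ℝ → Field, IsTimeDeriv u u' ∧ LocBoundedV α u' ∧
    ∀ᵐ t ∂(volume.restrict (Ioi (0 : ℝ))), ∀ φ : Fin 3 → Space → ℝ, IsTestField φ →
      pair (u' t) φ + α * gradPair (u' t) φ + μ * gradPair (u t) φ
        + trilinear (fun i x => u t i x) (fun j i x => dL2 j (u t i) x) (fun i x => (φ i x : ℂ))
        - α * trilinear (fun i x => u t i x) (fun j i x => dLapL2 j (u t i) x)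
            (fun i x => (φ i x : ℂ))
        + α * trilinear (fun i x => (φ i x : ℂ)) (fun j i x => dLapL2 j (u t i) x)
            (fun i x => u t i x) = 0

/-- Solutions on `[0, ∞)`, with initial value `u₀`, of the linear pseudo-parabolic system
`∂ₜ(u - αΔu) - μΔu = 0`, `div u = 0`; the equation holds in the sense of distributions. -/
def IsLinearSolution (α μ : ℝ) (u₀ : Field) (u : ℝ → Field) : Prop :=
  u 0 = u₀ ∧ LocBoundedV α u ∧
  ∃ u' : ℝ → Field, IsTimeDeriv u u' ∧ LocBoundedV α u' ∧
    ∀ᵐ t ∂(volume.restrict (Ioi (0 : ℝ))), ∀ i,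
      toDist (u' t i) - (α : ℂ) • Δ (toDist (u' t i)) - (μ : ℂ) • Δ (toDist (u t i)) = 0

end SecondGrade

end

open MeasureTheory Filter Set Topology
open scoped SchwartzMap LineDeriv Laplacian FourierTransform ContDiff

noncomputable section

namespace SecondGrade

/-! ### The Fourier transform of integrable functions -/

/-! Write v for the linear solution, w = u - v, E for the squared norm of H¹_α (`energy`), τ = t +
t₀ for a shifted time and N(u) for the nonlinearity (`nonlin`), which agrees with curl(u - αΔu) × u
up to a gradient. The proof is a Fourier splitting argument run simultaneously for u, v and w.

Energy balances. Since ⟨N(u), u⟩ = 0, both E(u) and E(v) are dissipated at the rate 2μ‖∇·‖², while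
E(w)' = -2μ‖∇w‖² - 2 Re⟨N(u), w⟩. By ⟨N(u), u⟩ = ⟨N(v), v⟩ = 0 and integration by parts
(`pairing_nonlin_eq`), ⟨N(u), w⟩ = -B(w, u; v) - B(v, w; v), where the bilinear form B has all
derivatives of order two on the smooth field v. Hence it is at most a constant times √E(w) (√E(u) +
√E(v)) times a norm of v (`norm_pairing_nonlin_sub_le`). That norm, `waveNorm`, is explicit: for |ξ|
≤ 1 the linear evolution behaves like the heat flow and gives (1+t)^(-5/4) √E(v(t/2)). For |ξ| > 1
it damps exponentially without smoothing, so there the H³ norm of u₀ is needed, and the bound on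
‖u₀‖_{V₂} supplies it.

Low frequencies. As w(0) = 0 and, after testing with a solenoidal field, every term of N(u) has a
derivative on the test field, the mass of w in |ξ| ≤ R is at most C R⁵ (∫₀ᵗ E(u))²
(`lowMass_difference_le`): R² comes from the derivative and R³ from the volume of the ball.

Splitting. With R² proportional to 1/τ, `dissip_splitting` bounds the dissipation term by -(3/τ) E
plus (6/τ) times the mass in |ξ| ≤ R. The decay character gives ∫_{|ξ|≤ρ} |û₀|² ≤ C ρ^(2q) for q <
r*₊ + 3/2, and q = 0 is always admissible. With the integrating factor τ³, E(v) decays like τ^(-q).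
Two rounds of bootstrapping give the same rate for E(u), and two more rounds raise the rate of E(w)
from q to 1/4 + 3q/2 and then to 3/8 + 7q/4, capped by the low-frequency rate (1/2 + 2q for q < 1,
5/2 for q > 1). This is `difference_decay`. The result exceeds 5/2 + 3r*₊/2 with some room, so q may
stay slightly below r*₊ + 3/2 and the supremum in r*₊ need not be attained.

Justification for weak solutions. Testing with curls shows that the transform of the momentum
balance is parallel to ξ, hence orthogonal to solenoidal fields at almost every frequency
(`balance_orthogonal`). The energy equality is first proved for the frequencies |ξ| ≤ R, where
everything is a bounded operation on L², and then R → ∞ (`Evolution.energy`).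

Uniformity. The constant may depend only on the norm, the decay character and the profile of u₀, so
the decay estimates are made for the whole family of solutions that share these data (`UDecay`,
`Comparison`). -/

lemma integral_fourier_mul {p q : Space → ℂ} (hp : Integrable p) (hq : Integrable q) :
    ∫ x, 𝓕 p x * q x = ∫ x, p x * 𝓕 q x := by
  simpa using! VectorFourier.integral_bilin_fourierIntegral_eq_flip
    (ContinuousLinearMap.mul ℂ ℂ) (L := innerₗ Space)
    Real.continuous_fourierChar continuous_inner hp hq

lemma integral_fourierInv_mul {p q : Space → ℂ} (hp : Integrable p) (hq : Integrable q) :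
    ∫ x, 𝓕⁻ p x * q x = ∫ x, p x * 𝓕⁻ q x := by
  rw [Real.fourierInv_eq_fourier_comp_neg p, integral_fourier_mul hp.comp_neg hq,
    ← integral_neg_eq_self]
  simp [Real.fourierInv_eq_fourier_neg]

lemma norm_fourierInv_le (p : Space → ℂ) (x : Space) : ‖𝓕⁻ p x‖ ≤ ∫ ξ, ‖p ξ‖ := by
  rw [Real.fourierInv_eq]
  refine (norm_integral_le_integral_norm _).trans_eq ?_
  simp [Circle.norm_smul]

lemma continuous_fourierInv {p : Space → ℂ} (hp : Integrable p) : Continuous (𝓕⁻ p) := by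
  rw [← Real.Lp.fourierTransformInv_toLp (memLp_one_iff_integrable.2 hp)]
  exact BoundedContinuousFunction.continuous _

/-- A locally integrable function that annihilates all Schwartz functions vanishes. -/
lemma ae_zero_of_integral_schwartz {p : Space → ℂ} (hp : LocallyIntegrable p)
    (h : ∀ φ : 𝓢(Space, ℂ), ∫ x, p x * φ x = 0) : p =ᵐ[volume] 0 := by
  refine ae_eq_zero_of_integral_contDiff_smul_eq_zero hp fun g hg hc => ?_
  have hg₁ : HasCompactSupport (Complex.ofRealCLM ∘ g) := hc.comp_left rfl
  have hg₂ : ContDiff ℝ ∞ (Complex.ofRealCLM ∘ g) := by fun_prop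
  rw [← h (hg₁.toSchwartzMap hg₂)]
  refine integral_congr_ae (Eventually.of_forall fun x => ?_)
  simp [mul_comm]

/-- Every Schwartz function is an inverse transform, so moving the transform across the integral
shows that `p` annihilates all of them. -/
lemma ae_zero_of_fourierInv_zero {p : Space → ℂ} (hp : Integrable p) (h : ∀ y, 𝓕⁻ p y = 0) :
    p =ᵐ[volume] 0 := by
  refine ae_zero_of_integral_schwartz hp.locallyIntegrable fun φ => ?_
  have : (φ : Space → ℂ) = 𝓕⁻ ((𝓕 φ : 𝓢(Space, ℂ)) : Space → ℂ) := by
    rw [← SchwartzMap.fourierInv_coe]; simp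
  rw [this, ← integral_fourierInv_mul hp (𝓕 φ : 𝓢(Space, ℂ)).integrable]
  simp [h]

/-! ### Square integrable functions as distributions, and Fourier symbols -/

lemma toDist_apply (f : L2) (φ : 𝓢(Space, ℂ)) : toDist f φ = ∫ x, φ x * f x := by
  simp [toDist]

lemma toDist_add (f g : L2) : toDist (f + g) = toDist f + toDist g :=
  map_add (Lp.toTemperedDistributionCLM ℂ volume 2) f g

lemma toDist_sub (f g : L2) : toDist (f - g) = toDist f - toDist g :=
  map_sub (Lp.toTemperedDistributionCLM ℂ volume 2) f g

lemma toDist_injective : Function.Injective toDist :=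
  LinearMap.ker_eq_bot.1 (Lp.ker_toTemperedDistributionCLM_eq_bot (F := ℂ)
    (μ := (volume : Measure Space)) (p := 2))

lemma fourier_toDist (f : L2) : 𝓕 (toDist f) = toDist (𝓕 f) :=
  Lp.fourier_toTemperedDistribution_eq f

lemma rep_toDist (g : L2) : rep (toDist g) = g := by
  have h : ∃ g' : L2, toDist g' = toDist g := ⟨g, rfl⟩
  rw [rep, dif_pos h]
  exact toDist_injective h.choose_spec

/-- The distribution `σ(D) f`. -/
abbrev mult (σ : Space → ℂ) (T : 𝓢'(Space, ℂ)) : 𝓢'(Space, ℂ) :=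
  TemperedDistribution.fourierMultiplierCLM ℂ σ T

lemma mult_toDist_apply {σ : Space → ℂ} (hσ : σ.HasTemperateGrowth) (f : L2)
    (φ : 𝓢(Space, ℂ)) :
    mult σ (toDist f) φ = ∫ ξ, σ ξ * (𝓕 f : L2) ξ * 𝓕⁻ φ ξ := by
  rw [mult, TemperedDistribution.fourierMultiplierCLM_apply_apply,
    ← TemperedDistribution.fourier_apply, fourier_toDist, toDist_apply]
  refine integral_congr_ae (Eventually.of_forall fun x => ?_)
  simp [SchwartzMap.smulLeftCLM_apply_apply hσ]
  ring

lemma integrable_mul_schwartz (f : L2) (φ : 𝓢(Space, ℂ)) : Integrable fun ξ => f ξ * φ ξ :=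
  (Lp.memLp f).integrable_mul (φ.memLp 2)

lemma integrable_symbol_mul {σ : Space → ℂ} (hσ : σ.HasTemperateGrowth) (f : L2)
    (φ : 𝓢(Space, ℂ)) : Integrable fun ξ => σ ξ * f ξ * φ ξ := by
  refine (integrable_mul_schwartz f (SchwartzMap.smulLeftCLM ℂ σ φ)).congr
    (Eventually.of_forall fun x => ?_)
  simp [SchwartzMap.smulLeftCLM_apply_apply hσ]
  ring

/-- If `∑ σᵢ(D) fᵢ` annihilates all real test functions then `∑ σᵢ 𝓕 fᵢ = 0`. -/
lemma symbol_sum_eq_zero_of_test {ι : Type*} (s : Finset ι) {σ : ι → Space → ℂ}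
    (hσ : ∀ i, (σ i).HasTemperateGrowth) (f : ι → L2)
    (h : ∀ ψ : Space → ℝ, ContDiff ℝ ∞ ψ → HasCompactSupport ψ → ∀ φ : 𝓢(Space, ℂ),
      (∀ x, φ x = ψ x) → ∑ i ∈ s, mult (σ i) (toDist (f i)) φ = 0) :
    ∀ᵐ ξ, ∑ i ∈ s, σ i ξ * (𝓕 (f i) : L2) ξ = 0 := by
  -- Testing with all translates of one bump shows that the inverse transform of the symbol sum
  -- times `𝓕⁻ φ` vanishes identically. The product is therefore zero almost everywhere.
  have key : ∀ ψ : Space → ℝ, ContDiff ℝ ∞ ψ → HasCompactSupport ψ → ∀ φ : 𝓢(Space, ℂ),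
      (∀ x, φ x = ψ x) → ∀ᵐ ξ, (∑ i ∈ s, σ i ξ * (𝓕 (f i) : L2) ξ) * 𝓕⁻ φ ξ = 0 := by
    intro ψ hψ hc φ hφ
    refine ae_zero_of_fourierInv_zero ?_ fun y => ?_
    · simp_rw [Finset.sum_mul]
      exact integrable_finsetSum _ fun i _ => integrable_symbol_mul (hσ i) _ _
    · have hy := h (fun x => ψ (x - y)) (hψ.comp (contDiff_id.sub contDiff_const))
        (hc.comp_homeomorph (Homeomorph.subRight y)) (φ.compSubConstCLM ℂ y)
        (fun x => by simp [hφ])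
      simp_rw [mult_toDist_apply (hσ _)] at hy
      rw [← integral_finsetSum _ fun i _ => integrable_symbol_mul (hσ i) _ _] at hy
      rw [Real.fourierInv_eq, ← hy]
      refine integral_congr_ae (Eventually.of_forall fun ξ => ?_)
      have : 𝓕⁻ (φ.compSubConstCLM ℂ y) ξ = Real.fourierChar (inner ℝ ξ y) • 𝓕⁻ φ ξ := by
        rw [SchwartzMap.fourierInv_coe, SchwartzMap.fourierInv_coe, Real.fourierInv_eq,
          Real.fourierInv_eq, ← integral_add_right_eq_self _ y]
        simp only [Circle.smul_def]
        rw [← integral_smul]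
        congr 1
        ext x
        simp [inner_add_left, AddChar.map_add_eq_mul, mul_left_comm, mul_assoc, real_inner_comm]
      simp only [this, Finset.sum_mul, Finset.smul_sum, Circle.smul_def, smul_eq_mul]
      exact Finset.sum_congr rfl fun i _ => by ring
  have hn : ∀ n : ℕ, ∀ᵐ ξ : Space, ‖ξ‖ ≤ n → ∑ i ∈ s, σ i ξ * (𝓕 (f i) : L2) ξ = 0 := by
    intro n
    have hr : (0:ℝ) < 1 / (4 * (n + 1)) := by positivity
    -- The bump is so narrow that |2π⟨x, ξ⟩| < π/2 on its support for |ξ| ≤ n. The real part of its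
    -- inverse transform is then the integral of a nonnegative function that is positive on a ball,
    -- so the factor `𝓕⁻ φ` can be cancelled.
    let b : ContDiffBump (0 : Space) := ⟨1 / (8 * (n + 1)), 1 / (4 * (n + 1)), by positivity, by
      gcongr; norm_num⟩
    have hg₁ : HasCompactSupport (Complex.ofRealCLM ∘ b) := b.hasCompactSupport.comp_left rfl
    have hg₂ : ContDiff ℝ ∞ (Complex.ofRealCLM ∘ b) :=
      Complex.ofRealCLM.contDiff.comp b.contDiff
    filter_upwards [key b b.contDiff b.hasCompactSupport (hg₁.toSchwartzMap hg₂) fun x => by simp]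
      with ξ hξ hle
    refine (mul_eq_zero.1 hξ).resolve_right fun h0 => ?_
    rw [SchwartzMap.fourierInv_coe, Real.fourierInv_eq'] at h0
    have hint : Integrable fun v : Space => Complex.exp (((2 * Real.pi * inner ℝ v ξ : ℝ) : ℂ)
        * Complex.I) • ((hg₁.toSchwartzMap hg₂ : 𝓢(Space, ℂ)) : Space → ℂ) v := by
      refine (hg₁.toSchwartzMap hg₂).integrable.bdd_mul (c := 1)
        (by fun_prop) (Eventually.of_forall fun x => ?_)
      rw [Complex.norm_exp_ofReal_mul_I]
    have h1 := congrArg Complex.re h0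
    rw [← RCLike.re_eq_complex_re, ← integral_re hint] at h1
    have hpos : ∀ x : Space, 0 ≤ Real.cos (2 * Real.pi * inner ℝ x ξ) * b x ∧
        (x ∈ Metric.ball (0 : Space) (1 / (4 * (n + 1))) →
          0 < Real.cos (2 * Real.pi * inner ℝ x ξ) * b x) := by
      intro x
      by_cases hx : x ∈ Metric.ball (0 : Space) (1 / (4 * (n + 1)))
      · have hb : 0 < b x := b.pos_of_mem_ball hx
        have hx' : ‖x‖ < 1 / (4 * (n + 1)) := by simpa using hx
        have hc : 0 < Real.cos (2 * Real.pi * inner ℝ x ξ) := by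
          have h3 : |(inner ℝ x ξ : ℝ)| < 1 / 4 := by
            refine (abs_real_inner_le_norm x ξ).trans_lt ?_
            calc ‖x‖ * ‖ξ‖ ≤ ‖x‖ * (n + 1) := by gcongr; linarith
              _ < 1 / (4 * (n + 1)) * (n + 1) := by gcongr
              _ = 1 / 4 := by field_simp
          have := abs_lt.1 h3
          apply Real.cos_pos_of_mem_Ioo
          constructor <;> nlinarith [Real.pi_pos]
        exact ⟨by positivity, fun _ => by positivity⟩
      · have hb : b x = 0 := by
          by_contra h
          exact hx (b.support_eq ▸ (Function.mem_support.2 h))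
        exact ⟨by simp [hb], fun h => absurd h hx⟩
    have e : ∀ v : Space, RCLike.re (Complex.exp (((2 * Real.pi * inner ℝ v ξ : ℝ) : ℂ)
        * Complex.I) • ((hg₁.toSchwartzMap hg₂ : 𝓢(Space, ℂ)) : Space → ℂ) v)
        = Real.cos (2 * Real.pi * inner ℝ v ξ) * b v := by
      intro v
      simp only [HasCompactSupport.toSchwartzMap_toFun, Function.comp, smul_eq_mul,
        Complex.ofRealCLM_apply, RCLike.re_eq_complex_re, Complex.re_mul_ofReal,
        Complex.exp_ofReal_mul_I_re]
    have hint' := hint.re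
    simp_rw [e] at h1 hint'
    rw [RCLike.zero_re, integral_eq_zero_iff_of_nonneg (fun x => (hpos x).1) hint'] at h1
    have hm : volume (Metric.ball (0 : Space) (1 / (4 * ((n:ℝ) + 1)))) = 0 := by
      refine measure_mono_null (fun x hx => ?_) h1
      exact ((hpos x).2 hx).ne'
    exact (Metric.measure_ball_pos volume (0 : Space) hr).ne' hm
  filter_upwards [ae_all_iff.2 hn] with ξ h
  exact h ⌈‖ξ‖⌉₊ (Nat.le_ceil _)

/-- This turns identities between distributions, such as a vanishing divergence or the linear
equation, into identities between transforms at almost every frequency. -/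
lemma symbol_sum_eq_zero_iff {ι : Type*} (s : Finset ι) {σ : ι → Space → ℂ}
    (hσ : ∀ i, (σ i).HasTemperateGrowth) (f : ι → L2) :
    ∑ i ∈ s, mult (σ i) (toDist (f i)) = 0 ↔
      ∀ᵐ ξ, ∑ i ∈ s, σ i ξ * (𝓕 (f i) : L2) ξ = 0 := by
  constructor
  · intro h
    refine symbol_sum_eq_zero_of_test s hσ f fun ψ _ _ φ _ => ?_
    have := congrArg (fun T : 𝓢'(Space, ℂ) => T φ) h
    simpa using this
  · intro h
    ext φ
    have : (∑ i ∈ s, mult (σ i) (toDist (f i))) φ = ∑ i ∈ s, mult (σ i) (toDist (f i)) φ := by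
      simp
    rw [this]
    simp_rw [mult_toDist_apply (hσ _)]
    rw [← integral_finsetSum _ fun i _ => integrable_symbol_mul (hσ i) _ _]
    refine (integral_eq_zero_of_ae ?_).trans (by simp)
    filter_upwards [h] with ξ hξ
    rw [← Finset.sum_mul, hξ]
    simp

lemma mult_toDist_eq_iff {σ : Space → ℂ} (hσ : σ.HasTemperateGrowth) (f g : L2) :
    mult σ (toDist f) = toDist g ↔ ∀ᵐ ξ, (𝓕 g : L2) ξ = σ ξ * (𝓕 f : L2) ξ := by
  -- The identity is read as a sum of two terms, with the symbol `σ` on `f` and the symbol -1 on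
  -- `g`.
  have h := symbol_sum_eq_zero_iff (Finset.univ : Finset Bool)
    (σ := fun b => if b then σ else fun _ => -1) (fun b => by
      cases b
      · exact .const _
      · exact hσ) (fun b => if b then f else g)
  simp only [Fintype.sum_bool, if_true, Bool.false_eq_true, if_false] at h
  have e : mult (fun _ => -1) (toDist g) = - toDist g := by
    simp [mult]
  rw [e, ← sub_eq_add_neg, sub_eq_zero] at h
  rw [h]
  refine eventually_congr (Eventually.of_forall fun ξ => ?_)
  constructor <;> intro h' <;> linear_combination -h'

/-! ### Derivatives as Fourier multipliers -/

/-- The symbol `2πi ξⱼ` of `∂ⱼ`. -/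
def dsym (j : Fin 3) (ξ : Space) : ℂ := 2 * Real.pi * Complex.I * (ξ j : ℂ)

/-- The symbol `|2πξ|²` of `-Δ`. -/
def ksq (ξ : Space) : ℝ := (2 * Real.pi) ^ 2 * ‖ξ‖ ^ 2

/-- The symbol of `1 - αΔ`. -/
def wt (α : ℝ) (ξ : Space) : ℝ := 1 + α * ksq ξ

lemma ksq_nonneg (ξ : Space) : 0 ≤ ksq ξ := by unfold ksq; positivity

lemma wt_pos {α : ℝ} (hα : 0 < α) (ξ : Space) : 0 < wt α ξ := by
  have := ksq_nonneg ξ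
  unfold wt; positivity

lemma one_le_wt {α : ℝ} (hα : 0 < α) (ξ : Space) : 1 ≤ wt α ξ := by
  have := ksq_nonneg ξ
  unfold wt; nlinarith [mul_nonneg hα.le this]

lemma coord_temperate (j : Fin 3) : (fun ξ : Space => ((ξ j : ℝ) : ℂ)).HasTemperateGrowth :=
  (Complex.ofRealCLM.comp (EuclideanSpace.proj (𝕜 := ℝ) j)).hasTemperateGrowth

lemma dsym_temperate (j : Fin 3) : (dsym j).HasTemperateGrowth :=
  (Function.HasTemperateGrowth.const _).mul (coord_temperate j)

lemma ksq_temperate : (fun ξ : Space => (ksq ξ : ℂ)).HasTemperateGrowth := by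
  unfold ksq; fun_prop

lemma neg_ksq_temperate : (fun ξ : Space => -(ksq ξ : ℂ)).HasTemperateGrowth :=
  ksq_temperate.neg

lemma wt_temperate (α : ℝ) : (fun ξ : Space => (wt α ξ : ℂ)).HasTemperateGrowth := by
  unfold wt ksq; fun_prop

lemma continuous_ksq : Continuous ksq := by unfold ksq; fun_prop

lemma continuous_wt (α : ℝ) : Continuous (wt α) := by unfold wt ksq; fun_prop

lemma continuous_dsym (j : Fin 3) : Continuous (dsym j) := (dsym_temperate j).1.continuous

lemma normSq_dsym (j : Fin 3) (ξ : Space) : ‖dsym j ξ‖ ^ 2 = (2 * Real.pi) ^ 2 * (ξ j) ^ 2 := by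
  simp [dsym, mul_pow]

lemma sum_normSq_dsym (ξ : Space) : ∑ j, ‖dsym j ξ‖ ^ 2 = ksq ξ := by
  simp_rw [normSq_dsym, ksq, EuclideanSpace.norm_sq_eq, Finset.mul_sum]
  simp

lemma norm_dsym_le (j : Fin 3) (ξ : Space) : ‖dsym j ξ‖ ≤ 2 * Real.pi * ‖ξ‖ := by
  have := EuclideanSpace.norm_sq_eq ξ
  refine abs_le_of_sq_le_sq' ?_ (by positivity) |>.2
  rw [normSq_dsym, mul_pow _ ‖ξ‖]
  refine mul_le_mul_of_nonneg_left ?_ (sq_nonneg _)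
  have h2 : ξ j ^ 2 = ‖ξ j‖ ^ 2 := by simp
  rw [this, h2]
  exact Finset.single_le_sum (f := fun i => ‖ξ i‖ ^ 2) (fun i _ => sq_nonneg _)
    (Finset.mem_univ j)

lemma conj_dsym (j : Fin 3) (ξ : Space) : (starRingEnd ℂ) (dsym j ξ) = -dsym j ξ := by
  simp [dsym, Complex.conj_ofNat]

lemma pd_eq_mult (j : Fin 3) (T : 𝓢'(Space, ℂ)) : pd j T = mult (dsym j) T := by
  have h := TemperedDistribution.lineDeriv_eq_fourierMultiplierCLM
    (EuclideanSpace.single j (1 : ℝ) : Space) T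
  rw [pd, h, mult]
  have e : dsym j = (2 * Real.pi * Complex.I : ℂ) • fun ξ : Space => ((ξ j : ℝ) : ℂ) := by
    ext ξ; simp [dsym]
  rw [e, TemperedDistribution.fourierMultiplierCLM_smul (coord_temperate j)]
  simp [EuclideanSpace.inner_single_right]

lemma lap_eq_mult (T : 𝓢'(Space, ℂ)) : Δ T = mult (fun ξ => -(ksq ξ : ℂ)) T := by
  rw [TemperedDistribution.laplacian_eq_fourierMultiplierCLM, mult]
  have e : (fun ξ : Space => -(ksq ξ : ℂ)) =
      (-(2 * Real.pi) ^ 2 : ℂ) • fun ξ : Space => ((‖ξ‖ ^ 2 : ℝ) : ℂ) := by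
    ext ξ; simp [ksq]
  rw [e, TemperedDistribution.fourierMultiplierCLM_smul (by fun_prop)]
  rw [smul_apply, ← Complex.coe_smul]
  simp

lemma mult_mult {σ τ : Space → ℂ} (hσ : σ.HasTemperateGrowth) (hτ : τ.HasTemperateGrowth)
    (T : 𝓢'(Space, ℂ)) : mult τ (mult σ T) = mult (fun ξ => σ ξ * τ ξ) T :=
  TemperedDistribution.fourierMultiplierCLM_fourierMultiplierCLM_apply hσ hτ T

lemma mult_one (T : 𝓢'(Space, ℂ)) : mult (fun _ => 1) T = T := by
  simp [mult]

lemma mult_add {σ τ : Space → ℂ} (hσ : σ.HasTemperateGrowth) (hτ : τ.HasTemperateGrowth)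
    (T : 𝓢'(Space, ℂ)) : mult (fun ξ => σ ξ + τ ξ) T = mult σ T + mult τ T := by
  simp only [mult, TemperedDistribution.fourierMultiplierCLM_apply]
  rw [← FourierTransform.fourierInv_add]
  congr 1
  exact congrArg (fun A => A (𝓕 T)) (TemperedDistribution.smulLeftCLM_add (F := ℂ) hσ hτ)

lemma mult_smul {σ : Space → ℂ} (hσ : σ.HasTemperateGrowth) (c : ℂ)
    (T : 𝓢'(Space, ℂ)) : mult (fun ξ => c * σ ξ) T = c • mult σ T := by
  have := TemperedDistribution.fourierMultiplierCLM_smul (F := ℂ) hσ c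
  exact congrArg (fun A => A T) this

lemma filtered_eq_mult (α : ℝ) (T : 𝓢'(Space, ℂ)) :
    T - (α : ℂ) • Δ T = mult (fun ξ => (wt α ξ : ℂ)) T := by
  have e : (fun ξ => (wt α ξ : ℂ)) = fun ξ => (1 : ℂ) + (-α : ℂ) * (-(ksq ξ : ℂ)) := by
    ext ξ; simp [wt]
  have ht : (fun ξ => (-α : ℂ) * (-(ksq ξ : ℂ))).HasTemperateGrowth :=
    (Function.HasTemperateGrowth.const _).mul neg_ksq_temperate
  rw [e, mult_add (.const _) ht,
    mult_smul neg_ksq_temperate, mult_one, lap_eq_mult]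
  module

/-! ### Sobolev regularity of square integrable functions -/

/-- `f` is in `Hⁿ`, in terms of the Fourier transform. -/
def Reg (n : ℕ) (f : L2) : Prop := Integrable fun ξ => (1 + ‖ξ‖) ^ (2 * n) * ‖(𝓕 f : L2) ξ‖ ^ 2

/-- The square of the `Hⁿ` norm. -/
def regSq (n : ℕ) (f : L2) : ℝ := ∫ ξ, (1 + ‖ξ‖) ^ (2 * n) * ‖(𝓕 f : L2) ξ‖ ^ 2

lemma regSq_nonneg (n : ℕ) (f : L2) : 0 ≤ regSq n f := integral_nonneg fun _ => by positivity

lemma integrable_normSq (f : L2) : Integrable fun x => ‖f x‖ ^ 2 :=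
  (memLp_two_iff_integrable_sq_norm (Lp.aestronglyMeasurable f)).1 (Lp.memLp f)

lemma integral_normSq (f : L2) : ∫ x, ‖f x‖ ^ 2 = ‖f‖ ^ 2 := by
  have h := (norm_sq_eq_re_inner (𝕜 := ℂ) f)
  rw [h, L2.inner_def, ← integral_re (L2.integrable_inner f f)]
  exact integral_congr_ae (Eventually.of_forall fun x => by
    simp only; rw [← norm_sq_eq_re_inner (𝕜 := ℂ)])

lemma integral_normSq_fourier (f : L2) : ∫ ξ, ‖(𝓕 f : L2) ξ‖ ^ 2 = ‖f‖ ^ 2 := by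
  rw [integral_normSq, Lp.norm_fourier_eq]

lemma memLp_of_integrable_normSq {p : Space → ℂ} (hp : AEStronglyMeasurable p)
    (h : Integrable fun ξ => ‖p ξ‖ ^ 2) : MemLp p 2 :=
  (memLp_two_iff_integrable_sq_norm hp).2 h

lemma exists_fourier_eq {p : Space → ℂ} (hp : MemLp p 2) : ∃ g : L2, (𝓕 g : L2) =ᵐ[volume] p := by
  refine ⟨𝓕⁻ (hp.toLp p), ?_⟩
  rw [FourierTransform.fourier_fourierInv_eq]
  exact hp.coeFn_toLp

lemma Reg.aesm (f : L2) : AEStronglyMeasurable (fun ξ => (𝓕 f : L2) ξ) :=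
  Lp.aestronglyMeasurable _

lemma Reg.mono {m n : ℕ} (h : m ≤ n) {f : L2} (hf : Reg n f) : Reg m f := by
  refine Integrable.mono' hf ?_ (Eventually.of_forall fun ξ => ?_)
  · have := Reg.aesm f; fun_prop
  · rw [Real.norm_of_nonneg (by positivity)]
    gcongr
    linarith [norm_nonneg ξ]

/-- If the symbol is dominated by `(1 + |ξ|)ᵐ` then the multiplier loses at most `m` derivatives. -/
lemma Reg.symbol {m n : ℕ} {f g : L2} (hf : Reg (n + m) f) {σ : Space → ℂ} {c : ℝ}
    (hσ : ∀ ξ, ‖σ ξ‖ ≤ c * (1 + ‖ξ‖) ^ m)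
    (hg : ∀ᵐ ξ, (𝓕 g : L2) ξ = σ ξ * (𝓕 f : L2) ξ) :
    Reg n g ∧ regSq n g ≤ c ^ 2 * regSq (n + m) f := by
  have key : ∀ᵐ ξ, (1 + ‖ξ‖) ^ (2 * n) * ‖(𝓕 g : L2) ξ‖ ^ 2 ≤
      c ^ 2 * ((1 + ‖ξ‖) ^ (2 * (n + m)) * ‖(𝓕 f : L2) ξ‖ ^ 2) := by
    filter_upwards [hg] with ξ h
    rw [h, norm_mul, mul_pow]
    calc (1 + ‖ξ‖) ^ (2 * n) * (‖σ ξ‖ ^ 2 * ‖(𝓕 f : L2) ξ‖ ^ 2)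
        ≤ (1 + ‖ξ‖) ^ (2 * n) * ((c * (1 + ‖ξ‖) ^ m) ^ 2 * ‖(𝓕 f : L2) ξ‖ ^ 2) := by
          gcongr; exact hσ ξ
      _ = _ := by ring
  have hi : Integrable fun ξ => c ^ 2 * ((1 + ‖ξ‖) ^ (2 * (n + m)) * ‖(𝓕 f : L2) ξ‖ ^ 2) :=
    Integrable.const_mul hf _
  have hg' : Reg n g := by
    refine Integrable.mono' hi ?_ ?_
    · have := Reg.aesm g; fun_prop
    · filter_upwards [key] with ξ h
      rwa [Real.norm_of_nonneg (by positivity)]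
  refine ⟨hg', ?_⟩
  rw [regSq, regSq, ← integral_const_mul]
  exact integral_mono_ae hg' hi key

lemma exists_symbol {m : ℕ} {f : L2} (hf : Reg m f) {σ : Space → ℂ} (hσm : Continuous σ) {c : ℝ}
    (hσ : ∀ ξ, ‖σ ξ‖ ≤ c * (1 + ‖ξ‖) ^ m) :
    ∃ g : L2, ∀ᵐ ξ, (𝓕 g : L2) ξ = σ ξ * (𝓕 f : L2) ξ := by
  refine exists_fourier_eq (p := fun ξ => σ ξ * (𝓕 f : L2) ξ) (memLp_of_integrable_normSq ?_ ?_)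
  · exact hσm.aestronglyMeasurable.mul (Reg.aesm f)
  · refine Integrable.mono' (Integrable.const_mul hf (c ^ 2)) ?_ (Eventually.of_forall fun ξ => ?_)
    · have := hσm.aestronglyMeasurable (μ := volume).mul (Reg.aesm f)
      exact this.norm.pow 2
    · rw [Real.norm_of_nonneg (by positivity), norm_mul, mul_pow]
      calc ‖σ ξ‖ ^ 2 * ‖(𝓕 f : L2) ξ‖ ^ 2
          ≤ ((c * (1 + ‖ξ‖) ^ m) ^ 2 * ‖(𝓕 f : L2) ξ‖ ^ 2) := by
            gcongr; exact hσ ξ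
        _ = _ := by ring

lemma norm_dsym_le' (j : Fin 3) (ξ : Space) : ‖dsym j ξ‖ ≤ (2 * Real.pi) * (1 + ‖ξ‖) ^ 1 := by
  refine (norm_dsym_le j ξ).trans ?_
  have := Real.pi_pos
  nlinarith

lemma norm_ksq_le (ξ : Space) : ‖(ksq ξ : ℂ)‖ ≤ (2 * Real.pi) ^ 2 * (1 + ‖ξ‖) ^ 2 := by
  rw [Complex.norm_real, Real.norm_of_nonneg (ksq_nonneg ξ), ksq]
  have := norm_nonneg ξ
  gcongr
  linarith

lemma norm_dLap_le (j : Fin 3) (ξ : Space) :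
    ‖-(ksq ξ : ℂ) * dsym j ξ‖ ≤ (2 * Real.pi) ^ 3 * (1 + ‖ξ‖) ^ 3 := by
  rw [norm_mul, norm_neg]
  calc _ ≤ ((2 * Real.pi) ^ 2 * (1 + ‖ξ‖) ^ 2) * ((2 * Real.pi) * (1 + ‖ξ‖) ^ 1) :=
        mul_le_mul (norm_ksq_le ξ) (norm_dsym_le' j ξ) (norm_nonneg _) (by positivity)
    _ = _ := by ring

lemma pd_toDist_iff (j : Fin 3) (f g : L2) :
    pd j (toDist f) = toDist g ↔ ∀ᵐ ξ, (𝓕 g : L2) ξ = dsym j ξ * (𝓕 f : L2) ξ := by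
  rw [pd_eq_mult, mult_toDist_eq_iff (dsym_temperate j)]

/-- In H¹ the symbol times the transform is square integrable, so `rep` returns the genuine
derivative and not its default value 0. -/
lemma fourier_dL2 (j : Fin 3) {f : L2} (hf : Reg 1 f) :
    ∀ᵐ ξ, (𝓕 (dL2 j f) : L2) ξ = dsym j ξ * (𝓕 f : L2) ξ := by
  obtain ⟨g, hg⟩ := exists_symbol hf (continuous_dsym j) (norm_dsym_le' j)
  have : dL2 j f = g := by
    rw [dL2, (pd_toDist_iff j f g).2 hg, rep_toDist]
  rwa [this]

lemma pd_toDist (j : Fin 3) {f : L2} (hf : Reg 1 f) : pd j (toDist f) = toDist (dL2 j f) :=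
  (pd_toDist_iff j _ _).2 (fourier_dL2 j hf)

lemma fourier_dLapL2 (j : Fin 3) {f : L2} (hf : Reg 3 f) :
    ∀ᵐ ξ, (𝓕 (dLapL2 j f) : L2) ξ = -(ksq ξ : ℂ) * dsym j ξ * (𝓕 f : L2) ξ := by
  obtain ⟨g, hg⟩ := exists_symbol hf (σ := fun ξ => -(ksq ξ : ℂ) * dsym j ξ)
    (by have := continuous_ksq; have := continuous_dsym j; fun_prop) (norm_dLap_le j)
  have ht : (fun ξ => -(ksq ξ : ℂ) * dsym j ξ).HasTemperateGrowth :=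
    neg_ksq_temperate.mul (dsym_temperate j)
  have : dLapL2 j f = g := by
    rw [dLapL2, lap_eq_mult, pd_eq_mult, mult_mult neg_ksq_temperate (dsym_temperate j),
      (mult_toDist_eq_iff ht f g).2 hg, rep_toDist]
  rwa [this]

lemma Reg.dL2 {n : ℕ} {f : L2} (hf : Reg (n + 1) f) (j : Fin 3) :
    Reg n (dL2 j f) ∧ regSq n (SecondGrade.dL2 j f) ≤ (2 * Real.pi) ^ 2 * regSq (n + 1) f :=
  hf.symbol (norm_dsym_le' j) (fourier_dL2 j (hf.mono (by omega)))

/-- The weights are comparable because (1 + |ξ|)² ≤ 2 (1 + |ξ|²). -/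
lemma reg_of_memSobolev {n : ℕ} {f : L2}
    (hf : TemperedDistribution.MemSobolev n 2 (toDist f)) : Reg n f := by
  obtain ⟨g, hg⟩ := hf
  have ht : (fun ξ : Space => (((1 + ‖ξ‖ ^ 2) ^ ((n : ℝ) / 2) : ℝ) : ℂ)).HasTemperateGrowth := by
    fun_prop
  have hg' := (mult_toDist_eq_iff ht f g).1 hg
  refine Integrable.mono' ((integrable_normSq (𝓕 g)).const_mul (2 ^ n)) ?_ ?_
  · have := Reg.aesm f; fun_prop
  · filter_upwards [hg'] with ξ h
    rw [h, Real.norm_of_nonneg (by positivity), norm_mul, mul_pow, Complex.norm_real,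
      Real.norm_of_nonneg (by positivity), ← mul_assoc]
    gcongr
    have e : ((1 + ‖ξ‖ ^ 2) ^ ((n : ℝ) / 2)) ^ 2 = (1 + ‖ξ‖ ^ 2) ^ n := by
      rw [← Real.rpow_natCast _ 2, ← Real.rpow_mul (by positivity), ← Real.rpow_natCast _ n]
      congr 1
      push_cast
      ring
    rw [e, ← mul_pow, pow_mul]
    gcongr
    nlinarith [sq_nonneg (1 - ‖ξ‖)]

lemma Reg.memSobolev {n : ℕ} {f : L2} (hf : Reg n f) :
    TemperedDistribution.MemSobolev n 2 (toDist f) := by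
  have ht : (fun ξ : Space => (((1 + ‖ξ‖ ^ 2) ^ ((n : ℝ) / 2) : ℝ) : ℂ)).HasTemperateGrowth := by
    fun_prop
  obtain ⟨g, hg⟩ := exists_symbol hf (σ := fun ξ => (((1 + ‖ξ‖ ^ 2) ^ ((n : ℝ) / 2) : ℝ) : ℂ))
    ht.1.continuous (c := 1) (fun ξ => by
      rw [Complex.norm_real, Real.norm_of_nonneg (by positivity), one_mul]
      calc (1 + ‖ξ‖ ^ 2) ^ ((n : ℝ) / 2) ≤ ((1 + ‖ξ‖) ^ 2) ^ ((n : ℝ) / 2) := by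
            gcongr; nlinarith [norm_nonneg ξ]
        _ = (1 + ‖ξ‖) ^ n := by
            rw [← Real.rpow_natCast, ← Real.rpow_mul (by positivity), ← Real.rpow_natCast]
            congr 1; push_cast; field_simp)
  exact ⟨g, (mult_toDist_eq_iff ht f g).2 hg⟩

/-! ### The Cauchy-Schwarz inequality -/

lemma integrable_mul_of_sq {X : Type*} [MeasurableSpace X] {ν : Measure X} {p q : X → ℝ}
    (hp : AEStronglyMeasurable p ν) (hq : AEStronglyMeasurable q ν)
    (hp2 : Integrable (fun x => p x ^ 2) ν) (hq2 : Integrable (fun x => q x ^ 2) ν) :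
    Integrable (fun x => p x * q x) ν :=
  ((memLp_two_iff_integrable_sq hp).2 hp2).integrable_mul ((memLp_two_iff_integrable_sq hq).2 hq2)

lemma integral_mul_le_sqrt {X : Type*} [MeasurableSpace X] {ν : Measure X} {p q : X → ℝ}
    (hp : AEStronglyMeasurable p ν) (hq : AEStronglyMeasurable q ν)
    (hp2 : Integrable (fun x => p x ^ 2) ν) (hq2 : Integrable (fun x => q x ^ 2) ν) :
    ∫ x, p x * q x ∂ν ≤ Real.sqrt (∫ x, p x ^ 2 ∂ν) * Real.sqrt (∫ x, q x ^ 2 ∂ν) := by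
  have hP := (memLp_two_iff_integrable_sq hp).2 hp2
  have hQ := (memLp_two_iff_integrable_sq hq).2 hq2
  have h := integral_mul_norm_le_Lp_mul_Lq (μ := ν) (f := p) (g := q)
    (p := 2) (q := 2) Real.HolderConjugate.two_two (by simpa using hP) (by simpa using hQ)
  simp only [Real.norm_eq_abs, Real.rpow_ofNat, sq_abs] at h
  rw [Real.sqrt_eq_rpow, Real.sqrt_eq_rpow]
  refine le_trans (integral_mono (integrable_mul_of_sq hp hq hp2 hq2) ?_ fun x => ?_) h
  · simpa [abs_mul] using (integrable_mul_of_sq hp hq hp2 hq2).abs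
  · simpa [abs_mul] using le_abs_self (p x * q x)

/-! ### Multiplication operators -/

/-- Multiplication by a bounded measurable function, as an operator on `L²`. -/
def mulL (θ : Space → ℂ) (h : MemLp θ ⊤) : L2 →L[ℂ] L2 :=
  (ContinuousLinearMap.mul ℂ ℂ).holderL volume ⊤ 2 2 (h.toLp θ)

lemma mulL_coe {θ : Space → ℂ} (h : MemLp θ ⊤) (f : L2) :
    ∀ᵐ ξ, mulL θ h f ξ = θ ξ * f ξ := by
  have h1 := (ContinuousLinearMap.mul ℂ ℂ).coeFn_holder (r := 2) (h.toLp θ) f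
  filter_upwards [h1, h.coeFn_toLp] with ξ h1 h2
  rw [← h2]
  exact h1

lemma memLp_top_of_le {θ : Space → ℂ} (hm : AEStronglyMeasurable θ) {c : ℝ}
    (hc : ∀ ξ, ‖θ ξ‖ ≤ c) : MemLp θ ⊤ :=
  memLp_top_of_bound hm c (Eventually.of_forall hc)

/-! ### Functions with integrable Fourier transform -/

/-- The first `n` derivatives of `f` have integrable Fourier transforms. -/
def Wiener (n : ℕ) (f : L2) : Prop := Integrable fun ξ => (1 + ‖ξ‖) ^ n * ‖(𝓕 f : L2) ξ‖

lemma Wiener.mono {m n : ℕ} (h : m ≤ n) {f : L2} (hf : Wiener n f) : Wiener m f := by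
  refine Integrable.mono' hf ?_ (Eventually.of_forall fun ξ => ?_)
  · have := Reg.aesm f; fun_prop
  · rw [Real.norm_of_nonneg (by positivity)]
    gcongr
    linarith [norm_nonneg ξ]

lemma Wiener.integrable {n : ℕ} {f : L2} (hf : Wiener n f) :
    Integrable fun ξ => (𝓕 f : L2) ξ := by
  rw [← integrable_norm_iff (Reg.aesm f)]
  simpa [Wiener] using hf.mono (Nat.zero_le n)

/-- The constant of the embedding of `H²` into the functions with integrable transform. -/
def embConst : ℝ := Real.sqrt (∫ ξ : Space, (((1 + ‖ξ‖) ^ 2)⁻¹) ^ 2)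

lemma embConst_nonneg : 0 ≤ embConst := Real.sqrt_nonneg _

lemma integrable_weight : Integrable fun ξ : Space => (((1 + ‖ξ‖) ^ 2)⁻¹) ^ 2 := by
  have h := integrable_one_add_norm (E := Space) (μ := volume) (r := 4) (by simp; norm_num)
  refine h.congr (Eventually.of_forall fun ξ => ?_)
  have : (0:ℝ) < 1 + ‖ξ‖ := by positivity
  simp only
  rw [Real.rpow_neg this.le]
  norm_cast
  rw [inv_pow, ← pow_mul]

/-- Cauchy-Schwarz against (1 + |ξ|)^(-2), which is square integrable in dimension three because 4 >
3. -/
lemma Reg.wiener {n : ℕ} {f : L2} (hf : Reg (n + 2) f) :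
    Wiener n f ∧ ∫ ξ, (1 + ‖ξ‖) ^ n * ‖(𝓕 f : L2) ξ‖ ≤
      embConst * Real.sqrt (regSq (n + 2) f) := by
  have e : ∀ ξ, (1 + ‖ξ‖) ^ n * ‖(𝓕 f : L2) ξ‖ =
      (((1 + ‖ξ‖) ^ 2)⁻¹) * ((1 + ‖ξ‖) ^ (n + 2) * ‖(𝓕 f : L2) ξ‖) := by
    intro ξ
    have : (0:ℝ) < 1 + ‖ξ‖ := by positivity
    field_simp
    ring
  have e2 : ∀ ξ, ((1 + ‖ξ‖) ^ (n + 2) * ‖(𝓕 f : L2) ξ‖) ^ 2 =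
      (1 + ‖ξ‖) ^ (2 * (n + 2)) * ‖(𝓕 f : L2) ξ‖ ^ 2 := fun ξ => by ring
  have hm1 : AEStronglyMeasurable (fun ξ : Space => (((1 + ‖ξ‖) ^ 2)⁻¹)) :=
    (Continuous.inv₀ (by fun_prop) fun ξ => by positivity).aestronglyMeasurable
  have hm2 : AEStronglyMeasurable (fun ξ : Space => (1 + ‖ξ‖) ^ (n + 2) * ‖(𝓕 f : L2) ξ‖) := by
    have := Reg.aesm f; fun_prop
  have hi : Integrable fun ξ => ((1 + ‖ξ‖) ^ (n + 2) * ‖(𝓕 f : L2) ξ‖) ^ 2 := by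
    simp_rw [e2]; exact hf
  unfold Wiener
  simp_rw [e]
  refine ⟨integrable_mul_of_sq hm1 hm2 integrable_weight hi, ?_⟩
  refine (integral_mul_le_sqrt hm1 hm2 integrable_weight hi).trans_eq ?_
  simp_rw [e2]
  rfl

/-- Fourier inversion for a function in L² whose transform is integrable. The two sides have the
same pairing with every Schwartz function, by Parseval on each side. -/
lemma ae_eq_fourierInv {f : L2} (hf : Integrable fun ξ => (𝓕 f : L2) ξ) :
    ∀ᵐ x, f x = 𝓕⁻ (fun ξ => (𝓕 f : L2) ξ) x := by
  have h1 : LocallyIntegrable fun x => f x := (Lp.memLp f).locallyIntegrable (by norm_num)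
  have h2 : LocallyIntegrable (𝓕⁻ (fun ξ => (𝓕 f : L2) ξ)) :=
    (continuous_fourierInv hf).locallyIntegrable
  have h := ae_zero_of_integral_schwartz (h1.sub h2) fun φ => by
    have i1 := integrable_mul_schwartz f φ
    have i2 : Integrable fun x => 𝓕⁻ (fun ξ => (𝓕 f : L2) ξ) x * φ x :=
      φ.integrable.bdd_mul (c := ∫ ξ, ‖(𝓕 f : L2) ξ‖) (continuous_fourierInv hf).aestronglyMeasurable
        (Eventually.of_forall fun x => norm_fourierInv_le _ x)
    simp only [Pi.sub_apply, sub_mul]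
    rw [integral_sub i1 i2, integral_fourierInv_mul hf φ.integrable, sub_eq_zero]
    have e : φ = 𝓕 (𝓕⁻ φ) := (FourierTransform.fourier_fourierInv_eq φ).symm
    calc ∫ x, f x * φ x = toDist f φ := by rw [toDist_apply]; simp_rw [mul_comm]
      _ = toDist (𝓕 f) (𝓕⁻ φ) := by
        conv_lhs => rw [e]
        rw [← TemperedDistribution.fourier_apply, fourier_toDist]
      _ = _ := by
        rw [toDist_apply]; simp_rw [mul_comm, SchwartzMap.fourierInv_coe]
  filter_upwards [h] with x hx
  simpa [sub_eq_zero] using hx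

lemma ae_norm_le {f : L2} (hf : Integrable fun ξ => (𝓕 f : L2) ξ) :
    ∀ᵐ x, ‖f x‖ ≤ ∫ ξ, ‖(𝓕 f : L2) ξ‖ := by
  filter_upwards [ae_eq_fourierInv hf] with x hx
  rw [hx]
  exact norm_fourierInv_le _ x

/-! ### Integration by parts -/

lemma integrable_mul_L2 (f g : L2) : Integrable fun x => f x * g x :=
  (Lp.memLp f).integrable_mul (Lp.memLp g)

/-- The plane wave `exp(-2πi ⟨x, ζ⟩)`. -/
def wave (ζ x : Space) : ℂ := Real.fourierChar (-(inner ℝ x ζ))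

lemma norm_wave (ζ x : Space) : ‖wave ζ x‖ = 1 := Circle.norm_coe _

lemma wave_eq (ζ x : Space) :
    wave ζ x = Complex.exp (((-(2 * Real.pi) * inner ℝ x ζ : ℝ) : ℂ) * Complex.I) := by
  simp [wave, Real.fourierChar_apply]

lemma cexp_mul_I_temperate :
    (fun t : ℝ => Complex.exp ((t : ℂ) * Complex.I)).HasTemperateGrowth := by
  have hd : ∀ n, iteratedDeriv n (fun t : ℝ => Complex.exp ((t : ℂ) * Complex.I)) =
      fun t : ℝ => Complex.I ^ n * Complex.exp ((t : ℂ) * Complex.I) := by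
    intro n
    induction n with
    | zero => simp
    | succ n ih =>
      rw [iteratedDeriv_succ, ih]
      ext t
      have h1 : HasDerivAt (fun t : ℝ => (t : ℂ) * Complex.I) (1 * Complex.I) t :=
        (Complex.ofRealCLM.hasDerivAt).mul_const _
      rw [(h1.cexp.const_mul _).deriv]
      ring
  refine ⟨?_, fun n => ⟨0, 1, fun t => ?_⟩⟩
  · exact (Complex.ofRealCLM.contDiff.mul contDiff_const).cexp
  · rw [norm_iteratedFDeriv_eq_norm_iteratedDeriv, hd]
    simp [Complex.norm_exp_ofReal_mul_I]

lemma wave_temperate (ζ : Space) : (wave ζ).HasTemperateGrowth := by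
  have h : (fun x : Space => -(2 * Real.pi) * inner ℝ x ζ).HasTemperateGrowth := by fun_prop
  have := cexp_mul_I_temperate.comp h
  rwa [show wave ζ = (fun t : ℝ => Complex.exp ((t : ℂ) * Complex.I)) ∘
    (fun x : Space => -(2 * Real.pi) * inner ℝ x ζ) from funext fun x => wave_eq ζ x]

lemma fourier_eq_wave (p : Space → ℂ) (ζ : Space) : 𝓕 p ζ = ∫ x, wave ζ x * p x := by
  simp [Real.fourier_eq, wave, Circle.smul_def]

lemma hasFDerivAt_wave (j : Fin 3) (ζ x : Space) :
    lineDeriv ℝ (wave ζ) x (EuclideanSpace.single j 1) = -dsym j ζ * wave ζ x := by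
  have h2 : HasDerivAt (fun t : ℝ => (((-(2 * Real.pi) *
      inner ℝ (x + t • EuclideanSpace.single j (1:ℝ)) ζ : ℝ) : ℂ) * Complex.I))
      (-dsym j ζ) 0 := by
    have e : (fun t : ℝ => (((-(2 * Real.pi) *
      inner ℝ (x + t • EuclideanSpace.single j (1:ℝ)) ζ : ℝ) : ℂ) * Complex.I)) =
      fun t : ℝ => (-(2 * Real.pi) * inner ℝ x ζ : ℝ) * Complex.I + (t : ℂ) * (-dsym j ζ) := by
      ext t
      simp [inner_add_left, inner_smul_left, EuclideanSpace.inner_single_left, dsym]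
      ring
    rw [e]
    simpa using ((Complex.ofRealCLM.hasDerivAt (x := (0:ℝ))).mul_const (-dsym j ζ)).const_add
      (((-(2 * Real.pi) * inner ℝ x ζ : ℝ) : ℂ) * Complex.I)
  have h3 := h2.cexp
  rw [lineDeriv]
  simp_rw [wave_eq]
  rw [h3.deriv]
  simp
  ring

/-- The Schwartz function `exp(-2πi ⟨·, ζ⟩) G`. -/
def modulate (ζ : Space) (G : 𝓢(Space, ℂ)) : 𝓢(Space, ℂ) := SchwartzMap.smulLeftCLM ℂ (wave ζ) G

lemma modulate_apply (ζ : Space) (G : 𝓢(Space, ℂ)) (x : Space) :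
    modulate ζ G x = wave ζ x * G x := by
  simp [modulate, SchwartzMap.smulLeftCLM_apply_apply (wave_temperate ζ)]

lemma lineDeriv_modulate (j : Fin 3) (ζ : Space) (G : 𝓢(Space, ℂ)) (x : Space) :
    (∂_{(EuclideanSpace.single j (1 : ℝ) : Space)} (modulate ζ G)) x =
      wave ζ x * (∂_{(EuclideanSpace.single j (1 : ℝ) : Space)} G) x
        - dsym j ζ * (wave ζ x * G x) := by
  have hw : DifferentiableAt ℝ (wave ζ) x :=
    ((wave_temperate ζ).1.differentiable (by simp)).differentiableAt
  have e : (modulate ζ G : Space → ℂ) = fun x => wave ζ x * G x := funext (modulate_apply ζ G)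
  have h1 := hasFDerivAt_wave j ζ x
  rw [hw.lineDeriv_eq_fderiv] at h1
  rw [SchwartzMap.lineDerivOp_apply_eq_fderiv, SchwartzMap.lineDerivOp_apply_eq_fderiv, e,
    fderiv_fun_mul hw G.differentiableAt]
  simp [h1]
  ring

/-- The definition of the distributional derivative, tested against the Schwartz function
exp(-2πi⟨·, ζ⟩) G. The derivative of the wave produces the term with `dsym`. -/
lemma integral_modulate_schwartz (j : Fin 3) (ζ : Space) {f : L2} (hf : Reg 1 f)
    (G : 𝓢(Space, ℂ)) :
    ∫ x, wave ζ x * (dL2 j f x * G x +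
      f x * (∂_{(EuclideanSpace.single j (1 : ℝ) : Space)} G) x - dsym j ζ * (f x * G x)) = 0 := by
  have h := congrArg (fun T : 𝓢'(Space, ℂ) => T (modulate ζ G)) (pd_toDist j hf)
  simp only [pd, TemperedDistribution.lineDerivOp_apply_apply, toDist_apply] at h
  have i1 := integrable_mul_schwartz (dL2 j f) (modulate ζ G)
  have i2 := integrable_mul_schwartz f
    (∂_{(EuclideanSpace.single j (1 : ℝ) : Space)} (modulate ζ G))
  have e : ∀ x, wave ζ x * (dL2 j f x * G x +
      f x * (∂_{(EuclideanSpace.single j (1 : ℝ) : Space)} G) x - dsym j ζ * (f x * G x)) =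
      dL2 j f x * modulate ζ G x +
      f x * (∂_{(EuclideanSpace.single j (1 : ℝ) : Space)} (modulate ζ G)) x := by
    intro x
    rw [lineDeriv_modulate, modulate_apply]
    ring
  simp_rw [e]
  rw [integral_add i1 i2]
  simp_rw [mul_comm (dL2 j f _), mul_comm (f _)]
  rw [← h, ← integral_add]
  · simp
  · simpa [mul_comm] using i2.neg
  · simpa [mul_comm] using i2

lemma continuous_integral_mul (p : L2) : Continuous fun q : L2 => ∫ x, p x * q x := by
  have h := ((ContinuousLinearMap.mul ℂ ℂ).lpPairing (volume : Measure Space) 2 2 p).continuous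
  refine h.congr fun q => ?_
  rw [ContinuousLinearMap.lpPairing_eq_integral]
  rfl

/-! ### Bessel potentials and the product rule in H¹ -/

/-- The symbol of the Bessel potential of order `-1`. -/
def bsym (ξ : Space) : ℂ := (((1 + ‖ξ‖ ^ 2) ^ (-(1:ℝ) / 2) : ℝ) : ℂ)

lemma bsym_temperate : bsym.HasTemperateGrowth := by unfold bsym; fun_prop

lemma norm_bsym (ξ : Space) : ‖bsym ξ‖ ^ 2 = (1 + ‖ξ‖ ^ 2)⁻¹ := by
  rw [bsym, Complex.norm_real, Real.norm_of_nonneg (by positivity), ← Real.rpow_natCast,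
    ← Real.rpow_mul (by positivity)]
  norm_num
  rw [Real.rpow_neg_one]

lemma bsym_memLp : MemLp bsym ⊤ := by
  refine memLp_top_of_le bsym_temperate.1.continuous.aestronglyMeasurable (c := 1) fun ξ => ?_
  have h := norm_bsym ξ
  have : (1 + ‖ξ‖ ^ 2)⁻¹ ≤ 1 := inv_le_one_of_one_le₀ (by nlinarith [norm_nonneg ξ])
  nlinarith [norm_nonneg (bsym ξ)]

lemma dsym_bsym_memLp (j : Fin 3) : MemLp (fun ξ => dsym j ξ * bsym ξ) ⊤ := by
  refine memLp_top_of_le ((dsym_temperate j).1.continuous.mul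
    bsym_temperate.1.continuous).aestronglyMeasurable (c := 2 * Real.pi) fun ξ => ?_
  refine (abs_le_of_sq_le_sq' ?_ (by positivity)).2
  rw [norm_mul, mul_pow, norm_bsym]
  have h0 := norm_dsym_le j ξ
  calc ‖dsym j ξ‖ ^ 2 * (1 + ‖ξ‖ ^ 2)⁻¹ ≤ (2 * Real.pi * ‖ξ‖) ^ 2 * (1 + ‖ξ‖ ^ 2)⁻¹ := by gcongr
    _ ≤ (2 * Real.pi) ^ 2 := by
      rw [← div_eq_mul_inv, div_le_iff₀ (by positivity)]
      nlinarith [sq_nonneg (2 * Real.pi)]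

/-- The Fourier multiplier with a bounded symbol, on `L²`. -/
def fmulL (θ : Space → ℂ) (h : MemLp θ ⊤) : L2 →L[ℂ] L2 :=
  (FourierTransform.fourierInvCLM ℂ L2) ∘L (mulL θ h) ∘L (FourierTransform.fourierCLM ℂ L2)

lemma fourier_fmulL {θ : Space → ℂ} (h : MemLp θ ⊤) (f : L2) :
    ∀ᵐ ξ, (𝓕 (fmulL θ h f) : L2) ξ = θ ξ * (𝓕 f : L2) ξ := by
  have : 𝓕 (fmulL θ h f) = mulL θ h (𝓕 f) := FourierTransform.fourier_fourierInv_eq _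
  rw [this]
  exact mulL_coe h _

lemma eq_of_fourier_ae {f g : L2} (h : ∀ᵐ ξ, (𝓕 f : L2) ξ = (𝓕 g : L2) ξ) : f = g := by
  have : 𝓕 f = 𝓕 g := Lp.ext h
  simpa using congrArg (fun x : L2 => 𝓕⁻ x) this

/-- The Bessel potential preserves Schwartz functions. Density of these in L² thereby becomes
density in H¹, together with the derivatives. -/
lemma fmulL_schwartz (h : 𝓢(Space, ℂ)) (j : Fin 3) : ∃ G : 𝓢(Space, ℂ),
    fmulL bsym bsym_memLp (h.toLp 2) = G.toLp 2 ∧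
    fmulL _ (dsym_bsym_memLp j) (h.toLp 2) =
      (∂_{(EuclideanSpace.single j (1 : ℝ) : Space)} G).toLp 2 := by
  refine ⟨𝓕⁻ (SchwartzMap.smulLeftCLM ℂ bsym (𝓕 h)), eq_of_fourier_ae ?_, eq_of_fourier_ae ?_⟩
  · rw [SchwartzMap.toLp_fourier_eq, FourierTransform.fourier_fourierInv_eq]
    filter_upwards [fourier_fmulL bsym_memLp (h.toLp 2),
      (SchwartzMap.smulLeftCLM ℂ bsym (𝓕 h)).coeFn_toLp 2 volume,
      (𝓕 h : 𝓢(Space, ℂ)).coeFn_toLp 2 volume] with ξ h1 h2 h3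
    rw [SchwartzMap.toLp_fourier_eq] at h1
    rw [h1, h2, h3, SchwartzMap.smulLeftCLM_apply_apply bsym_temperate]
    rfl
  · rw [SchwartzMap.toLp_fourier_eq, SchwartzMap.fourier_lineDerivOp_eq,
      FourierTransform.fourier_fourierInv_eq]
    filter_upwards [fourier_fmulL (dsym_bsym_memLp j) (h.toLp 2),
      ((2 * Real.pi * Complex.I) • SchwartzMap.smulLeftCLM ℂ
        (inner ℝ · (EuclideanSpace.single j (1 : ℝ) : Space))
        (SchwartzMap.smulLeftCLM ℂ bsym (𝓕 h))).coeFn_toLp 2 volume,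
      (𝓕 h : 𝓢(Space, ℂ)).coeFn_toLp 2 volume] with ξ h1 h2 h3
    rw [SchwartzMap.toLp_fourier_eq] at h1
    have ht : (inner ℝ · (EuclideanSpace.single j (1 : ℝ) : Space)).HasTemperateGrowth := by
      fun_prop
    rw [h1, h2, h3]
    rw [smul_apply, SchwartzMap.smulLeftCLM_apply_apply ht,
      SchwartzMap.smulLeftCLM_apply_apply bsym_temperate]
    simp [EuclideanSpace.inner_single_right, dsym]
    ring

lemma wave_memLp (ζ : Space) : MemLp (wave ζ) ⊤ :=
  memLp_top_of_le (wave_temperate ζ).1.continuous.aestronglyMeasurable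
    (fun x => (norm_wave ζ x).le)

/-- The transform of ∂ⱼ(fg) is the symbol times the transform of fg, although fg is only known to be
integrable. For Schwartz `g` this is the definition of the weak derivative. The general case follows
by density after writing `g` as the Bessel potential of some `h` in L², since both sides are
continuous in `h`. -/
lemma integral_wave_mul (j : Fin 3) (ζ : Space) {f g : L2} (hf : Reg 1 f) (hg : Reg 1 g) :
    ∫ x, wave ζ x * (dL2 j f x * g x + f x * dL2 j g x) =
      dsym j ζ * ∫ x, wave ζ x * (f x * g x) := by
  -- With these choices the claim reads ∫ P g + ∫ Q ∂ⱼg = 0, which is visibly continuous in (g, ∂ⱼg)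
  -- for the L² norms.
  set P : L2 := mulL (wave ζ) (wave_memLp ζ) (dL2 j f - dsym j ζ • f) with hP
  set Q : L2 := mulL (wave ζ) (wave_memLp ζ) f with hQ
  have hPe : ∀ᵐ x, P x = wave ζ x * (dL2 j f x - dsym j ζ * f x) := by
    filter_upwards [mulL_coe (wave_memLp ζ) (dL2 j f - dsym j ζ • f),
      Lp.coeFn_sub (dL2 j f) (dsym j ζ • f), Lp.coeFn_smul (dsym j ζ) f] with x h1 h2 h3
    rw [hP, h1, h2]
    simp [h3]
  have hQe : ∀ᵐ x, Q x = wave ζ x * f x := mulL_coe (wave_memLp ζ) f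
  have key : ∀ a b : L2, ∫ x, wave ζ x * (dL2 j f x * a x + f x * b x - dsym j ζ * (f x * a x)) =
      (∫ x, P x * a x) + ∫ x, Q x * b x := by
    intro a b
    rw [← integral_add (integrable_mul_L2 P a) (integrable_mul_L2 Q b)]
    refine integral_congr_ae ?_
    filter_upwards [hPe, hQe] with x h1 h2
    simp only [h1, h2]
    ring
  have hz : ∀ h : L2, (∫ x, P x * fmulL bsym bsym_memLp h x) +
      ∫ x, Q x * fmulL _ (dsym_bsym_memLp j) h x = 0 := by
    intro h
    refine DenseRange.induction_on (p := fun h : L2 => (∫ x, P x * fmulL bsym bsym_memLp h x) +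
      ∫ x, Q x * fmulL _ (dsym_bsym_memLp j) h x = 0)
      (SchwartzMap.denseRange_toLpCLM (F := ℂ) (E := Space) (p := 2)
        ENNReal.ofNat_ne_top) h ?_ ?_
    · refine isClosed_eq (Continuous.add ?_ ?_) continuous_const
      · exact (continuous_integral_mul P).comp (fmulL bsym bsym_memLp).continuous
      · exact (continuous_integral_mul Q).comp (fmulL _ (dsym_bsym_memLp j)).continuous
    · intro h
      obtain ⟨G, h1, h2⟩ := fmulL_schwartz h j
      rw [SchwartzMap.toLpCLM_apply, h1, h2, ← key, ← integral_modulate_schwartz j ζ hf G]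
      refine integral_congr_ae ?_
      filter_upwards [G.coeFn_toLp 2 volume,
        (∂_{(EuclideanSpace.single j (1 : ℝ) : Space)} G).coeFn_toLp 2 volume] with x h3 h4
      rw [h3, h4]
  -- The preimage of `g` under the Bessel potential. It is in L² exactly because `g` is in H¹.
  obtain ⟨h, hh⟩ := exists_symbol hg
    (σ := fun ξ => (((1 + ‖ξ‖ ^ 2) ^ ((1:ℝ) / 2) : ℝ) : ℂ)) (by
      have : (fun ξ : Space => (((1 + ‖ξ‖ ^ 2) ^ ((1:ℝ) / 2) : ℝ) : ℂ)).HasTemperateGrowth := by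
        fun_prop
      exact this.1.continuous) (c := 1) (fun ξ => by
        rw [Complex.norm_real, Real.norm_of_nonneg (by positivity), ← Real.sqrt_eq_rpow,
          Real.sqrt_le_left (by positivity)]
        nlinarith [norm_nonneg ξ])
  have hone : ∀ ξ : Space, bsym ξ * (((1 + ‖ξ‖ ^ 2) ^ ((1:ℝ) / 2) : ℝ) : ℂ) = 1 := by
    intro ξ
    rw [bsym, ← Complex.ofReal_mul, ← Real.rpow_add (by positivity)]
    norm_num
  have eg : fmulL bsym bsym_memLp h = g := by
    refine eq_of_fourier_ae ?_
    filter_upwards [hh, fourier_fmulL bsym_memLp h] with ξ h1 h2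
    rw [h2, h1, ← mul_assoc, hone, one_mul]
  have eg' : fmulL _ (dsym_bsym_memLp j) h = dL2 j g := by
    refine eq_of_fourier_ae ?_
    filter_upwards [hh, fourier_fmulL (dsym_bsym_memLp j) h, fourier_dL2 j hg] with ξ h1 h2 h3
    rw [h2, h1, h3, ← mul_assoc, mul_assoc (dsym j ξ), hone, mul_one]
  have h0 := hz h
  rw [eg, eg', ← key] at h0
  have i1 : Integrable fun x => wave ζ x * (dL2 j f x * g x + f x * dL2 j g x) :=
    ((integrable_mul_L2 _ _).add (integrable_mul_L2 _ _)).bdd_mul (c := 1)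
      (wave_temperate ζ).1.continuous.aestronglyMeasurable
      (Eventually.of_forall fun x => (norm_wave ζ x).le)
  have i2 : Integrable fun x => wave ζ x * (f x * g x) :=
    (integrable_mul_L2 _ _).bdd_mul (c := 1)
      (wave_temperate ζ).1.continuous.aestronglyMeasurable
      (Eventually.of_forall fun x => (norm_wave ζ x).le)
  rw [← sub_eq_zero, ← integral_const_mul, ← integral_sub i1 (i2.const_mul _), ← h0]
  refine integral_congr_ae (Eventually.of_forall fun x => ?_)
  simp only
  ring

/-- Integration by parts against a function with integrable Fourier transform. -/
lemma integral_by_parts (j : Fin 3) {f g h : L2} (hf : Reg 1 f) (hg : Reg 1 g) (hh : Wiener 1 h)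
    (hh' : Reg 1 h) :
    ∫ x, (dL2 j f x * g x + f x * dL2 j g x) * (starRingEnd ℂ) (h x) =
      -∫ x, f x * g x * (starRingEnd ℂ) (dL2 j h x) := by
  -- The conjugate of `h` is the transform of χ. The transform can thus be moved onto the product,
  -- where the derivative becomes a multiplication by the symbol, and back again.
  set χ : Space → ℂ := fun ξ => (starRingEnd ℂ) ((𝓕 h : L2) ξ) with hχ
  have hχi : Integrable χ := by
    have := hh.integrable
    exact (RCLike.conjCLE (K := ℂ)).toContinuousLinearMap.integrable_comp this
  have hdm : AEStronglyMeasurable fun ξ => dsym j ξ * χ ξ :=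
    (continuous_dsym j).aestronglyMeasurable.mul hχi.1
  have hχd : Integrable fun ξ => dsym j ξ * χ ξ := by
    refine Integrable.mono' (hh.const_mul (2 * Real.pi)) hdm (Eventually.of_forall fun ξ => ?_)
    rw [norm_mul, hχ]
    simp only [RCLike.norm_conj]
    rw [← mul_assoc]
    exact mul_le_mul_of_nonneg_right (norm_dsym_le' j ξ) (norm_nonneg _)
  have conj_inv : ∀ (p : Space → ℂ) (x : Space),
      (starRingEnd ℂ) (𝓕⁻ p x) = 𝓕 (fun ξ => (starRingEnd ℂ) (p ξ)) x := by
    intro p x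
    rw [Real.fourierInv_eq', Real.fourier_eq', ← integral_conj]
    congr 1
    ext ξ
    simp [← Complex.exp_conj, Complex.conj_ofNat]
  have e1 : ∀ᵐ x, (starRingEnd ℂ) (h x) = 𝓕 χ x := by
    filter_upwards [ae_eq_fourierInv hh.integrable] with x hx
    rw [hx, conj_inv]
  have e2 : ∀ᵐ x, (starRingEnd ℂ) (dL2 j h x) = -𝓕 (fun ξ => dsym j ξ * χ ξ) x := by
    have hd := fourier_dL2 j hh'
    have hc : (fun ξ => (starRingEnd ℂ) ((𝓕 (dL2 j h) : L2) ξ)) =ᵐ[volume]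
        fun ξ => -(dsym j ξ * χ ξ) := by
      filter_upwards [hd] with ξ h1
      rw [h1, map_mul, conj_dsym]
      simp [hχ]
    have hi : Integrable fun ξ => (𝓕 (dL2 j h) : L2) ξ := by
      have := (RCLike.conjCLE (K := ℂ)).toContinuousLinearMap.integrable_comp
        (hχd.neg.congr hc.symm)
      simpa using this
    filter_upwards [ae_eq_fourierInv hi] with x hx
    rw [hx, conj_inv, Real.fourier_congr_ae hc x]
    simp [Real.fourier_eq, integral_neg]
  have i1 : Integrable fun x => dL2 j f x * g x + f x * dL2 j g x :=
    (integrable_mul_L2 _ _).add (integrable_mul_L2 _ _)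
  have i2 : Integrable fun x => f x * g x := integrable_mul_L2 _ _
  calc _ = ∫ x, (dL2 j f x * g x + f x * dL2 j g x) * 𝓕 χ x := by
        refine integral_congr_ae ?_
        filter_upwards [e1] with x hx
        rw [hx]
    _ = ∫ ξ, 𝓕 (fun x => dL2 j f x * g x + f x * dL2 j g x) ξ * χ ξ :=
        (integral_fourier_mul i1 hχi).symm
    _ = ∫ ξ, 𝓕 (fun x => f x * g x) ξ * (dsym j ξ * χ ξ) := by
        congr 1
        ext ξ
        rw [fourier_eq_wave, fourier_eq_wave, integral_wave_mul j ξ hf hg]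
        ring
    _ = ∫ x, f x * g x * 𝓕 (fun ξ => dsym j ξ * χ ξ) x := integral_fourier_mul i2 hχd
    _ = _ := by
        rw [← integral_neg]
        refine integral_congr_ae ?_
        filter_upwards [e2] with x hx
        rw [hx]
        ring

/-! ### Calculus of derivatives in `L²` -/

lemma dL2_add (j : Fin 3) {f g : L2} (hf : Reg 1 f) (hg : Reg 1 g) :
    dL2 j (f + g) = dL2 j f + dL2 j g := by
  have : pd j (toDist (f + g)) = toDist (dL2 j f + dL2 j g) := by
    rw [toDist_add, toDist_add, ← pd_toDist j hf, ← pd_toDist j hg, pd_eq_mult, pd_eq_mult,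
      pd_eq_mult, mult, map_add]
  rw [dL2, this, rep_toDist]

lemma dL2_comm (j k : Fin 3) {f : L2} (hf : Reg 2 f) : dL2 j (dL2 k f) = dL2 k (dL2 j f) := by
  have h1 : Reg 1 f := hf.mono (by norm_num)
  refine eq_of_fourier_ae ?_
  filter_upwards [fourier_dL2 j (Reg.dL2 (n := 1) hf k).1, fourier_dL2 k (Reg.dL2 (n := 1) hf j).1,
    fourier_dL2 j h1, fourier_dL2 k h1] with ξ a b c d
  rw [a, b, c, d]
  ring

/-- The Laplacian in `L²`. -/
def lapL2 (f : L2) : L2 := ∑ k, dL2 k (dL2 k f)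

lemma fourier_sum (s : Finset (Fin 3)) (f : Fin 3 → L2) :
    ∀ᵐ ξ, (𝓕 (∑ k ∈ s, f k) : L2) ξ = ∑ k ∈ s, (𝓕 (f k) : L2) ξ := by
  have e : 𝓕 (∑ k ∈ s, f k) = ∑ k ∈ s, 𝓕 (f k) :=
    map_sum (FourierTransform.fourierCLM ℂ L2) f s
  rw [e]
  filter_upwards [Lp.coeFn_finsetSum s (fun k => 𝓕 (f k))] with ξ h
  rw [h, Finset.sum_apply]

lemma dsym_sq (k : Fin 3) (ξ : Space) : dsym k ξ * dsym k ξ = -((‖dsym k ξ‖ ^ 2 : ℝ) : ℂ) := by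
  have := Complex.mul_conj (dsym k ξ)
  rw [conj_dsym, Complex.normSq_eq_norm_sq] at this
  rw [← this]
  ring

lemma sum_dsym_sq (ξ : Space) : ∑ k, dsym k ξ * dsym k ξ = -(ksq ξ : ℂ) := by
  simp_rw [dsym_sq]
  rw [Finset.sum_neg_distrib, ← sum_normSq_dsym]
  push_cast
  rfl

lemma fourier_lapL2 {f : L2} (hf : Reg 2 f) :
    ∀ᵐ ξ, (𝓕 (lapL2 f) : L2) ξ = -(ksq ξ : ℂ) * (𝓕 f : L2) ξ := by
  have h1 : ∀ᵐ ξ, ∀ k, (𝓕 (dL2 k (dL2 k f)) : L2) ξ = dsym k ξ * (𝓕 (dL2 k f) : L2) ξ :=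
    ae_all_iff.2 fun k => fourier_dL2 k (Reg.dL2 (n := 1) hf k).1
  have h2 : ∀ᵐ ξ, ∀ k, (𝓕 (dL2 k f) : L2) ξ = dsym k ξ * (𝓕 f : L2) ξ :=
    ae_all_iff.2 fun k => fourier_dL2 k (hf.mono (by norm_num))
  filter_upwards [fourier_sum Finset.univ (fun k => dL2 k (dL2 k f)), h1, h2] with ξ a b c
  rw [lapL2, a, ← sum_dsym_sq, Finset.sum_mul]
  exact Finset.sum_congr rfl fun k _ => by rw [b, c]; ring

lemma Reg.lapL2 {f : L2} (hf : Reg 3 f) : Reg 1 (lapL2 f) := by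
  refine (Reg.symbol (n := 1) (m := 2) hf (σ := fun ξ => -(ksq ξ : ℂ)) (c := (2 * Real.pi) ^ 2)
    (fun ξ => ?_) (fourier_lapL2 (hf.mono (by norm_num)))).1
  rw [norm_neg]
  exact norm_ksq_le ξ

lemma dL2_lapL2 (j : Fin 3) {f : L2} (hf : Reg 3 f) : dL2 j (lapL2 f) = dLapL2 j f := by
  refine eq_of_fourier_ae ?_
  filter_upwards [fourier_dL2 j hf.lapL2, fourier_lapL2 (hf.mono (by norm_num : 2 ≤ 3)),
    fourier_dLapL2 j hf] with ξ a b c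
  rw [a, b, c]
  ring

lemma Wiener.dL2 {n : ℕ} {f : L2} (hf : Wiener (n + 1) f) (hf1 : Reg 1 f) (j : Fin 3) :
    Wiener n (dL2 j f) := by
  refine Integrable.mono' (Integrable.const_mul hf (2 * Real.pi)) ?_ ?_
  · have := Reg.aesm (SecondGrade.dL2 j f); fun_prop
  · filter_upwards [fourier_dL2 j hf1] with ξ h
    rw [h, Real.norm_of_nonneg (by positivity), norm_mul]
    calc (1 + ‖ξ‖) ^ n * (‖dsym j ξ‖ * ‖(𝓕 f : L2) ξ‖)
        ≤ (1 + ‖ξ‖) ^ n * ((2 * Real.pi) * (1 + ‖ξ‖) ^ 1 * ‖(𝓕 f : L2) ξ‖) := by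
          gcongr; exact norm_dsym_le' j ξ
      _ = _ := by ring

/-- A solenoidal field, in terms of the Fourier transform. -/
def DivFree (u : Field) : Prop := ∀ᵐ ξ, ∑ j, dsym j ξ * (𝓕 (u j) : L2) ξ = 0

lemma divFree_iff (u : Field) : divergence u = 0 ↔ DivFree u := by
  have := symbol_sum_eq_zero_iff Finset.univ dsym_temperate u
  simpa only [divergence, pd_eq_mult, DivFree] using this

lemma DivFree.sum_dL2 {u : Field} (h : DivFree u) (hu : ∀ i, Reg 1 (u i)) :
    ∑ j, dL2 j (u j) = 0 := by
  refine eq_of_fourier_ae ?_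
  have h1 : ∀ᵐ ξ, ∀ k, (𝓕 (dL2 k (u k)) : L2) ξ = dsym k ξ * (𝓕 (u k) : L2) ξ :=
    ae_all_iff.2 fun k => fourier_dL2 k (hu k)
  have h0 : 𝓕 (0 : L2) = 0 := map_zero (FourierTransform.fourierCLM ℂ L2)
  filter_upwards [fourier_sum Finset.univ (fun k => dL2 k (u k)), h1, h,
    Lp.coeFn_zero ℂ 2 (volume : Measure Space)] with ξ a b c d
  rw [a, h0, d]
  simp only [b, c, Pi.zero_apply]

lemma DivFree.ae_sum_dL2 {u : Field} (h : DivFree u) (hu : ∀ i, Reg 1 (u i)) :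
    ∀ᵐ x, ∑ j, dL2 j (u j) x = 0 := by
  filter_upwards [Lp.coeFn_finsetSum Finset.univ (fun j => dL2 j (u j)),
    Lp.coeFn_zero ℂ 2 (volume : Measure Space)] with x h1 h2
  rw [h.sum_dL2 hu, h2, Finset.sum_apply] at h1
  simpa using h1.symm

/-! ### Trilinear integrals -/

/-- The trilinear integral `∫ a b c̄`. -/
def tri (a b c : L2) : ℂ := ∫ x, a x * b x * (starRingEnd ℂ) (c x)

lemma tri_comm (a b c : L2) : tri a b c = tri b a c := by
  unfold tri; simp_rw [mul_comm (a _)]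

lemma aesm_conj (c : L2) : AEStronglyMeasurable fun x => (starRingEnd ℂ) (c x) :=
  Complex.continuous_conj.comp_aestronglyMeasurable (Lp.aestronglyMeasurable c)

lemma integrable_tri {a b c : L2} (hc : Wiener 0 c) :
    Integrable fun x => a x * b x * (starRingEnd ℂ) (c x) := by
  refine (integrable_mul_L2 a b).mul_bdd (c := ∫ ξ, ‖(𝓕 c : L2) ξ‖) (aesm_conj c) ?_
  filter_upwards [ae_norm_le hc.integrable] with x hx
  rwa [RCLike.norm_conj]

lemma integrable_tri_left {a b c : L2} (ha : Wiener 0 a) :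
    Integrable fun x => a x * b x * (starRingEnd ℂ) (c x) := by
  have h1 : Integrable fun x => b x * (starRingEnd ℂ) (c x) :=
    (Lp.memLp b).integrable_mul (Lp.memLp c).star
  simp_rw [mul_assoc]
  refine h1.bdd_mul (c := ∫ ξ, ‖(𝓕 a : L2) ξ‖) (Lp.aestronglyMeasurable a) (ae_norm_le ha.integrable)

lemma integral_norm_mul_le (a b : L2) : ∫ x, ‖a x * b x‖ ≤ ‖a‖ * ‖b‖ := by
  simp_rw [norm_mul]
  refine (integral_mul_le_sqrt (Lp.aestronglyMeasurable a).norm (Lp.aestronglyMeasurable b).norm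
    (integrable_normSq a) (integrable_normSq b)).trans_eq ?_
  rw [integral_normSq, integral_normSq, Real.sqrt_sq (norm_nonneg _), Real.sqrt_sq (norm_nonneg _)]

lemma norm_tri_le {a b c : L2} (hc : Wiener 0 c) :
    ‖tri a b c‖ ≤ ‖a‖ * ‖b‖ * ∫ ξ, ‖(𝓕 c : L2) ξ‖ := by
  refine (norm_integral_le_integral_norm _).trans ?_
  calc ∫ x, ‖a x * b x * (starRingEnd ℂ) (c x)‖
      ≤ ∫ x, ‖a x * b x‖ * ∫ ξ, ‖(𝓕 c : L2) ξ‖ := by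
        refine integral_mono_ae (integrable_tri hc).norm
          ((integrable_mul_L2 a b).norm.mul_const _) ?_
        filter_upwards [ae_norm_le hc.integrable] with x hx
        rw [norm_mul, RCLike.norm_conj]
        gcongr
    _ = (∫ x, ‖a x * b x‖) * ∫ ξ, ‖(𝓕 c : L2) ξ‖ := integral_mul_const _ _
    _ ≤ _ := by
        gcongr
        exact integral_norm_mul_le a b

lemma tri_add_left {a a' b c : L2} (hc : Wiener 0 c) :
    tri (a + a') b c = tri a b c + tri a' b c := by
  rw [tri, tri, tri, ← integral_add (integrable_tri hc) (integrable_tri hc)]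
  refine integral_congr_ae ?_
  filter_upwards [Lp.coeFn_add a a'] with x hx
  rw [hx]
  simp only [Pi.add_apply]
  ring

lemma tri_add_right {a b b' c : L2} (hc : Wiener 0 c) :
    tri a (b + b') c = tri a b c + tri a b' c := by
  rw [tri_comm, tri_add_left hc, tri_comm b, tri_comm b']

lemma tri_sum_right {a c : L2} {b : Fin 3 → L2} (hc : Wiener 0 c) :
    tri a (∑ k, b k) c = ∑ k, tri a (b k) c := by
  simp [Fin.sum_univ_three, tri_add_right hc]

lemma sum_tri_eq_zero {a c : L2} {b : Fin 3 → L2} (hc : Wiener 0 c)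
    (hb : ∀ᵐ x, ∑ k, b k x = 0) : ∑ k, tri a (b k) c = 0 := by
  unfold tri
  rw [← integral_finsetSum _ fun k _ => integrable_tri hc]
  refine integral_eq_zero_of_ae ?_
  filter_upwards [hb] with x hx
  rw [← Finset.sum_mul, ← Finset.mul_sum, hx]
  simp

lemma ibp_tri (j : Fin 3) {f g h : L2} (hf : Reg 1 f) (hg : Reg 1 g) (hh : Wiener 1 h)
    (hh' : Reg 1 h) :
    tri (dL2 j f) g h + tri f (dL2 j g) h = -tri f g (dL2 j h) := by
  have h0 : Wiener 0 h := hh.mono (by norm_num)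
  rw [tri, tri, tri, ← integral_add (integrable_tri h0) (integrable_tri h0),
    ← integral_by_parts j hf hg hh hh']
  simp_rw [add_mul]

/-- Transport by a solenoidal field is skew-symmetric. -/
lemma sum_tri_transport {a : Field} (ha : ∀ j, Reg 1 (a j)) (hdiv : DivFree a) {f h : L2}
    (hf : Reg 1 f) (hh : Wiener 1 h) (hh' : Reg 1 h) :
    ∑ j, tri (a j) (dL2 j f) h = -∑ j, tri (a j) f (dL2 j h) := by
  have h0 : Wiener 0 h := hh.mono (by norm_num)
  have h1 : ∑ j, tri f (dL2 j (a j)) h = 0 := sum_tri_eq_zero h0 (hdiv.ae_sum_dL2 ha)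
  have h2 : ∑ j, (tri (dL2 j (a j)) f h + tri (a j) (dL2 j f) h) = -∑ j, tri (a j) f (dL2 j h) := by
    rw [← Finset.sum_neg_distrib]
    exact Finset.sum_congr rfl fun j _ => ibp_tri j (ha j) hf hh hh'
  rw [Finset.sum_add_distrib] at h2
  simp_rw [tri_comm (dL2 _ (a _)) f] at h2
  rwa [h1, zero_add] at h2

/-- The gradient of fg is orthogonal to a solenoidal field. -/
lemma sum_tri_conj_div {ψ : Field} (hψ : ∀ j, Reg 1 (ψ j)) (hdiv : DivFree ψ)
    {f g : L2} (hf : Reg 1 f) (hg : Reg 1 g) (hw : ∀ j, Wiener 1 (ψ j)) :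
    ∑ j, (tri (dL2 j f) g (ψ j) + tri f (dL2 j g) (ψ j)) = 0 := by
  simp_rw [ibp_tri _ hf hg (hw _) (hψ _)]
  rw [Finset.sum_neg_distrib, neg_eq_zero]
  unfold tri
  rw [← integral_finsetSum _ fun k _ => integrable_tri ((hw k).dL2 (hψ k) k)]
  refine integral_eq_zero_of_ae ?_
  filter_upwards [hdiv.ae_sum_dL2 hψ] with x hx
  rw [← Finset.mul_sum, ← map_sum, hx]
  simp

/-! ### The nonlinearity -/

open Classical in
/-- The product `a f` for bounded `a`. -/
def prodL2 (a f : L2) : L2 := if h : MemLp (fun x => a x) ⊤ then mulL _ h f else 0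

lemma Wiener.memLp_top {a : L2} (ha : Wiener 0 a) : MemLp (fun x => a x) ⊤ :=
  memLp_top_of_bound (Lp.aestronglyMeasurable a) _ (ae_norm_le ha.integrable)

lemma prodL2_coe {a : L2} (ha : Wiener 0 a) (f : L2) : ∀ᵐ x, prodL2 a f x = a x * f x := by
  rw [prodL2, dif_pos ha.memLp_top]
  exact mulL_coe _ f

lemma norm_prodL2_le {a : L2} (ha : Wiener 0 a) (f : L2) :
    ‖prodL2 a f‖ ≤ (∫ ξ, ‖(𝓕 a : L2) ξ‖) * ‖f‖ := by
  refine Lp.norm_le_mul_norm_of_ae_le_mul ?_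
  filter_upwards [prodL2_coe ha f, ae_norm_le ha.integrable] with x h1 h2
  rw [h1, norm_mul]
  gcongr

/-- The nonlinear term `u·∇u - α u·∇Δu + α (∇Δu)ᵀ u`. -/
def nonlin (α : ℝ) (u : Field) : Field := fun i =>
  ∑ j, (prodL2 (u j) (dL2 j (u i)) - (α : ℂ) • prodL2 (u j) (dLapL2 j (u i))
    + (α : ℂ) • prodL2 (u j) (dLapL2 i (u j)))

/-- The `L²` pairing of two vector fields. -/
def pairing (f g : Field) : ℂ := ∑ i, ∫ x, f i x * (starRingEnd ℂ) (g i x)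

lemma integrable_mul_conj (f g : L2) : Integrable fun x => f x * (starRingEnd ℂ) (g x) :=
  (Lp.memLp f).integrable_mul (Lp.memLp g).star

lemma nonlin_coe {α : ℝ} {u : Field} (hw : ∀ i, Wiener 0 (u i)) (i : Fin 3) :
    ∀ᵐ x, nonlin α u i x = ∑ j, (u j x * dL2 j (u i) x - α * (u j x * dLapL2 j (u i) x)
      + α * (u j x * dLapL2 i (u j) x)) := by
  have h1 : ∀ᵐ x, ∀ j, prodL2 (u j) (dL2 j (u i)) x = u j x * dL2 j (u i) x :=
    ae_all_iff.2 fun j => prodL2_coe (hw j) _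
  have h2 : ∀ᵐ x, ∀ j, prodL2 (u j) (dLapL2 j (u i)) x = u j x * dLapL2 j (u i) x :=
    ae_all_iff.2 fun j => prodL2_coe (hw j) _
  have h3 : ∀ᵐ x, ∀ j, prodL2 (u j) (dLapL2 i (u j)) x = u j x * dLapL2 i (u j) x :=
    ae_all_iff.2 fun j => prodL2_coe (hw j) _
  have h4 := Lp.coeFn_finsetSum Finset.univ (fun j =>
    (prodL2 (u j) (dL2 j (u i)) - (α : ℂ) • prodL2 (u j) (dLapL2 j (u i))
    + (α : ℂ) • prodL2 (u j) (dLapL2 i (u j))))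
  have h5 : ∀ᵐ x, ∀ j, (prodL2 (u j) (dL2 j (u i)) - (α : ℂ) • prodL2 (u j) (dLapL2 j (u i))
    + (α : ℂ) • prodL2 (u j) (dLapL2 i (u j)) : L2) x = prodL2 (u j) (dL2 j (u i)) x
      - α * prodL2 (u j) (dLapL2 j (u i)) x + α * prodL2 (u j) (dLapL2 i (u j)) x :=
    ae_all_iff.2 fun j => by
      filter_upwards [Lp.coeFn_add (prodL2 (u j) (dL2 j (u i)) - (α : ℂ) •
          prodL2 (u j) (dLapL2 j (u i))) ((α : ℂ) • prodL2 (u j) (dLapL2 i (u j))),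
        Lp.coeFn_sub (prodL2 (u j) (dL2 j (u i))) ((α : ℂ) • prodL2 (u j) (dLapL2 j (u i))),
        Lp.coeFn_smul (α : ℂ) (prodL2 (u j) (dLapL2 j (u i))),
        Lp.coeFn_smul (α : ℂ) (prodL2 (u j) (dLapL2 i (u j)))] with x a b c d
      rw [a, Pi.add_apply, b, Pi.sub_apply, c, d]
      simp
  filter_upwards [h1, h2, h3, h4, h5] with x a b c d e
  rw [nonlin, d, Finset.sum_apply]
  exact Finset.sum_congr rfl fun j _ => by rw [e, a, b, c]

lemma pairing_nonlin {α : ℝ} {u ψ : Field} (hw : ∀ i, Wiener 0 (u i)) :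
    pairing (nonlin α u) ψ = ∑ i, ∑ j, (tri (u j) (dL2 j (u i)) (ψ i)
      - α * tri (u j) (dLapL2 j (u i)) (ψ i) + α * tri (u j) (dLapL2 i (u j)) (ψ i)) := by
  refine Finset.sum_congr rfl fun i _ => ?_
  have i1 : ∀ j, Integrable fun x => u j x * dL2 j (u i) x * (starRingEnd ℂ) (ψ i x) :=
    fun j => integrable_tri_left (hw j)
  have i2 : ∀ j, Integrable fun x => u j x * dLapL2 j (u i) x * (starRingEnd ℂ) (ψ i x) :=
    fun j => integrable_tri_left (hw j)
  have i3 : ∀ j, Integrable fun x => u j x * dLapL2 i (u j) x * (starRingEnd ℂ) (ψ i x) :=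
    fun j => integrable_tri_left (hw j)
  have i4 : ∀ j, Integrable fun x => u j x * dL2 j (u i) x * (starRingEnd ℂ) (ψ i x)
      - α * (u j x * dLapL2 j (u i) x * (starRingEnd ℂ) (ψ i x)) :=
    fun j => (i1 j).sub ((i2 j).const_mul _)
  have i5 : ∀ j, Integrable fun x => u j x * dL2 j (u i) x * (starRingEnd ℂ) (ψ i x)
      - α * (u j x * dLapL2 j (u i) x * (starRingEnd ℂ) (ψ i x))
      + α * (u j x * dLapL2 i (u j) x * (starRingEnd ℂ) (ψ i x)) :=
    fun j => (i4 j).add ((i3 j).const_mul _)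
  have e : ∀ j, tri (u j) (dL2 j (u i)) (ψ i) - α * tri (u j) (dLapL2 j (u i)) (ψ i)
      + α * tri (u j) (dLapL2 i (u j)) (ψ i) = ∫ x, (u j x * dL2 j (u i) x * (starRingEnd ℂ) (ψ i x)
      - α * (u j x * dLapL2 j (u i) x * (starRingEnd ℂ) (ψ i x))
      + α * (u j x * dLapL2 i (u j) x * (starRingEnd ℂ) (ψ i x))) := by
    intro j
    rw [integral_add (i4 j) ((i3 j).const_mul _),
      integral_sub (i1 j) ((i2 j).const_mul _), integral_const_mul, integral_const_mul]
    rfl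
  simp_rw [e]
  rw [← integral_finsetSum _ fun j _ => i5 j]
  refine integral_congr_ae ?_
  filter_upwards [nonlin_coe (α := α) hw i] with x hx
  rw [hx, Finset.sum_mul]
  exact Finset.sum_congr rfl fun j _ => by ring

/-- The weak form of the nonlinearity: all derivatives of order higher than one are on `ψ`. -/
def weakNonlin (α : ℝ) (a b ψ : Field) : ℂ :=
  ∑ i, ∑ j, (-tri (a j) (b i) (dL2 j (ψ i)) + α * ∑ k,
    (-tri (dL2 k (a j)) (dL2 k (b i)) (dL2 j (ψ i)) - tri (a j) (dL2 k (b i)) (dL2 k (dL2 j (ψ i)))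
      + tri (dL2 j (a i)) (dL2 k (b i)) (dL2 k (ψ j))))

/-- The third derivatives of `u` in the nonlinearity are moved onto the test field. The resulting
form costs only first derivatives of `u`, so the energy controls it, and it is bilinear, so it can
be polarized for the difference of two solutions. -/
theorem pairing_nonlin_eq {α : ℝ} {u ψ : Field} (hu : ∀ i, Reg 3 (u i)) (hdu : DivFree u)
    (hψ : ∀ i, Reg 2 (ψ i)) (hwψ : ∀ i, Wiener 2 (ψ i)) (hdψ : DivFree ψ) :
    pairing (nonlin α u) ψ = weakNonlin α u u ψ := by
  have hw : ∀ i, Wiener 1 (u i) := fun i => (Reg.wiener (n := 1) (hu i)).1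
  have hu1 : ∀ i, Reg 1 (u i) := fun i => (hu i).mono (by norm_num)
  have hu2 : ∀ i, Reg 2 (u i) := fun i => (hu i).mono (by norm_num)
  have hdu1 : ∀ k i, Reg 1 (dL2 k (u i)) := fun k i => (Reg.dL2 (n := 1) (hu2 i) k).1
  have hψ1 : ∀ i, Reg 1 (ψ i) := fun i => (hψ i).mono (by norm_num)
  have hwψ1 : ∀ i, Wiener 1 (ψ i) := fun i => (hwψ i).mono (by norm_num)
  have hwψ0 : ∀ i, Wiener 0 (ψ i) := fun i => (hwψ i).mono (by norm_num)
  have hdψ1 : ∀ k i, Reg 1 (dL2 k (ψ i)) := fun k i => (Reg.dL2 (n := 1) (hψ i) k).1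
  have hwdψ : ∀ k i, Wiener 1 (dL2 k (ψ i)) := fun k i => (hwψ i).dL2 (hψ1 i) k
  rw [pairing_nonlin fun i => (hw i).mono (by norm_num)]
  have s1 : ∀ i, ∑ j, tri (u j) (dL2 j (u i)) (ψ i) = -∑ j, tri (u j) (u i) (dL2 j (ψ i)) :=
    fun i => sum_tri_transport hu1 hdu (hu1 i) (hwψ1 i) (hψ1 i)
  -- Skew-symmetry of the transport moves ∂ⱼ from Δu onto ψ. One of the two derivatives in Δ is then
  -- moved as well, and falls either on the transporting field or on ∂ⱼψ.
  have s2 : ∀ i, ∑ j, tri (u j) (dLapL2 j (u i)) (ψ i) =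
      ∑ j, ∑ k, (tri (dL2 k (u j)) (dL2 k (u i)) (dL2 j (ψ i)) +
        tri (u j) (dL2 k (u i)) (dL2 k (dL2 j (ψ i)))) := by
    intro i
    simp_rw [← dL2_lapL2 _ (hu i)]
    rw [sum_tri_transport hu1 hdu (hu i).lapL2 (hwψ1 i) (hψ1 i), ← Finset.sum_neg_distrib]
    refine Finset.sum_congr rfl fun j _ => ?_
    rw [lapL2, tri_sum_right ((hwdψ j i).mono (by norm_num)), ← Finset.sum_neg_distrib]
    refine Finset.sum_congr rfl fun k _ => ?_
    have := ibp_tri k (hdu1 k i) (hu1 j) (hwdψ j i) (hdψ1 j i)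
    rw [tri_comm (u j), tri_comm (u j), tri_comm (dL2 k (u j))]
    linear_combination -this
  -- Since ψ is solenoidal, ∑ⱼ uᵢ ∂ⱼΔuᵢ ψⱼ may be replaced by -∑ⱼ ∂ⱼuᵢ Δuᵢ ψⱼ under the integral.
  -- One more integration by parts removes the second derivative.
  have s3 : ∀ i, ∑ j, tri (u i) (dLapL2 j (u i)) (ψ j) =
      ∑ j, ∑ k, tri (dL2 j (u i)) (dL2 k (u i)) (dL2 k (ψ j)) := by
    intro i
    simp_rw [← dL2_lapL2 _ (hu i)]
    have t1 := sum_tri_conj_div hψ1 hdψ (hu1 i) (hu i).lapL2 hwψ1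
    rw [Finset.sum_add_distrib] at t1
    -- The leftover terms are the gradient of |∂ₖuᵢ|²/2 paired with the solenoidal field ψ.
    have t2 : ∀ k, ∑ j, tri (dL2 k (u i)) (dL2 j (dL2 k (u i))) (ψ j) = 0 := by
      intro k
      have := sum_tri_conj_div hψ1 hdψ (hdu1 k i) (hdu1 k i) hwψ1
      simp_rw [tri_comm (dL2 _ (dL2 k (u i))), ← two_mul] at this
      rw [← Finset.mul_sum] at this
      simpa using this
    have t3 : ∀ j, tri (dL2 j (u i)) (lapL2 (u i)) (ψ j) =
        ∑ k, (-tri (dL2 j (u i)) (dL2 k (u i)) (dL2 k (ψ j))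
          - tri (dL2 k (u i)) (dL2 j (dL2 k (u i))) (ψ j)) := by
      intro j
      rw [lapL2, tri_sum_right (hwψ0 j)]
      refine Finset.sum_congr rfl fun k _ => ?_
      have := ibp_tri k (hdu1 k i) (hdu1 j i) (hwψ1 j) (hψ1 j)
      rw [dL2_comm k j (hu2 i)] at this
      rw [tri_comm (dL2 j (u i)), tri_comm (dL2 j (u i))]
      linear_combination this
    have t4 : ∑ j, tri (dL2 j (u i)) (lapL2 (u i)) (ψ j) =
        -∑ j, ∑ k, tri (dL2 j (u i)) (dL2 k (u i)) (dL2 k (ψ j)) := by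
      simp_rw [t3, Finset.sum_sub_distrib, Finset.sum_neg_distrib]
      rw [Finset.sum_comm (f := fun j k => tri (dL2 k (u i)) (dL2 j (dL2 k (u i))) (ψ j))]
      simp [t2]
    linear_combination t1 - t4
  have s3' : ∑ i, ∑ j, tri (u j) (dLapL2 i (u j)) (ψ i) =
      ∑ i, ∑ j, ∑ k, tri (dL2 j (u i)) (dL2 k (u i)) (dL2 k (ψ j)) := by
    rw [Finset.sum_comm]
    exact Finset.sum_congr rfl fun i _ => s3 i
  unfold weakNonlin
  simp only [Finset.sum_add_distrib, Finset.sum_sub_distrib, ← Finset.mul_sum,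
    Finset.sum_neg_distrib]
  simp only [Finset.sum_add_distrib] at s2
  rw [s3']
  simp_rw [s1, s2]
  simp only [Finset.sum_add_distrib, Finset.sum_neg_distrib]
  ring

/-- The nonlinearity does no work. -/
theorem pairing_nonlin_self {α : ℝ} {u : Field} (hu : ∀ i, Reg 3 (u i)) (hdu : DivFree u)
    (hr : IsRealValued u) : pairing (nonlin α u) u = 0 := by
  have hw : ∀ i, Wiener 1 (u i) := fun i => (Reg.wiener (n := 1) (hu i)).1
  have hu1 : ∀ i, Reg 1 (u i) := fun i => (hu i).mono (by norm_num)
  rw [pairing_nonlin fun i => (hw i).mono (by norm_num)]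
  have hc : ∀ a : L2, ∀ i j, tri (u i) a (u j) = tri (u j) a (u i) := by
    intro a i j
    refine integral_congr_ae ?_
    filter_upwards [hr i, hr j] with x h1 h2
    rw [Complex.conj_eq_iff_im.2 h1, Complex.conj_eq_iff_im.2 h2]
    ring
  -- The two terms with α are the same double sum with the indices exchanged, as `u` is real, and
  -- they enter the nonlinearity with opposite signs.
  have e1 : ∑ i, ∑ j, tri (u j) (dLapL2 j (u i)) (u i) =
      ∑ i, ∑ j, tri (u j) (dLapL2 i (u j)) (u i) := by
    rw [Finset.sum_comm]
    simp_rw [hc]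
  -- This is half the integral of u·∇(uᵢ²).
  have e2 : ∀ i, ∑ j, tri (u j) (dL2 j (u i)) (u i) = 0 := by
    intro i
    have := sum_tri_conj_div hu1 hdu (hu1 i) (hu1 i) hw
    simp_rw [tri_comm (dL2 _ (u i)), ← two_mul] at this
    rw [← Finset.mul_sum] at this
    simp_rw [hc]
    simpa using this
  simp only [Finset.sum_add_distrib, Finset.sum_sub_distrib, ← Finset.mul_sum, e1, e2]
  simp

/-! ### A trilinear bound in terms of Sobolev norms -/

/-- Modulation becomes translation under the Fourier transform. -/
lemma fourier_wave_mul (η : Space) (a : L2) :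
    ∀ᵐ ζ, (𝓕 (mulL _ (wave_memLp η) a) : L2) ζ = (𝓕 a : L2) (ζ + η) := by
  set g := mulL _ (wave_memLp η) a
  have hmp := measurePreserving_add_right (volume : Measure Space) η
  have h1 : LocallyIntegrable fun x => (𝓕 g : L2) x := (Lp.memLp _).locallyIntegrable (by norm_num)
  have h2' : MemLp (fun ζ => (𝓕 a : L2) (ζ + η)) 2 := (Lp.memLp (𝓕 a)).comp_measurePreserving hmp
  have h2 : LocallyIntegrable fun ζ => (𝓕 a : L2) (ζ + η) := h2'.locallyIntegrable (by norm_num)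
  have h := ae_zero_of_integral_schwartz (h1.sub h2) fun φ => by
    have i1 := integrable_mul_schwartz (𝓕 g) φ
    have i2 : Integrable fun ζ => (𝓕 a : L2) (ζ + η) * φ ζ := h2'.integrable_mul (φ.memLp 2)
    simp only [Pi.sub_apply, sub_mul]
    rw [integral_sub i1 i2, sub_eq_zero]
    have e1 : ∫ ζ, (𝓕 g : L2) ζ * φ ζ = ∫ x, g x * (𝓕 φ : 𝓢(Space, ℂ)) x := by
      have := congrArg (fun T : 𝓢'(Space, ℂ) => T φ) (fourier_toDist g)
      simp only [TemperedDistribution.fourier_apply, toDist_apply] at this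
      simp_rw [mul_comm _ (φ _), mul_comm (g _)]
      exact this.symm
    have e2 : ∫ ζ, (𝓕 a : L2) (ζ + η) * φ ζ = ∫ ζ, (𝓕 a : L2) ζ * φ.compSubConstCLM ℂ η ζ := by
      rw [← integral_add_right_eq_self (fun ζ => (𝓕 a : L2) ζ * φ.compSubConstCLM ℂ η ζ) η]
      simp
    have e3 : ∫ ζ, (𝓕 a : L2) ζ * φ.compSubConstCLM ℂ η ζ =
        ∫ x, a x * (𝓕 (φ.compSubConstCLM ℂ η) : 𝓢(Space, ℂ)) x := by
      have := congrArg (fun T : 𝓢'(Space, ℂ) => T (φ.compSubConstCLM ℂ η)) (fourier_toDist a)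
      simp only [TemperedDistribution.fourier_apply, toDist_apply] at this
      simp_rw [mul_comm _ ((φ.compSubConstCLM ℂ η) _), mul_comm (a _)]
      exact this.symm
    rw [e1, e2, e3]
    refine integral_congr_ae ?_
    filter_upwards [mulL_coe (wave_memLp η) a] with x hx
    have : (𝓕 (φ.compSubConstCLM ℂ η) : 𝓢(Space, ℂ)) x =
        wave η x * (𝓕 φ : 𝓢(Space, ℂ)) x := by
      rw [SchwartzMap.fourier_coe, SchwartzMap.fourier_coe, fourier_eq_wave, fourier_eq_wave,
        ← integral_add_right_eq_self _ η, ← integral_const_mul]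
      congr 1
      ext y
      have : wave x (y + η) = wave η x * wave x y := by
        simp [wave, inner_add_left, AddChar.map_add_eq_mul, real_inner_comm]
      rw [this]
      simp [mul_assoc]
    rw [this, hx]
    ring
  filter_upwards [h] with x hx
  simpa [sub_eq_zero] using hx

/-- Parseval: the integral is an inner product, and the modulation of `b` shifts its transform. -/
lemma norm_integral_wave_mul_conj_le (η : Space) (b c : L2) :
    ‖∫ x, wave η x * (b x * (starRingEnd ℂ) (c x))‖ ≤
      ∫ ζ, ‖(𝓕 c : L2) ζ‖ * ‖(𝓕 b : L2) (ζ + η)‖ := by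
  have e : ∫ x, wave η x * (b x * (starRingEnd ℂ) (c x)) =
      inner ℂ c (mulL _ (wave_memLp η) b) := by
    rw [L2.inner_def]
    refine integral_congr_ae ?_
    filter_upwards [mulL_coe (wave_memLp η) b] with x hx
    rw [hx, RCLike.inner_apply]
    ring
  rw [e, ← Lp.inner_fourier_eq, L2.inner_def]
  refine (norm_integral_le_integral_norm _).trans_eq (integral_congr_ae ?_)
  filter_upwards [fourier_wave_mul η b] with ζ hζ
  rw [hζ, RCLike.inner_apply, norm_mul, RCLike.norm_conj, mul_comm]

/-- The expansion of a trilinear integral in plane waves. -/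
lemma norm_tri_le_conv {a b c : L2} (ha : Wiener 0 a) :
    ‖tri a b c‖ ≤ ∫ η, ‖(𝓕 a : L2) η‖ * ∫ ζ, ‖(𝓕 c : L2) ζ‖ * ‖(𝓕 b : L2) (ζ - η)‖ := by
  set P : Space → ℂ := fun x => b x * (starRingEnd ℂ) (c x)
  have hP : Integrable P := integrable_mul_conj b c
  have hA := ha.integrable
  have e1 : tri a b c = ∫ η, (𝓕 a : L2) η * 𝓕⁻ P η := by
    rw [← integral_fourierInv_mul hA hP]
    refine integral_congr_ae ?_
    filter_upwards [ae_eq_fourierInv hA] with x hx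
    rw [← hx, mul_assoc]
  have e2 : ∀ η, ‖𝓕⁻ P η‖ ≤ ∫ ζ, ‖(𝓕 c : L2) ζ‖ * ‖(𝓕 b : L2) (ζ - η)‖ := by
    intro η
    rw [Real.fourierInv_eq_fourier_neg, fourier_eq_wave]
    simpa [sub_eq_add_neg] using norm_integral_wave_mul_conj_le (-η) b c
  have hm : MemLp (fun ζ => ‖(𝓕 c : L2) ζ‖) 2 := (Lp.memLp (𝓕 c)).norm
  rw [e1]
  refine (norm_integral_le_integral_norm _).trans ?_
  have hb : ∀ η, ∫ ζ, ‖(𝓕 c : L2) ζ‖ * ‖(𝓕 b : L2) (ζ - η)‖ ≤ ‖c‖ * ‖b‖ := by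
    intro η
    have hmp := measurePreserving_sub_right (volume : Measure Space) η
    have hq : AEStronglyMeasurable fun ζ => ‖(𝓕 b : L2) (ζ - η)‖ :=
      ((Lp.aestronglyMeasurable (𝓕 b)).comp_measurePreserving hmp).norm
    have hq2 : Integrable fun ζ => ‖(𝓕 b : L2) (ζ - η)‖ ^ 2 :=
      (integrable_normSq (𝓕 b)).comp_sub_right η
    refine (integral_mul_le_sqrt hm.1 hq (integrable_normSq (𝓕 c)) hq2).trans_eq ?_
    rw [integral_sub_right_eq_self (fun ζ => ‖(𝓕 b : L2) ζ‖ ^ 2) η, integral_normSq_fourier,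
      integral_normSq_fourier, Real.sqrt_sq (norm_nonneg _), Real.sqrt_sq (norm_nonneg _)]
  have hconv : AEStronglyMeasurable fun η =>
      ∫ ζ, ‖(𝓕 c : L2) ζ‖ * ‖(𝓕 b : L2) (ζ - η)‖ := by
    have h1 : AEStronglyMeasurable (fun p : Space × Space => ‖(𝓕 c : L2) p.2‖ *
        ‖(𝓕 b : L2) (p.2 - p.1)‖) ((volume : Measure Space).prod volume) := by
      refine AEStronglyMeasurable.mul ?_ ?_
      · exact (Lp.aestronglyMeasurable (𝓕 c)).norm.comp_quasiMeasurePreserving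
          Measure.quasiMeasurePreserving_snd
      · refine (Lp.aestronglyMeasurable (𝓕 b)).norm.comp_quasiMeasurePreserving
          (f := fun p : Space × Space => p.2 - p.1) ?_
        exact (quasiMeasurePreserving_sub volume volume).comp
          Measure.measurePreserving_swap.quasiMeasurePreserving
    exact h1.integral_prod_right'
  refine integral_mono_of_nonneg (Eventually.of_forall fun _ => norm_nonneg _) ?_
    (Eventually.of_forall fun η => ?_)
  · refine hA.norm.mul_bdd (c := ‖c‖ * ‖b‖) hconv (Eventually.of_forall fun η => ?_)
    rw [Real.norm_of_nonneg (integral_nonneg fun ζ => by positivity)]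
    exact hb η
  · simp only [norm_mul]
    gcongr
    exact e2 η

lemma embConst_sq : embConst ^ 2 = ∫ ξ : Space, (((1 + ‖ξ‖) ^ 2)⁻¹) ^ 2 :=
  Real.sq_sqrt (integral_nonneg fun _ => by positivity)

/-- Cauchy-Schwarz on the product space, with the factors (1+|η|)A(η) (1+|ζ|)C(ζ) and B(ζ-η) /
((1+|η|)(1+|ζ|)). This replaces the embeddings of H¹ into Lᵖ spaces. -/
lemma integral_weighted_conv_le {A B C : Space → ℝ} (hA : AEStronglyMeasurable A)
    (hB : AEStronglyMeasurable B) (hC : AEStronglyMeasurable C)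
    (iA : Integrable fun ξ => (1 + ‖ξ‖) ^ 2 * A ξ ^ 2) (iB : Integrable fun ξ => B ξ ^ 2)
    (iC : Integrable fun ξ => (1 + ‖ξ‖) ^ 2 * C ξ ^ 2) :
    ∫ η, A η * ∫ ζ, C ζ * B (ζ - η) ≤
      embConst * Real.sqrt (∫ ξ, (1 + ‖ξ‖) ^ 2 * A ξ ^ 2) * Real.sqrt (∫ ξ, B ξ ^ 2) *
        Real.sqrt (∫ ξ, (1 + ‖ξ‖) ^ 2 * C ξ ^ 2) := by
  set ν := (volume : Measure Space).prod (volume : Measure Space)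
  have hsub : Measure.QuasiMeasurePreserving (fun p : Space × Space => p.2 - p.1) ν volume :=
    (quasiMeasurePreserving_sub volume volume).comp
      Measure.measurePreserving_swap.quasiMeasurePreserving
  set f : Space × Space → ℝ := fun p => ((1 + ‖p.1‖) * A p.1) * ((1 + ‖p.2‖) * C p.2)
  set g : Space × Space → ℝ := fun p => (1 + ‖p.1‖)⁻¹ * (1 + ‖p.2‖)⁻¹ * B (p.2 - p.1)
  have hw : AEStronglyMeasurable (fun ξ : Space => (1 + ‖ξ‖)) := by fun_prop
  have hwi : Continuous (fun ξ : Space => (1 + ‖ξ‖)⁻¹) :=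
    Continuous.inv₀ (by fun_prop) fun ξ => by positivity
  have hf : AEStronglyMeasurable f ν :=
    ((hw.mul hA).comp_quasiMeasurePreserving Measure.quasiMeasurePreserving_fst).mul
      ((hw.mul hC).comp_quasiMeasurePreserving Measure.quasiMeasurePreserving_snd)
  have hg : AEStronglyMeasurable g ν :=
    (((hwi.comp continuous_fst).mul (hwi.comp continuous_snd)).aestronglyMeasurable).mul
      (hB.comp_quasiMeasurePreserving hsub)
  have ef : ∀ p, f p ^ 2 = ((1 + ‖p.1‖) ^ 2 * A p.1 ^ 2) * ((1 + ‖p.2‖) ^ 2 * C p.2 ^ 2) :=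
    fun p => by simp only [f]; ring
  have hf2 : Integrable (fun p => f p ^ 2) ν := by
    simp_rw [ef]; exact iA.mul_prod iC
  set k : Space → ℝ := fun ξ => (((1 + ‖ξ‖) ^ 2)⁻¹) ^ 2
  have hk : Integrable k := integrable_weight
  have hshift : MeasurePreserving (fun p : Space × Space => (p.1, p.2 - p.1)) ν ν :=
    measurePreserving_prod_sub volume volume
  have key : ∀ b : Space → ℝ, Integrable (fun ξ => b ξ ^ 2) →
      Integrable (fun p : Space × Space => k p.1 * b (p.2 - p.1) ^ 2) ν ∧
      ∫ p, k p.1 * b (p.2 - p.1) ^ 2 ∂ν = embConst ^ 2 * ∫ ξ, b ξ ^ 2 := by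
    intro b ib
    refine ⟨hshift.integrable_comp_of_integrable (hk.mul_prod ib), ?_⟩
    rw [embConst_sq, ← integral_prod_mul (μ := (volume : Measure Space))
      (ν := (volume : Measure Space)) k (fun ξ => b ξ ^ 2)]
    exact hshift.integral_comp (MeasurableEquiv.shearSubRight Space).measurableEmbedding
      (fun p : Space × Space => k p.1 * b p.2 ^ 2)
  obtain ⟨d1, v1⟩ := key B iB
  obtain ⟨d2', v2'⟩ := key (fun x => B (-x)) (iB.comp_neg)
  have hswap : MeasurePreserving (Prod.swap : Space × Space → Space × Space) ν ν :=
    Measure.measurePreserving_swap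
  have es : (fun p : Space × Space => k p.2 * B (p.2 - p.1) ^ 2) =
      (fun p : Space × Space => k p.1 * B (-(p.2 - p.1)) ^ 2) ∘ Prod.swap := by
    ext p; simp
  have d2 : Integrable (fun p : Space × Space => k p.2 * B (p.2 - p.1) ^ 2) ν := by
    rw [es]; exact hswap.integrable_comp_of_integrable d2'
  have v2 : ∫ p, k p.2 * B (p.2 - p.1) ^ 2 ∂ν = embConst ^ 2 * ∫ ξ, B ξ ^ 2 := by
    rw [es]
    refine (hswap.integral_comp MeasurableEquiv.prodComm.measurableEmbedding
      (fun p : Space × Space => k p.1 * B (-(p.2 - p.1)) ^ 2)).trans (v2'.trans ?_)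
    rw [integral_neg_eq_self (fun ξ => B ξ ^ 2)]
  -- The inequality between the arithmetic and the geometric mean separates the two weights. Each of
  -- the resulting terms depends on one variable and on ζ - η only, and a shear of the product space
  -- computes its integral.
  have hgle : ∀ p, g p ^ 2 ≤ 2⁻¹ * (k p.1 * B (p.2 - p.1) ^ 2 + k p.2 * B (p.2 - p.1) ^ 2) := by
    intro p
    have e : g p ^ 2 = ((1 + ‖p.1‖) ^ 2)⁻¹ * ((1 + ‖p.2‖) ^ 2)⁻¹ * B (p.2 - p.1) ^ 2 := by
      simp only [g]
      rw [mul_pow, mul_pow, inv_pow, inv_pow]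
    rw [e, ← add_mul, ← mul_assoc]
    refine mul_le_mul_of_nonneg_right ?_ (sq_nonneg _)
    simp only [k]
    nlinarith [sq_nonneg (((1 + ‖p.1‖) ^ 2)⁻¹ - ((1 + ‖p.2‖) ^ 2)⁻¹)]
  have dg : Integrable (fun p => g p ^ 2) ν :=
    ((d1.add d2).const_mul 2⁻¹).mono' (hg.pow 2) (Eventually.of_forall fun p => by
      rw [Real.norm_of_nonneg (sq_nonneg _)]; exact hgle p)
  have vg : ∫ p, g p ^ 2 ∂ν ≤ embConst ^ 2 * ∫ ξ, B ξ ^ 2 := by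
    refine (integral_mono dg ((d1.add d2).const_mul 2⁻¹) hgle).trans_eq ?_
    rw [integral_const_mul, integral_add' d1 d2, v1, v2]
    ring
  have vf : ∫ p, f p ^ 2 ∂ν =
      (∫ ξ, (1 + ‖ξ‖) ^ 2 * A ξ ^ 2) * ∫ ξ, (1 + ‖ξ‖) ^ 2 * C ξ ^ 2 := by
    simp_rw [ef]
    exact integral_prod_mul (fun ξ => (1 + ‖ξ‖) ^ 2 * A ξ ^ 2) fun ξ => (1 + ‖ξ‖) ^ 2 * C ξ ^ 2
  have hfg := integrable_mul_of_sq hf hg hf2 dg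
  have efg : ∀ η ζ, f (η, ζ) * g (η, ζ) = A η * (C ζ * B (ζ - η)) := by
    intro η ζ
    have h1 : (1 + ‖η‖) ≠ 0 := by positivity
    have h2 : (1 + ‖ζ‖) ≠ 0 := by positivity
    simp only [f, g]
    field_simp
  have e : ∫ p, f p * g p ∂ν = ∫ η, A η * ∫ ζ, C ζ * B (ζ - η) := by
    rw [integral_prod _ hfg]
    simp only [efg, integral_const_mul]
  rw [← e]
  refine (integral_mul_le_sqrt hf hg hf2 dg).trans ?_
  rw [vf, Real.sqrt_mul (integral_nonneg fun _ => by positivity)]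
  have h3 : Real.sqrt (∫ p, g p ^ 2 ∂ν) ≤ embConst * Real.sqrt (∫ ξ, B ξ ^ 2) := by
    rw [← Real.sqrt_sq embConst_nonneg, ← Real.sqrt_mul (sq_nonneg _)]
    exact Real.sqrt_le_sqrt vg
  calc _ ≤ Real.sqrt (∫ ξ, (1 + ‖ξ‖) ^ 2 * A ξ ^ 2) * Real.sqrt (∫ ξ, (1 + ‖ξ‖) ^ 2 * C ξ ^ 2) *
        (embConst * Real.sqrt (∫ ξ, B ξ ^ 2)) := by gcongr
    _ = _ := by ring

/-- Two factors in `H¹` and one in `L²`. -/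
theorem norm_tri_le_sobolev {a b c : L2} (ha : Wiener 0 a) (ha1 : Reg 1 a) (hc : Reg 1 c) :
    ‖tri a b c‖ ≤ embConst * Real.sqrt (regSq 1 a) * ‖b‖ * Real.sqrt (regSq 1 c) := by
  refine (norm_tri_le_conv ha).trans ?_
  have h := integral_weighted_conv_le (Reg.aesm a).norm (Reg.aesm b).norm (Reg.aesm c).norm
    ha1 (integrable_normSq (𝓕 b)) hc
  rwa [integral_normSq_fourier, Real.sqrt_sq (norm_nonneg _)] at h

/-! ### The energy on the Fourier side -/

/-- The spectral density of a vector field. -/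
def dens (z : Field) (ξ : Space) : ℝ := ∑ i, ‖(𝓕 (z i) : L2) ξ‖ ^ 2

/-- The energy `∫ (1 + α|k|²) |ẑ|²`. -/
def energy (α : ℝ) (z : Field) : ℝ := ∫ ξ, wt α ξ * dens z ξ

lemma dens_nonneg (z : Field) (ξ : Space) : 0 ≤ dens z ξ :=
  Finset.sum_nonneg fun _ _ => sq_nonneg _

lemma integrable_dens (z : Field) : Integrable (dens z) :=
  integrable_finsetSum _ fun i _ => integrable_normSq (𝓕 (z i))

lemma integral_dens (z : Field) : ∫ ξ, dens z ξ = ∑ i, ‖z i‖ ^ 2 := by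
  unfold dens
  rw [integral_finsetSum _ fun i _ => integrable_normSq (𝓕 (z i))]
  simp_rw [integral_normSq_fourier]

lemma energy_nonneg {α : ℝ} (hα : 0 < α) (z : Field) : 0 ≤ energy α z :=
  integral_nonneg fun ξ => mul_nonneg (wt_pos hα ξ).le (dens_nonneg z ξ)

lemma Reg.integrable_mul {n : ℕ} {f : L2} (hf : Reg n f) {p : Space → ℝ}
    (hp : AEStronglyMeasurable p) {c : ℝ} (hc : ∀ ξ, |p ξ| ≤ c * (1 + ‖ξ‖) ^ (2 * n)) :
    Integrable fun ξ => p ξ * ‖(𝓕 f : L2) ξ‖ ^ 2 := by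
  refine Integrable.mono' (Integrable.const_mul hf c) (hp.mul ((Reg.aesm f).norm.pow 2))
    (Eventually.of_forall fun ξ => ?_)
  rw [norm_mul, norm_pow, norm_norm, Real.norm_eq_abs, ← mul_assoc]
  gcongr
  exact hc ξ

lemma integrable_mul_dens {n : ℕ} {z : Field} (hz : ∀ i, Reg n (z i)) {p : Space → ℝ}
    (hp : AEStronglyMeasurable p) {c : ℝ} (hc : ∀ ξ, |p ξ| ≤ c * (1 + ‖ξ‖) ^ (2 * n)) :
    Integrable fun ξ => p ξ * dens z ξ := by
  unfold dens
  simp_rw [Finset.mul_sum]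
  exact integrable_finsetSum _ fun i _ => (hz i).integrable_mul hp hc

lemma ksq_le (ξ : Space) : ksq ξ ≤ (2 * Real.pi) ^ 2 * (1 + ‖ξ‖) ^ 2 := by
  have := norm_ksq_le ξ
  rwa [Complex.norm_real, Real.norm_of_nonneg (ksq_nonneg ξ)] at this

lemma wt_le {α : ℝ} (hα : 0 < α) (ξ : Space) :
    wt α ξ ≤ (1 + α * (2 * Real.pi) ^ 2) * (1 + ‖ξ‖) ^ 2 := by
  have h1 := ksq_le ξ
  have h2 : 1 ≤ (1 + ‖ξ‖) ^ 2 := by nlinarith [norm_nonneg ξ]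
  unfold wt
  nlinarith

lemma integrable_ksq_dens {z : Field} (hz : ∀ i, Reg 1 (z i)) :
    Integrable fun ξ => ksq ξ * dens z ξ :=
  integrable_mul_dens (n := 1) hz continuous_ksq.aestronglyMeasurable fun ξ => by
    rw [abs_of_nonneg (ksq_nonneg ξ)]; exact ksq_le ξ

lemma integrable_wt_dens {α : ℝ} (hα : 0 < α) {z : Field} (hz : ∀ i, Reg 1 (z i)) :
    Integrable fun ξ => wt α ξ * dens z ξ :=
  integrable_mul_dens (n := 1) hz (continuous_wt α).aestronglyMeasurable fun ξ => by
    rw [abs_of_pos (wt_pos hα ξ)]; exact wt_le hα ξ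

lemma normSq_dL2 (j : Fin 3) {f : L2} (hf : Reg 1 f) :
    ‖dL2 j f‖ ^ 2 = ∫ ξ, ‖dsym j ξ‖ ^ 2 * ‖(𝓕 f : L2) ξ‖ ^ 2 := by
  rw [← integral_normSq_fourier]
  refine integral_congr_ae ?_
  filter_upwards [fourier_dL2 j hf] with ξ h
  rw [h, norm_mul, mul_pow]

lemma sum_normSq_dL2 {z : Field} (hz : ∀ i, Reg 1 (z i)) :
    ∑ i, ∑ j, ‖dL2 j (z i)‖ ^ 2 = ∫ ξ, ksq ξ * dens z ξ := by
  simp_rw [normSq_dL2 _ (hz _)]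
  have hi : ∀ i j, Integrable fun ξ => ‖dsym j ξ‖ ^ 2 * ‖(𝓕 (z i) : L2) ξ‖ ^ 2 := fun i j =>
    (hz i).integrable_mul ((continuous_dsym j).norm.pow 2).aestronglyMeasurable
      (c := (2 * Real.pi) ^ 2) fun ξ => by
        rw [abs_of_nonneg (by positivity)]
        calc ‖dsym j ξ‖ ^ 2 ≤ (2 * Real.pi * (1 + ‖ξ‖) ^ 1) ^ 2 := by
              gcongr; exact norm_dsym_le' j ξ
          _ = _ := by ring
  simp_rw [← integral_finsetSum Finset.univ fun j _ => hi _ j]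
  rw [← integral_finsetSum Finset.univ fun i _ => integrable_finsetSum _ fun j _ => hi i j]
  congr 1
  ext ξ
  simp_rw [dens, ← sum_normSq_dsym, Finset.sum_mul_sum]
  rw [Finset.sum_comm]

lemma normSqH1_eq_energy {α : ℝ} {z : Field} (hz : ∀ i, Reg 1 (z i)) :
    normSqH1 α z = energy α z := by
  rw [normSqH1, sum_normSq_dL2 hz, ← integral_dens, ← integral_const_mul, ← integral_add
    (integrable_dens z) ((integrable_ksq_dens hz).const_mul α), energy]
  congr 1
  ext ξ
  rw [wt]; ring

lemma le_sum_fin (f : Fin 3 → ℝ) (hf : ∀ i, 0 ≤ f i) (i : Fin 3) : f i ≤ ∑ i, f i :=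
  Finset.single_le_sum (fun i _ => hf i) (Finset.mem_univ i)

lemma normSq_le_energy {α : ℝ} (hα : 0 < α) {z : Field} (hz : ∀ i, Reg 1 (z i)) (i : Fin 3) :
    ‖z i‖ ^ 2 ≤ energy α z := by
  rw [← normSqH1_eq_energy hz, normSqH1]
  have h1 := le_sum_fin (fun i => ‖z i‖ ^ 2) (fun i => sq_nonneg ‖z i‖) i
  have h2 : 0 ≤ α * ∑ i, ∑ j, ‖dL2 j (z i)‖ ^ 2 := mul_nonneg hα.le
    (Finset.sum_nonneg fun i _ => Finset.sum_nonneg fun j _ => sq_nonneg ‖dL2 j (z i)‖)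
  exact h1.trans (le_add_of_nonneg_right h2)

lemma normSq_dL2_le_energy {α : ℝ} (hα : 0 < α) {z : Field} (hz : ∀ i, Reg 1 (z i))
    (i j : Fin 3) : ‖dL2 j (z i)‖ ^ 2 ≤ α⁻¹ * energy α z := by
  rw [← normSqH1_eq_energy hz, normSqH1, mul_add, inv_mul_cancel_left₀ hα.ne']
  have h1 := le_sum_fin (fun j => ‖dL2 j (z i)‖ ^ 2) (fun j => sq_nonneg ‖dL2 j (z i)‖) j
  have h2 := le_sum_fin (fun i => ∑ j, ‖dL2 j (z i)‖ ^ 2)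
    (fun i => Finset.sum_nonneg fun j _ => sq_nonneg ‖dL2 j (z i)‖) i
  have h3 : 0 ≤ α⁻¹ * ∑ i, ‖z i‖ ^ 2 := mul_nonneg (inv_pos.2 hα).le
    (Finset.sum_nonneg fun i _ => sq_nonneg ‖z i‖)
  exact (h1.trans h2).trans (le_add_of_nonneg_left h3)

/-! ### Low and high frequencies, and the norm of the test field -/

/-- The closed unit ball of frequencies. -/
abbrev lowBall : Set Space := Metric.closedBall 0 1

lemma measurableSet_lowBall : MeasurableSet lowBall := Metric.isClosed_closedBall.measurableSet

/-- The part of the `H³` norm in the frequencies `|ξ| > 1`. -/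
def highNorm (f : L2) : ℝ :=
  Real.sqrt (∫ ξ in lowBallᶜ, (1 + ‖ξ‖) ^ 6 * ‖(𝓕 f : L2) ξ‖ ^ 2)

/-- The integral norm that controls the first two derivatives in the frequencies `|ξ| ≤ 1`. -/
def lowNorm (f : L2) : ℝ :=
  ∫ ξ in lowBall, (2 * Real.pi * ‖ξ‖ + (2 * Real.pi * ‖ξ‖) ^ 2) * ‖(𝓕 f : L2) ξ‖

/-- The norm of a test field in the bounds of the nonlinearity. -/
def waveNorm (ψ : Field) : ℝ := ∑ i, (lowNorm (ψ i) + highNorm (ψ i))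

lemma lowNorm_nonneg (f : L2) : 0 ≤ lowNorm f := integral_nonneg fun _ => by positivity

lemma highNorm_nonneg (f : L2) : 0 ≤ highNorm f := Real.sqrt_nonneg _

lemma waveNorm_nonneg (ψ : Field) : 0 ≤ waveNorm ψ :=
  Finset.sum_nonneg fun _ _ => add_nonneg (lowNorm_nonneg _) (highNorm_nonneg _)

lemma le_waveNorm (ψ : Field) (i : Fin 3) : lowNorm (ψ i) + highNorm (ψ i) ≤ waveNorm ψ :=
  le_sum_fin (fun i => lowNorm (ψ i) + highNorm (ψ i))
    (fun i => add_nonneg (lowNorm_nonneg (ψ i)) (highNorm_nonneg (ψ i))) i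

lemma integrableOn_lowNorm (f : L2) : IntegrableOn
    (fun ξ => (2 * Real.pi * ‖ξ‖ + (2 * Real.pi * ‖ξ‖) ^ 2) * ‖(𝓕 f : L2) ξ‖) lowBall := by
  have hf : IntegrableOn (fun ξ => ‖(𝓕 f : L2) ξ‖) lowBall := by
    have h : MemLp (fun ξ => (𝓕 f : L2) ξ) 2 (volume.restrict lowBall) :=
      (Lp.memLp (𝓕 f)).restrict _
    have hfin : IsFiniteMeasure ((volume : Measure Space).restrict lowBall) :=
      ⟨by simp⟩
    exact (h.integrable (by norm_num)).norm
  refine hf.bdd_mul (c := 2 * Real.pi + (2 * Real.pi) ^ 2) (by fun_prop) ?_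
  rw [ae_restrict_iff' measurableSet_lowBall]
  refine Eventually.of_forall fun ξ hξ => ?_
  have h1 : ‖ξ‖ ≤ 1 := by simpa using hξ
  rw [Real.norm_of_nonneg (by positivity)]
  have := Real.pi_pos
  have h2 : 2 * Real.pi * ‖ξ‖ ≤ 2 * Real.pi := mul_le_of_le_one_right (by positivity) h1
  gcongr

lemma indicator_memLp {S : Set Space} (hS : MeasurableSet S) :
    MemLp (S.indicator (fun _ => (1 : ℂ))) ⊤ :=
  memLp_top_of_le (c := 1) (measurable_const.indicator hS).aestronglyMeasurable fun ξ => by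
    by_cases h : ξ ∈ S <;> simp [h]

/-- The projection onto the frequencies in `S`. -/
def proj (S : Set Space) (hS : MeasurableSet S) : L2 →L[ℂ] L2 :=
  fmulL (S.indicator fun _ => (1 : ℂ)) (indicator_memLp hS)

lemma fourier_proj {S : Set Space} (hS : MeasurableSet S) (f : L2) :
    ∀ᵐ ξ, (𝓕 (proj S hS f) : L2) ξ = S.indicator (fun ξ => (𝓕 f : L2) ξ) ξ := by
  filter_upwards [fourier_fmulL (indicator_memLp hS) f] with ξ h
  rw [proj, h]
  by_cases hξ : ξ ∈ S <;> simp [hξ]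

lemma proj_add_proj_compl {S : Set Space} (hS : MeasurableSet S) (f : L2) :
    proj S hS f + proj Sᶜ hS.compl f = f := by
  refine eq_of_fourier_ae ?_
  have e : 𝓕 (proj S hS f + proj Sᶜ hS.compl f) = 𝓕 (proj S hS f) + 𝓕 (proj Sᶜ hS.compl f) :=
    FourierTransform.fourier_add _ _
  rw [e]
  filter_upwards [Lp.coeFn_add (𝓕 (proj S hS f)) (𝓕 (proj Sᶜ hS.compl f)), fourier_proj hS f,
    fourier_proj hS.compl f] with ξ h1 h2 h3
  rw [h1, Pi.add_apply, h2, h3]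
  by_cases hξ : ξ ∈ S <;> simp [hξ]

lemma Reg.proj {n : ℕ} {f : L2} (hf : Reg n f) {S : Set Space} (hS : MeasurableSet S) :
    Reg n (proj S hS f) ∧
      regSq n (SecondGrade.proj S hS f) = ∫ ξ in S, (1 + ‖ξ‖) ^ (2 * n) * ‖(𝓕 f : L2) ξ‖ ^ 2 := by
  have e : (fun ξ => (1 + ‖ξ‖) ^ (2 * n) * ‖(𝓕 (SecondGrade.proj S hS f) : L2) ξ‖ ^ 2) =ᵐ[volume]
      S.indicator fun ξ => (1 + ‖ξ‖) ^ (2 * n) * ‖(𝓕 f : L2) ξ‖ ^ 2 := by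
    filter_upwards [fourier_proj hS f] with ξ h
    rw [h]
    by_cases hξ : ξ ∈ S <;> simp [hξ]
  refine ⟨(Integrable.indicator hf hS).congr e.symm, ?_⟩
  rw [regSq, integral_congr_ae e, integral_indicator hS]

lemma Wiener.proj {n : ℕ} {f : L2} (hf : Wiener n f) {S : Set Space} (hS : MeasurableSet S) :
    Wiener n (proj S hS f) ∧
      ∫ ξ, ‖(𝓕 (SecondGrade.proj S hS f) : L2) ξ‖ = ∫ ξ in S, ‖(𝓕 f : L2) ξ‖ := by
  have e : ∀ n : ℕ, (fun ξ => (1 + ‖ξ‖) ^ n * ‖(𝓕 (SecondGrade.proj S hS f) : L2) ξ‖) =ᵐ[volume]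
      S.indicator fun ξ => (1 + ‖ξ‖) ^ n * ‖(𝓕 f : L2) ξ‖ := by
    intro n
    filter_upwards [fourier_proj hS f] with ξ h
    rw [h]
    by_cases hξ : ξ ∈ S <;> simp [hξ]
  refine ⟨(Integrable.indicator hf hS).congr (e n).symm, ?_⟩
  have := e 0
  simp only [pow_zero, one_mul] at this
  rw [integral_congr_ae this, integral_indicator hS]

lemma dsym_le_low (j : Fin 3) (ξ : Space) :
    ‖dsym j ξ‖ ≤ 2 * Real.pi * ‖ξ‖ + (2 * Real.pi * ‖ξ‖) ^ 2 :=
  (norm_dsym_le j ξ).trans (le_add_of_nonneg_right (by positivity))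

lemma dsym_mul_le_low (j k : Fin 3) (ξ : Space) :
    ‖dsym k ξ * dsym j ξ‖ ≤ 2 * Real.pi * ‖ξ‖ + (2 * Real.pi * ‖ξ‖) ^ 2 := by
  rw [norm_mul]
  calc ‖dsym k ξ‖ * ‖dsym j ξ‖ ≤ (2 * Real.pi * ‖ξ‖) * (2 * Real.pi * ‖ξ‖) :=
        mul_le_mul (norm_dsym_le _ _) (norm_dsym_le _ _) (norm_nonneg _) (by positivity)
    _ ≤ _ := by rw [← sq]; exact le_add_of_nonneg_left (by positivity)

lemma setIntegral_low_le {f g : L2} {σ : Space → ℂ}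
    (hσ : ∀ ξ, ‖σ ξ‖ ≤ 2 * Real.pi * ‖ξ‖ + (2 * Real.pi * ‖ξ‖) ^ 2)
    (hg : ∀ᵐ ξ, (𝓕 g : L2) ξ = σ ξ * (𝓕 f : L2) ξ) :
    ∫ ξ in lowBall, ‖(𝓕 g : L2) ξ‖ ≤ lowNorm f := by
  refine integral_mono_of_nonneg (Eventually.of_forall fun _ => norm_nonneg _)
    (integrableOn_lowNorm f) (ae_restrict_of_ae ?_)
  filter_upwards [hg] with ξ h
  rw [h, norm_mul]
  gcongr
  exact hσ ξ

/-- A symbol of order m commutes with the projection onto |ξ| > 1. The condition n + m = 3 reflects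
that at high frequencies only the H³ norm of the test field is available. -/
lemma regSq_high_le {n m : ℕ} (hnm : n + m = 3) {f g : L2} (hf : Reg 3 f) {σ : Space → ℂ} {c : ℝ}
    (hc : 0 ≤ c) (hσ : ∀ ξ, ‖σ ξ‖ ≤ c * (1 + ‖ξ‖) ^ m)
    (hg : ∀ᵐ ξ, (𝓕 g : L2) ξ = σ ξ * (𝓕 f : L2) ξ) :
    Real.sqrt (regSq n (proj lowBallᶜ measurableSet_lowBall.compl g)) ≤ c * highNorm f := by
  have hr := hf.proj measurableSet_lowBall.compl
  have h : ∀ᵐ ξ, (𝓕 (proj lowBallᶜ measurableSet_lowBall.compl g) : L2) ξ =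
      σ ξ * (𝓕 (proj lowBallᶜ measurableSet_lowBall.compl f) : L2) ξ := by
    filter_upwards [fourier_proj measurableSet_lowBall.compl f,
      fourier_proj measurableSet_lowBall.compl g, hg] with ξ h1 h2 h3
    rw [h1, h2]
    by_cases hξ : ξ ∈ lowBallᶜ
    · rw [Set.indicator_of_mem hξ, Set.indicator_of_mem hξ, h3]
    · rw [Set.indicator_of_notMem hξ, Set.indicator_of_notMem hξ, mul_zero]
  have h2 := (Reg.symbol (n := n) (m := m) (by rw [hnm]; exact hr.1) hσ h).2
  rw [hnm, hr.2] at h2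
  rw [highNorm, ← Real.sqrt_sq hc, ← Real.sqrt_mul (sq_nonneg _)]
  exact Real.sqrt_le_sqrt h2

/-- The constant in the bounds of derivatives by `waveNorm`. -/
def waveConst : ℝ := 1 + (2 * Real.pi) ^ 2 * embConst

lemma one_le_waveConst : 1 ≤ waveConst := by
  have := embConst_nonneg
  unfold waveConst
  have : 0 ≤ (2 * Real.pi) ^ 2 * embConst := by positivity
  linarith

/-- For |ξ| ≤ 1 the integral is part of `lowNorm`. For |ξ| > 1 the derivative is in H², which embeds
into the functions with integrable transform. -/
lemma integral_norm_dL2_le {ψ : Field} (hψ : ∀ i, Wiener 2 (ψ i)) (hψ' : ∀ i, Reg 3 (ψ i))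
    (i j : Fin 3) : ∫ ξ, ‖(𝓕 (dL2 j (ψ i)) : L2) ξ‖ ≤ waveConst * waveNorm ψ := by
  have hψ1 : Reg 1 (ψ i) := (hψ' i).mono (by norm_num)
  have hw : Wiener 0 (dL2 j (ψ i)) := ((hψ i).dL2 hψ1 j).mono (by norm_num)
  have h1 := setIntegral_low_le (dsym_le_low j) (fourier_dL2 j hψ1)
  have h2 := regSq_high_le (n := 2) (m := 1) rfl (hψ' i) (by positivity) (norm_dsym_le' j)
    (fourier_dL2 j hψ1)
  have h3 := (hw.proj measurableSet_lowBall.compl).2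
  have hr2 := ((hψ' i).dL2 (n := 2) j).1.proj measurableSet_lowBall.compl
  have h4 := (Reg.wiener (n := 0) hr2.1).2
  simp only [pow_zero, one_mul, zero_add] at h4
  rw [← integral_add_compl measurableSet_lowBall hw.integrable.norm, ← h3]
  have h5 := le_waveNorm ψ i
  have e0 := embConst_nonneg
  have h6 : embConst * Real.sqrt (regSq 2 (proj lowBallᶜ measurableSet_lowBall.compl
      (dL2 j (ψ i)))) ≤ (2 * Real.pi) ^ 2 * embConst * highNorm (ψ i) := by
    calc _ ≤ embConst * (2 * Real.pi * highNorm (ψ i)) := by gcongr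
      _ = 2 * Real.pi * (embConst * highNorm (ψ i)) := by ring
      _ ≤ (2 * Real.pi) ^ 2 * (embConst * highNorm (ψ i)) := by
        refine mul_le_mul_of_nonneg_right ?_ (mul_nonneg e0 (highNorm_nonneg _))
        nlinarith [Real.pi_gt_three]
      _ = _ := by ring
  have hc : 0 ≤ (2 * Real.pi) ^ 2 * embConst := by positivity
  unfold waveConst
  nlinarith [lowNorm_nonneg (ψ i), highNorm_nonneg (ψ i), mul_nonneg hc (lowNorm_nonneg (ψ i)),
    mul_le_mul_of_nonneg_left h5 hc]

lemma tri_conj_add {a b c c' : L2} (h : Wiener 0 a) :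
    tri a b (c + c') = tri a b c + tri a b c' := by
  rw [tri, tri, tri, ← integral_add (integrable_tri_left h) (integrable_tri_left h)]
  refine integral_congr_ae ?_
  filter_upwards [Lp.coeFn_add c c'] with x hx
  rw [hx, Pi.add_apply, map_add]
  ring

/-- Second derivatives of a field in H³ need not be bounded. Only their low-frequency part is
estimated in the supremum norm. The high-frequency part is merely in H¹, and is paired with `a` in
H¹ and `b` in L². -/
lemma norm_tri_dL2_dL2_le {a b : L2} {ψ : Field} (ha : Wiener 0 a) (ha1 : Reg 1 a)
    (hψ : ∀ i, Wiener 2 (ψ i)) (hψ' : ∀ i, Reg 3 (ψ i)) (i j k : Fin 3) :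
    ‖tri a b (dL2 k (dL2 j (ψ i)))‖ ≤
      (‖a‖ + Real.sqrt (regSq 1 a)) * ‖b‖ * (waveConst * waveNorm ψ) := by
  have hψ1 : Reg 1 (ψ i) := (hψ' i).mono (by norm_num)
  have hr2 : Reg 2 (dL2 j (ψ i)) := (Reg.dL2 (n := 2) (hψ' i) j).1
  have hr1 : Reg 1 (dL2 k (dL2 j (ψ i))) := (Reg.dL2 (n := 1) hr2 k).1
  have hw : Wiener 0 (dL2 k (dL2 j (ψ i))) :=
    ((hψ i).dL2 hψ1 j).dL2 (hr2.mono (by norm_num)) k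
  have hs : ∀ᵐ ξ, (𝓕 (dL2 k (dL2 j (ψ i))) : L2) ξ = dsym k ξ * dsym j ξ * (𝓕 (ψ i) : L2) ξ := by
    filter_upwards [fourier_dL2 j hψ1, fourier_dL2 k (hr2.mono (by norm_num))] with ξ h h'
    rw [h', h]
    ring
  have hσ : ∀ ξ, ‖dsym k ξ * dsym j ξ‖ ≤ (2 * Real.pi) ^ 2 * (1 + ‖ξ‖) ^ 2 := by
    intro ξ
    rw [norm_mul]
    calc _ ≤ ((2 * Real.pi) * (1 + ‖ξ‖) ^ 1) * ((2 * Real.pi) * (1 + ‖ξ‖) ^ 1) :=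
          mul_le_mul (norm_dsym_le' k ξ) (norm_dsym_le' j ξ) (norm_nonneg _) (by positivity)
      _ = _ := by ring
  have h1 := setIntegral_low_le (dsym_mul_le_low j k) hs
  have h2 := regSq_high_le (n := 1) (m := 2) rfl (hψ' i) (by positivity) hσ hs
  set c := dL2 k (dL2 j (ψ i))
  have p1 := hw.proj measurableSet_lowBall
  have t1 := norm_tri_le (a := a) (b := b) p1.1
  have t2 := norm_tri_le_sobolev (b := b) ha ha1 (hr1.proj measurableSet_lowBall.compl).1
  rw [p1.2] at t1
  have e0 := embConst_nonneg
  rw [← proj_add_proj_compl measurableSet_lowBall c, tri_conj_add ha]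
  have h5 := le_waveNorm ψ i
  have l0 := lowNorm_nonneg (ψ i)
  have g0 := highNorm_nonneg (ψ i)
  have k1 : lowNorm (ψ i) ≤ waveConst * waveNorm ψ :=
    (by linarith : lowNorm (ψ i) ≤ waveNorm ψ).trans
      (le_mul_of_one_le_left (waveNorm_nonneg ψ) one_le_waveConst)
  have k2 : embConst * ((2 * Real.pi) ^ 2 * highNorm (ψ i)) ≤ waveConst * waveNorm ψ := by
    calc _ = ((2 * Real.pi) ^ 2 * embConst) * highNorm (ψ i) := by ring
      _ ≤ waveConst * waveNorm ψ := by
        refine mul_le_mul ?_ (by linarith) g0 (zero_le_one.trans one_le_waveConst)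
        unfold waveConst; linarith
  calc _ ≤ ‖a‖ * ‖b‖ * (waveConst * waveNorm ψ) +
        Real.sqrt (regSq 1 a) * ‖b‖ * (waveConst * waveNorm ψ) := by
        refine (norm_add_le _ _).trans (add_le_add (t1.trans ?_) (t2.trans ?_))
        · gcongr
          exact h1.trans k1
        · calc _ ≤ embConst * Real.sqrt (regSq 1 a) * ‖b‖ * ((2 * Real.pi) ^ 2 * highNorm (ψ i)) := by
                gcongr
            _ = Real.sqrt (regSq 1 a) * ‖b‖ * (embConst * ((2 * Real.pi) ^ 2 * highNorm (ψ i))) := by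
                ring
            _ ≤ _ := by gcongr
    _ = _ := by ring

lemma sq_one_add_norm_le {α : ℝ} (hα : 0 < α) (ξ : Space) :
    (1 + ‖ξ‖) ^ 2 ≤ 2 * (1 + α⁻¹) * wt α ξ := by
  have h2 : ‖ξ‖ ^ 2 ≤ ksq ξ := by
    have : (1:ℝ) ≤ (2 * Real.pi) ^ 2 := by nlinarith [Real.pi_gt_three]
    unfold ksq; nlinarith [sq_nonneg ‖ξ‖]
  have h3 : ksq ξ ≤ α⁻¹ * wt α ξ := by
    rw [← div_eq_inv_mul, le_div_iff₀ hα]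
    unfold wt; linarith
  have h4 := one_le_wt hα ξ
  have h5 : 0 ≤ (1 - ‖ξ‖) ^ 2 := sq_nonneg _
  nlinarith

lemma regSq_one_le {α : ℝ} (hα : 0 < α) {z : Field} (hz : ∀ i, Reg 1 (z i)) (i : Fin 3) :
    regSq 1 (z i) ≤ 2 * (1 + α⁻¹) * energy α z := by
  rw [regSq, energy, ← integral_const_mul]
  refine integral_mono (hz i) ((integrable_wt_dens hα hz).const_mul _) fun ξ => ?_
  simp only
  rw [← mul_assoc]
  refine mul_le_mul (sq_one_add_norm_le hα ξ) ?_ (by positivity) ?_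
  · exact le_sum_fin (fun i => ‖(𝓕 (z i) : L2) ξ‖ ^ 2) (fun i => sq_nonneg ‖(𝓕 (z i) : L2) ξ‖) i
  · have := wt_pos hα ξ
    positivity

/-- The constant in the bound of the nonlinearity. -/
def nlConst (α : ℝ) : ℝ := 9 * (1 + 9 * α) * (3 * (1 + α⁻¹)) * waveConst

/-- In each term `a` and `b` carry at most one derivative. Second derivatives of ψ occur only next
to an undifferentiated component of `a`, which is in H¹, as `norm_tri_dL2_dL2_le` requires. -/
lemma norm_weakNonlin_le {α : ℝ} (hα : 0 < α) {a b ψ : Field} (ha : ∀ i, Reg 1 (a i))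
    (hwa : ∀ i, Wiener 0 (a i)) (hb : ∀ i, Reg 1 (b i)) (hψ : ∀ i, Wiener 2 (ψ i))
    (hψ' : ∀ i, Reg 3 (ψ i)) : ‖weakNonlin α a b ψ‖ ≤
      nlConst α * (Real.sqrt (energy α a) * Real.sqrt (energy α b) * waveNorm ψ) := by
  set A := Real.sqrt (energy α a)
  set B := Real.sqrt (energy α b)
  set P := waveConst * waveNorm ψ with hPdef
  have hP : 0 ≤ P := mul_nonneg (zero_le_one.trans one_le_waveConst) (waveNorm_nonneg ψ)
  -- A common factor for the bounds by √E: the L² norm of a component needs the constant 1 and that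
  -- of a derivative needs α^(-1/2).
  set s := Real.sqrt (1 + α⁻¹)
  have hs : s * s = 1 + α⁻¹ := Real.mul_self_sqrt (by positivity)
  have hpos : 0 ≤ α⁻¹ := by positivity
  have n0 : ∀ (z : Field), (∀ i, Reg 1 (z i)) → ∀ i, ‖z i‖ ≤ s * Real.sqrt (energy α z) := by
    intro z hz i
    rw [← Real.sqrt_mul (by positivity)]
    refine Real.le_sqrt_of_sq_le ((normSq_le_energy hα hz i).trans ?_)
    nlinarith [energy_nonneg hα z, mul_nonneg hpos (energy_nonneg hα z)]
  have n1 : ∀ (z : Field), (∀ i, Reg 1 (z i)) → ∀ i j, ‖dL2 j (z i)‖ ≤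
      s * Real.sqrt (energy α z) := by
    intro z hz i j
    rw [← Real.sqrt_mul (by positivity)]
    refine Real.le_sqrt_of_sq_le ((normSq_dL2_le_energy hα hz i j).trans ?_)
    nlinarith [energy_nonneg hα z]
  have n2 : ∀ i, ‖a i‖ + Real.sqrt (regSq 1 (a i)) ≤ (3 * s) * A := by
    intro i
    have h1 : Real.sqrt (regSq 1 (a i)) ≤ 2 * (s * A) := by
      rw [← Real.sqrt_mul (by positivity), Real.sqrt_le_left (by positivity), mul_pow,
        Real.sq_sqrt (mul_nonneg (by positivity) (energy_nonneg hα a))]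
      refine (regSq_one_le hα ha i).trans ?_
      nlinarith [mul_nonneg (by positivity : 0 ≤ 1 + α⁻¹) (energy_nonneg hα a)]
    linarith [n0 a ha i]
  have hψ1 : ∀ i, Reg 1 (ψ i) := fun i => (hψ' i).mono (by norm_num)
  have hM : 0 ≤ (1 + α⁻¹) * (A * B * P) := by positivity
  have t : ∀ {f g h : L2}, ‖f‖ ≤ s * A → ‖g‖ ≤ s * B → Wiener 0 h → ∫ ξ, ‖(𝓕 h : L2) ξ‖ ≤ P →
      ‖tri f g h‖ ≤ 3 * ((1 + α⁻¹) * (A * B * P)) := by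
    intro f g h hf hg hh hP'
    refine (norm_tri_le hh).trans ?_
    calc ‖f‖ * ‖g‖ * ∫ ξ, ‖(𝓕 h : L2) ξ‖ ≤ (s * A) * (s * B) * P := by gcongr
      _ = (1 + α⁻¹) * (A * B * P) := by rw [← hs]; ring
      _ ≤ _ := by linarith
  have wd : ∀ i j, Wiener 1 (dL2 j (ψ i)) := fun i j => (hψ i).dL2 (hψ1 i) j
  have b1 : ∀ i j, ‖tri (a j) (b i) (dL2 j (ψ i))‖ ≤ 3 * ((1 + α⁻¹) * (A * B * P)) := fun i j =>
    t (n0 a ha j) (n0 b hb i) ((wd i j).mono (by norm_num)) (integral_norm_dL2_le hψ hψ' i j)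
  have b2 : ∀ i j k, ‖tri (dL2 k (a j)) (dL2 k (b i)) (dL2 j (ψ i))‖ ≤
      3 * ((1 + α⁻¹) * (A * B * P)) := fun i j k =>
    t (n1 a ha j k) (n1 b hb i k) ((wd i j).mono (by norm_num)) (integral_norm_dL2_le hψ hψ' i j)
  have b3 : ∀ i j k, ‖tri (a j) (dL2 k (b i)) (dL2 k (dL2 j (ψ i)))‖ ≤
      3 * ((1 + α⁻¹) * (A * B * P)) := fun i j k => by
    refine (norm_tri_dL2_dL2_le (hwa j) (ha j) hψ hψ' i j k).trans ?_
    calc _ ≤ (3 * s * A) * (s * B) * P := by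
          gcongr
          · exact n2 j
          · exact n1 b hb i k
      _ = _ := by rw [← hs]; ring
  have b4 : ∀ i j k, ‖tri (dL2 j (a i)) (dL2 k (b i)) (dL2 k (ψ j))‖ ≤
      3 * ((1 + α⁻¹) * (A * B * P)) := fun i j k =>
    t (n1 a ha i j) (n1 b hb i k) ((wd j k).mono (by norm_num)) (integral_norm_dL2_le hψ hψ' j k)
  set M := 3 * ((1 + α⁻¹) * (A * B * P)) with hMdef
  have hk : ∀ i j, ‖∑ k, (-tri (dL2 k (a j)) (dL2 k (b i)) (dL2 j (ψ i))
      - tri (a j) (dL2 k (b i)) (dL2 k (dL2 j (ψ i)))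
      + tri (dL2 j (a i)) (dL2 k (b i)) (dL2 k (ψ j)))‖ ≤ 9 * M := by
    intro i j
    refine (norm_sum_le_of_le (f := fun k => -tri (dL2 k (a j)) (dL2 k (b i)) (dL2 j (ψ i))
      - tri (a j) (dL2 k (b i)) (dL2 k (dL2 j (ψ i)))
      + tri (dL2 j (a i)) (dL2 k (b i)) (dL2 k (ψ j))) _ (n := fun _ => 3 * M)
      fun k _ => ?_).trans_eq (by simp; ring)
    refine (norm_add_le _ _).trans ?_
    have := norm_sub_le (-tri (dL2 k (a j)) (dL2 k (b i)) (dL2 j (ψ i)))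
      (tri (a j) (dL2 k (b i)) (dL2 k (dL2 j (ψ i))))
    rw [norm_neg] at this
    linarith [b2 i j k, b3 i j k, b4 i j k]
  -- Nine pairs (i, j). Each has one term of size M and, multiplied by α, three terms of size M for
  -- each of three values of k.
  calc ‖weakNonlin α a b ψ‖ ≤ ∑ i : Fin 3, ∑ j : Fin 3, (M + α * (9 * M)) := by
        refine norm_sum_le_of_le _ fun i _ => norm_sum_le_of_le _ fun j _ => ?_
        refine (norm_add_le _ _).trans ?_
        rw [norm_neg, norm_mul, Complex.norm_real, Real.norm_of_nonneg hα.le]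
        gcongr
        · exact b1 i j
        · exact hk i j
    _ = _ := by simp [nlConst, hMdef, hPdef]; ring

lemma weakNonlin_add_left {α : ℝ} {a a' b ψ : Field} (ha : ∀ i, Reg 1 (a i))
    (ha' : ∀ i, Reg 1 (a' i)) (hψ : ∀ i, Wiener 2 (ψ i)) (hψ' : ∀ i, Reg 2 (ψ i)) :
    weakNonlin α (a + a') b ψ = weakNonlin α a b ψ + weakNonlin α a' b ψ := by
  have hψ1 : ∀ i, Reg 1 (ψ i) := fun i => (hψ' i).mono (by norm_num)
  have wd : ∀ i j, Wiener 1 (dL2 j (ψ i)) := fun i j => (hψ i).dL2 (hψ1 i) j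
  have wd0 : ∀ i j, Wiener 0 (dL2 j (ψ i)) := fun i j => (wd i j).mono (by norm_num)
  have rd : ∀ i j, Reg 1 (dL2 j (ψ i)) := fun i j => (Reg.dL2 (n := 1) (hψ' i) j).1
  have wdd : ∀ i j k, Wiener 0 (dL2 k (dL2 j (ψ i))) := fun i j k => (wd i j).dL2 (rd i j) k
  simp only [weakNonlin, Pi.add_apply, dL2_add _ (ha _) (ha' _), tri_add_left (wd0 _ _),
    tri_add_left (wdd _ _ _), ← Finset.sum_add_distrib]
  refine Finset.sum_congr rfl fun i _ => Finset.sum_congr rfl fun j _ => ?_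
  simp only [Finset.sum_add_distrib, Finset.sum_sub_distrib, Finset.sum_neg_distrib, neg_add]
  ring

lemma weakNonlin_add_right {α : ℝ} {a b b' ψ : Field} (hb : ∀ i, Reg 1 (b i))
    (hb' : ∀ i, Reg 1 (b' i)) (hψ : ∀ i, Wiener 2 (ψ i)) (hψ' : ∀ i, Reg 2 (ψ i)) :
    weakNonlin α a (b + b') ψ = weakNonlin α a b ψ + weakNonlin α a b' ψ := by
  have hψ1 : ∀ i, Reg 1 (ψ i) := fun i => (hψ' i).mono (by norm_num)
  have wd : ∀ i j, Wiener 1 (dL2 j (ψ i)) := fun i j => (hψ i).dL2 (hψ1 i) j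
  have wd0 : ∀ i j, Wiener 0 (dL2 j (ψ i)) := fun i j => (wd i j).mono (by norm_num)
  have rd : ∀ i j, Reg 1 (dL2 j (ψ i)) := fun i j => (Reg.dL2 (n := 1) (hψ' i) j).1
  have wdd : ∀ i j k, Wiener 0 (dL2 k (dL2 j (ψ i))) := fun i j k => (wd i j).dL2 (rd i j) k
  simp only [weakNonlin, Pi.add_apply, dL2_add _ (hb _) (hb' _), tri_add_right (wd0 _ _),
    tri_add_right (wdd _ _ _), ← Finset.sum_add_distrib]
  refine Finset.sum_congr rfl fun i _ => Finset.sum_congr rfl fun j _ => ?_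
  simp only [Finset.sum_add_distrib, Finset.sum_sub_distrib, Finset.sum_neg_distrib, neg_add]
  ring

lemma pairing_sub_right (f g h : Field) : pairing f (g - h) = pairing f g - pairing f h := by
  simp only [pairing, ← Finset.sum_sub_distrib]
  refine Finset.sum_congr rfl fun i _ => ?_
  rw [← integral_sub (integrable_mul_conj _ _) (integrable_mul_conj _ _)]
  refine integral_congr_ae ?_
  filter_upwards [Lp.coeFn_sub (g i) (h i)] with x hx
  rw [Pi.sub_apply, hx, Pi.sub_apply, map_sub]
  ring

/-- The work of the nonlinearity of `u` on the difference of `u` and `v`. -/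
lemma norm_pairing_nonlin_sub_le {α : ℝ} (hα : 0 < α) {u v : Field} (hu : ∀ i, Reg 3 (u i))
    (hdu : DivFree u) (hru : IsRealValued u) (hv : ∀ i, Reg 4 (v i)) (hdv : DivFree v)
    (hrv : IsRealValued v) (hw : ∀ i, Reg 3 ((u - v) i)) :
    ‖pairing (nonlin α u) (u - v)‖ ≤ nlConst α * (Real.sqrt (energy α (u - v)) *
      (Real.sqrt (energy α u) + Real.sqrt (energy α v)) * waveNorm v) := by
  have hu1 : ∀ i, Reg 1 (u i) := fun i => (hu i).mono (by norm_num)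
  have hw1 : ∀ i, Reg 1 ((u - v) i) := fun i => (hw i).mono (by norm_num)
  have hww : ∀ i, Wiener 0 ((u - v) i) := fun i =>
    (Reg.wiener (n := 0) ((hw i).mono (by norm_num))).1
  have hv1 : ∀ i, Reg 1 (v i) := fun i => (hv i).mono (by norm_num)
  have hv2 : ∀ i, Reg 2 (v i) := fun i => (hv i).mono (by norm_num)
  have hv3 : ∀ i, Reg 3 (v i) := fun i => (hv i).mono (by norm_num)
  have hwv : ∀ i, Wiener 2 (v i) := fun i => (Reg.wiener (n := 2) (hv i)).1
  -- Polarization: u = w + v is inserted first on the left and then on the right. The remaining term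
  -- of v alone does no work.
  have e : weakNonlin α u u v = weakNonlin α (u - v) u v + weakNonlin α v (u - v) v := by
    have h1 := weakNonlin_add_left (α := α) (b := u) hw1 hv1 hwv hv2
    have h2 := weakNonlin_add_right (α := α) (a := v) hw1 hv1 hwv hv2
    rw [sub_add_cancel] at h1 h2
    rw [h1, h2, ← pairing_nonlin_eq hv3 hdv hv2 hwv hdv, pairing_nonlin_self hv3 hdv hrv, add_zero]
  rw [pairing_sub_right, pairing_nonlin_self hu hdu hru, zero_sub, norm_neg,
    pairing_nonlin_eq hu hdu hv2 hwv hdv, e]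
  refine (norm_add_le _ _).trans ?_
  have h1 := norm_weakNonlin_le hα hw1 hww hu1 hwv hv3
  have h2 := norm_weakNonlin_le hα hv1 (fun i => (hwv i).mono (by norm_num)) hw1 hwv hv3
  calc _ ≤ _ := add_le_add h1 h2
    _ = _ := by ring

/-! ### The space `V₂` -/

/-- |k × a|² = |k|²|a|² - |k·a|², where the last term vanishes. Its real and imaginary parts account
for the two multiples of the hypothesis. -/
lemma lagrange_identity (k : Fin 3 → ℝ) (a : Fin 3 → ℂ) (h : ∑ j, (k j : ℂ) * a j = 0) :
    ‖k 1 * a 2 - k 2 * a 1‖ ^ 2 + ‖k 2 * a 0 - k 0 * a 2‖ ^ 2 + ‖k 0 * a 1 - k 1 * a 0‖ ^ 2 =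
      (∑ j, k j ^ 2) * ∑ j, ‖a j‖ ^ 2 := by
  have h1 := congrArg Complex.re h
  have h2 := congrArg Complex.im h
  simp only [Fin.sum_univ_three, Complex.add_re, Complex.add_im, Complex.mul_re, Complex.mul_im,
    Complex.ofReal_re, Complex.ofReal_im, zero_mul, sub_zero, add_zero, Complex.zero_re,
    Complex.zero_im] at h1 h2
  simp only [Complex.sq_norm, Complex.normSq_apply, Fin.sum_univ_three, Complex.sub_re,
    Complex.sub_im, Complex.mul_re, Complex.mul_im,
    Complex.ofReal_re, Complex.ofReal_im, zero_mul, sub_zero, add_zero]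
  linear_combination (-(k 0 * (a 0).re + k 1 * (a 1).re + k 2 * (a 2).re)) * h1
    - (k 0 * (a 0).im + k 1 * (a 1).im + k 2 * (a 2).im) * h2

lemma curl_dsym_identity (ξ : Space) (a : Fin 3 → ℂ) (h : ∑ j, dsym j ξ * a j = 0) :
    ‖dsym 1 ξ * a 2 - dsym 2 ξ * a 1‖ ^ 2 + ‖dsym 2 ξ * a 0 - dsym 0 ξ * a 2‖ ^ 2 +
      ‖dsym 0 ξ * a 1 - dsym 1 ξ * a 0‖ ^ 2 = ksq ξ * ∑ j, ‖a j‖ ^ 2 := by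
  have h2pi : (2 * Real.pi * Complex.I : ℂ) ≠ 0 := by
    simp [Real.pi_ne_zero]
  have h0 : ∑ j, ((ξ j : ℝ) : ℂ) * a j = 0 := by
    refine (mul_eq_zero.1 (?_ : (2 * Real.pi * Complex.I : ℂ) * _ = 0)).resolve_left h2pi
    rw [Finset.mul_sum, ← h]
    exact Finset.sum_congr rfl fun j _ => by rw [dsym]; ring
  have h1 := lagrange_identity (fun j => ξ j) a h0
  have e : ∀ i j, ‖dsym i ξ * a j - dsym j ξ * a i‖ ^ 2 =
      (2 * Real.pi) ^ 2 * ‖((ξ i : ℝ) : ℂ) * a j - ((ξ j : ℝ) : ℂ) * a i‖ ^ 2 := by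
    intro i j
    have : dsym i ξ * a j - dsym j ξ * a i =
        (2 * Real.pi * Complex.I : ℂ) * (((ξ i : ℝ) : ℂ) * a j - ((ξ j : ℝ) : ℂ) * a i) := by
      rw [dsym, dsym]; ring
    rw [this, norm_mul, mul_pow]
    simp [abs_of_pos Real.pi_pos]
  rw [e, e, e, ← mul_add, ← mul_add, h1, ksq, EuclideanSpace.norm_sq_eq]
  simp only [Real.norm_eq_abs, sq_abs]
  ring

lemma fourier_curlFiltered {α : ℝ} {v : Field} {g : L2} {a b : Fin 3}
    (hg : toDist g = pd a (toDist (v b) - (α : ℂ) • Δ (toDist (v b)))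
      - pd b (toDist (v a) - (α : ℂ) • Δ (toDist (v a)))) :
    ∀ᵐ ξ, (𝓕 g : L2) ξ =
      wt α ξ * (dsym a ξ * (𝓕 (v b) : L2) ξ - dsym b ξ * (𝓕 (v a) : L2) ξ) := by
  have hw := wt_temperate α
  have hs : ∀ i, (fun ξ => (wt α ξ : ℂ) * dsym i ξ).HasTemperateGrowth :=
    fun i => hw.mul (dsym_temperate i)
  have h := (symbol_sum_eq_zero_iff (Finset.univ : Finset (Fin 3))
    (σ := ![fun _ => -1, fun ξ => (wt α ξ : ℂ) * dsym a ξ, fun ξ => (-1) * ((wt α ξ : ℂ) * dsym b ξ)])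
    (fun i => by
      fin_cases i
      · exact .const _
      · exact hs a
      · exact (Function.HasTemperateGrowth.const _).mul (hs b)) ![g, v b, v a]).1 (by
    rw [Fin.sum_univ_three]
    simp only [Matrix.cons_val_zero, Matrix.cons_val_one, Matrix.cons_val]
    have e : mult (fun _ => -1) (toDist g) = - toDist g := by simp [mult]
    rw [e, mult_smul (hs b), hg, filtered_eq_mult, filtered_eq_mult, pd_eq_mult, pd_eq_mult,
      mult_mult hw (dsym_temperate a), mult_mult hw (dsym_temperate b)]
    module)
  filter_upwards [h] with ξ hξ
  rw [Fin.sum_univ_three] at hξ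
  simp only [Matrix.cons_val_zero, Matrix.cons_val_one, Matrix.cons_val] at hξ
  linear_combination -hξ

lemma MemV.reg {v : Field} (hv : MemV v) (i : Fin 3) : Reg 1 (v i) :=
  reg_of_memSobolev (n := 1) (by simpa using hv.2.1 i)

lemma MemV.divFree {v : Field} (hv : MemV v) : DivFree v := (divFree_iff v).1 hv.2.2

/-- On solenoidal fields the curl multiplies the length of the transform by exactly 2π|ξ|, so the
curl controls the full gradient. -/
lemma MemV2.dens_eq {α : ℝ} {v : Field} (hv : MemV2 α v) :
    ∀ᵐ ξ, ∑ i, ‖(𝓕 (rep (curlFiltered α v i)) : L2) ξ‖ ^ 2 = ksq ξ * wt α ξ ^ 2 * dens v ξ := by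
  have hg : ∀ i, toDist (rep (curlFiltered α v i)) = curlFiltered α v i := by
    intro i
    obtain ⟨g, h⟩ := hv.2 i
    rw [← h, rep_toDist]
  filter_upwards [fourier_curlFiltered (a := 1) (b := 2) (hg 0),
    fourier_curlFiltered (a := 2) (b := 0) (hg 1), fourier_curlFiltered (a := 0) (b := 1) (hg 2),
    hv.1.divFree] with ξ h0 h1 h2 hd
  have h := curl_dsym_identity ξ (fun i => (𝓕 (v i) : L2) ξ) hd
  rw [Fin.sum_univ_three, h0, h1, h2]
  simp only [norm_mul, mul_pow, Complex.norm_real, Real.norm_eq_abs, sq_abs]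
  rw [dens]
  linear_combination (wt α ξ ^ 2) * h

/-- The constant in the embedding of `V₂` into `H³`. -/
def v2Const (α : ℝ) : ℝ := 32 * (1 + (α ^ 2)⁻¹)

lemma pow_six_le {α : ℝ} (hα : 0 < α) (ξ : Space) :
    (1 + ‖ξ‖) ^ 6 ≤ v2Const α * (1 + ksq ξ * wt α ξ ^ 2) := by
  have hx := norm_nonneg ξ
  -- By convexity (1 + x)⁶ ≤ 2⁵ (1 + x⁶).
  have h1 : (1 + ‖ξ‖) ^ 6 ≤ 32 * (1 + ‖ξ‖ ^ 6) := by
    have := add_pow_le (zero_le_one) hx 6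
    norm_num at this
    linarith
  have h2 : ‖ξ‖ ^ 2 ≤ ksq ξ := by
    have : (1:ℝ) ≤ (2 * Real.pi) ^ 2 := by nlinarith [Real.pi_gt_three]
    unfold ksq; nlinarith [sq_nonneg ‖ξ‖]
  have h3 : ‖ξ‖ ^ 6 ≤ (α ^ 2)⁻¹ * (ksq ξ * wt α ξ ^ 2) := by
    rw [← div_eq_inv_mul, le_div_iff₀ (by positivity)]
    calc ‖ξ‖ ^ 6 * α ^ 2 = ‖ξ‖ ^ 2 * (α * ‖ξ‖ ^ 2) ^ 2 := by ring
      _ ≤ ksq ξ * wt α ξ ^ 2 := by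
        refine mul_le_mul h2 (pow_le_pow_left₀ (by positivity) ?_ 2) (by positivity)
          (ksq_nonneg ξ)
        unfold wt
        nlinarith [ksq_nonneg ξ]
  have h4 : 0 ≤ ksq ξ * wt α ξ ^ 2 := mul_nonneg (ksq_nonneg ξ) (sq_nonneg _)
  have h5 : 0 ≤ (α ^ 2)⁻¹ := by positivity
  unfold v2Const
  nlinarith

/-- The symbol of the norm of V₂ contains 1 + |k|²(1 + α|k|²)², with k = 2πξ, which dominates (1 +
|ξ|)⁶. -/
lemma MemV2.reg {α : ℝ} (hα : 0 < α) {v : Field} (hv : MemV2 α v) :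
    (∀ i, Reg 3 (v i)) ∧ ∑ i, regSq 3 (v i) ≤ v2Const α * normV2 α v ^ 2 := by
  set g : Field := fun i => rep (curlFiltered α v i)
  have hi : Integrable fun ξ => v2Const α * (dens v ξ + dens g ξ) :=
    ((integrable_dens v).add (integrable_dens g)).const_mul _
  have hle : ∀ᵐ ξ, (1 + ‖ξ‖) ^ 6 * dens v ξ ≤ v2Const α * (dens v ξ + dens g ξ) := by
    filter_upwards [hv.dens_eq] with ξ h
    have h' : dens g ξ = ksq ξ * wt α ξ ^ 2 * dens v ξ := h
    rw [h']
    have := mul_le_mul_of_nonneg_right (pow_six_le hα ξ) (dens_nonneg v ξ)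
    linarith
  have hr : ∀ i, Reg 3 (v i) := by
    intro i
    refine Integrable.mono' hi ?_ ?_
    · have := Reg.aesm (v i); fun_prop
    · filter_upwards [hle] with ξ h
      rw [Real.norm_of_nonneg (by positivity)]
      refine le_trans ?_ h
      gcongr
      exact Finset.single_le_sum (f := fun i => ‖(𝓕 (v i) : L2) ξ‖ ^ 2)
          (fun i _ => sq_nonneg _) (Finset.mem_univ i)
  refine ⟨hr, ?_⟩
  have hsq : normV2 α v ^ 2 = normSqH1 α v + ∑ i, ‖g i‖ ^ 2 := by
    rw [normV2, Real.sq_sqrt]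
    rw [normSqH1_eq_energy hv.1.reg]
    have := energy_nonneg hα v
    positivity
  have hd : ∑ i, ‖v i‖ ^ 2 ≤ normSqH1 α v := by
    rw [normSqH1]
    exact le_add_of_nonneg_right (by positivity)
  have h0 : 0 ≤ v2Const α := by unfold v2Const; positivity
  calc ∑ i, regSq 3 (v i) = ∫ ξ, (1 + ‖ξ‖) ^ 6 * dens v ξ := by
        simp only [regSq, dens, Finset.mul_sum]
        rw [integral_finsetSum _ fun i _ => hr i]
    _ ≤ ∫ ξ, v2Const α * (dens v ξ + dens g ξ) :=
        integral_mono_of_nonneg (Eventually.of_forall fun ξ =>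
          mul_nonneg (by positivity) (dens_nonneg v ξ)) hi hle
    _ = v2Const α * (∑ i, ‖v i‖ ^ 2 + ∑ i, ‖g i‖ ^ 2) := by
        rw [integral_const_mul, integral_add (integrable_dens v) (integrable_dens g),
          integral_dens, integral_dens]
    _ ≤ _ := by rw [hsq]; gcongr

lemma regSq_mono {m n : ℕ} (h : m ≤ n) {f : L2} (hf : Reg n f) : regSq m f ≤ regSq n f := by
  refine integral_mono (hf.mono h) hf fun ξ => ?_
  simp only
  gcongr
  linarith [norm_nonneg ξ]

lemma normSq_le_regSq {n : ℕ} {f : L2} (hf : Reg n f) : ‖f‖ ^ 2 ≤ regSq n f := by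
  refine le_trans (le_of_eq ?_) (regSq_mono (Nat.zero_le n) hf)
  simp [regSq, integral_normSq_fourier]

/-- This makes the forcing bounded in L² on bounded time intervals. The passage to the limit in the
truncated energy equality needs such a bound, but not its size. -/
lemma norm_nonlin_le {α : ℝ} (hα : 0 < α) : ∃ c, 0 ≤ c ∧ ∀ u : Field, (∀ i, Reg 3 (u i)) →
    ∀ i, ‖nonlin α u i‖ ≤ c * ∑ i, regSq 3 (u i) := by
  refine ⟨3 * (embConst * (1 + 2 * α) * (2 * Real.pi) ^ 3), ?_, fun u hu i => ?_⟩
  · have := embConst_nonneg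
    positivity
  set S := ∑ i, regSq 3 (u i)
  have hS : ∀ i, regSq 3 (u i) ≤ S := fun i =>
    Finset.single_le_sum (f := fun i => regSq 3 (u i)) (fun i _ => regSq_nonneg _ _)
      (Finset.mem_univ i)
  have hS0 : 0 ≤ S := (regSq_nonneg _ _).trans (hS 0)
  have hw : ∀ i, Wiener 0 (u i) := fun i => (Reg.wiener (n := 0) ((hu i).mono (by norm_num))).1
  have hpi : (1:ℝ) ≤ 2 * Real.pi := by nlinarith [Real.pi_gt_three]
  have h1 : ∀ i, ∫ ξ, ‖(𝓕 (u i) : L2) ξ‖ ≤ embConst * Real.sqrt S := by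
    intro i
    have := (Reg.wiener (n := 0) ((hu i).mono (by norm_num))).2
    simp only [pow_zero, one_mul] at this
    refine this.trans ?_
    gcongr
    · exact embConst_nonneg
    · exact (regSq_mono (by norm_num) (hu i)).trans (hS i)
  have h2 : ∀ i j, ‖dL2 j (u i)‖ ≤ (2 * Real.pi) ^ 3 * Real.sqrt S := by
    intro i j
    have h := (Reg.dL2 (n := 2) (hu i) j)
    have h' := (normSq_le_regSq h.1).trans h.2
    rw [← Real.sqrt_sq (by positivity : 0 ≤ (2 * Real.pi) ^ 3), ← Real.sqrt_mul (by positivity)]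
    refine Real.le_sqrt_of_sq_le (h'.trans ?_)
    refine mul_le_mul ?_ (hS i) (regSq_nonneg _ _) (by positivity)
    rw [← pow_mul]
    exact pow_le_pow_right₀ hpi (by norm_num)
  have h3 : ∀ i j, ‖dLapL2 j (u i)‖ ≤ (2 * Real.pi) ^ 3 * Real.sqrt S := by
    intro i j
    have h := Reg.symbol (n := 0) (m := 3) (hu i) (norm_dLap_le j) (fourier_dLapL2 j (hu i))
    have h' := (normSq_le_regSq h.1).trans h.2
    rw [← Real.sqrt_sq (by positivity : 0 ≤ (2 * Real.pi) ^ 3), ← Real.sqrt_mul (by positivity)]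
    refine Real.le_sqrt_of_sq_le (h'.trans ?_)
    gcongr
    exact hS i
  have hp : ∀ (j : Fin 3) (f : L2), ‖f‖ ≤ (2 * Real.pi) ^ 3 * Real.sqrt S →
      ‖prodL2 (u j) f‖ ≤ embConst * (2 * Real.pi) ^ 3 * S := by
    intro j f hf
    refine (norm_prodL2_le (hw j) f).trans ?_
    calc _ ≤ (embConst * Real.sqrt S) * ((2 * Real.pi) ^ 3 * Real.sqrt S) :=
          mul_le_mul (h1 j) hf (norm_nonneg _)
            (mul_nonneg embConst_nonneg (Real.sqrt_nonneg _))
      _ = embConst * (2 * Real.pi) ^ 3 * (Real.sqrt S * Real.sqrt S) := by ring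
      _ = _ := by rw [Real.mul_self_sqrt hS0]
  have : ‖nonlin α u i‖ ≤ ∑ j : Fin 3, (embConst * (2 * Real.pi) ^ 3 * S
      + α * (embConst * (2 * Real.pi) ^ 3 * S) + α * (embConst * (2 * Real.pi) ^ 3 * S)) := by
    refine norm_sum_le_of_le _ fun j _ => ?_
    refine (norm_add_le _ _).trans (add_le_add ((norm_sub_le _ _).trans (add_le_add ?_ ?_)) ?_)
    · exact hp j _ (h2 i j)
    · rw [norm_smul, Complex.norm_real, Real.norm_of_nonneg hα.le]
      gcongr
      exact hp j _ (h3 i j)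
    · rw [norm_smul, Complex.norm_real, Real.norm_of_nonneg hα.le]
      gcongr
      exact hp j _ (h3 j i)
  refine this.trans_eq ?_
  simp
  ring

/-! ### The weak formulation on the Fourier side -/

lemma toDist_apply' (f : L2) (φ : 𝓢(Space, ℂ)) : toDist f φ = ∫ x, f x * φ x := by
  rw [toDist_apply]; simp_rw [mul_comm]

lemma dTest_eq_lineDeriv {φ : Space → ℝ} (hφ : ContDiff ℝ ∞ φ) {Φ : 𝓢(Space, ℂ)}
    (h : ∀ x, Φ x = φ x) (j : Fin 3) (x : Space) :
    (∂_{(EuclideanSpace.single j (1 : ℝ) : Space)} Φ) x = (dTest j φ x : ℂ) := by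
  have e : (Φ : Space → ℂ) = Complex.ofRealCLM ∘ φ := funext fun x => by simp [h]
  have hd : HasFDerivAt φ (fderiv ℝ φ x) x :=
    ((hφ.differentiable (by simp)) x).hasFDerivAt
  rw [SchwartzMap.lineDerivOp_apply_eq_fderiv, e,
    (Complex.ofRealCLM.hasFDerivAt.comp x hd).fderiv]
  rfl

lemma toDist_lineDeriv (T : 𝓢'(Space, ℂ)) (j : Fin 3) (φ : 𝓢(Space, ℂ)) :
    T (∂_{(EuclideanSpace.single j (1 : ℝ) : Space)} φ) = -pd j T φ := by
  rw [pd, TemperedDistribution.lineDerivOp_apply_apply, map_neg, neg_neg]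

lemma sum_toDist_dL2 {f : L2} (hf : Reg 1 f) (Φ : 𝓢(Space, ℂ)) :
    ∑ j, toDist (dL2 j f) (∂_{(EuclideanSpace.single j (1 : ℝ) : Space)} Φ) =
      mult (fun ξ => (ksq ξ : ℂ)) (toDist f) Φ := by
  have ht : ∀ j, (fun ξ => dsym j ξ * dsym j ξ).HasTemperateGrowth :=
    fun j => (dsym_temperate j).mul (dsym_temperate j)
  have e : ∀ j, toDist (dL2 j f) (∂_{(EuclideanSpace.single j (1 : ℝ) : Space)} Φ) =
      -∫ ξ, dsym j ξ * dsym j ξ * (𝓕 f : L2) ξ * 𝓕⁻ Φ ξ := by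
    intro j
    rw [toDist_lineDeriv, ← pd_toDist j hf, pd_eq_mult, pd_eq_mult,
      mult_mult (dsym_temperate j) (dsym_temperate j), mult_toDist_apply (ht j)]
  simp_rw [e]
  rw [Finset.sum_neg_distrib, ← integral_finsetSum _ fun j _ => integrable_symbol_mul (ht j) _ _,
    mult_toDist_apply ksq_temperate, ← integral_neg]
  congr 1
  ext ξ
  rw [← Finset.sum_mul, ← Finset.sum_mul, sum_dsym_sq]
  ring

lemma toDist_nonlin {α : ℝ} {u : Field} (hw : ∀ i, Wiener 0 (u i)) (i : Fin 3)
    (Φ : 𝓢(Space, ℂ)) :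
    toDist (nonlin α u i) Φ = ∑ j, ((∫ x, u j x * dL2 j (u i) x * Φ x)
      - α * (∫ x, u j x * dLapL2 j (u i) x * Φ x) + α * ∫ x, u j x * dLapL2 i (u j) x * Φ x) := by
  have hi : ∀ (j : Fin 3) (f : L2), Integrable fun x => u j x * f x * Φ x := by
    intro j f
    simp_rw [mul_assoc]
    exact (integrable_mul_schwartz f Φ).bdd_mul (c := ∫ ξ, ‖(𝓕 (u j) : L2) ξ‖)
      (Lp.aestronglyMeasurable (u j)) (ae_norm_le (hw j).integrable)
  have i4 : ∀ j, Integrable fun x => u j x * dL2 j (u i) x * Φ x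
      - α * (u j x * dLapL2 j (u i) x * Φ x) :=
    fun j => (hi j _).sub ((hi j _).const_mul _)
  have i5 : ∀ j, Integrable fun x => u j x * dL2 j (u i) x * Φ x
      - α * (u j x * dLapL2 j (u i) x * Φ x) + α * (u j x * dLapL2 i (u j) x * Φ x) :=
    fun j => (i4 j).add ((hi j _).const_mul _)
  have e : ∀ j, (∫ x, u j x * dL2 j (u i) x * Φ x)
      - α * (∫ x, u j x * dLapL2 j (u i) x * Φ x) + α * ∫ x, u j x * dLapL2 i (u j) x * Φ x =
      ∫ x, (u j x * dL2 j (u i) x * Φ x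
      - α * (u j x * dLapL2 j (u i) x * Φ x) + α * (u j x * dLapL2 i (u j) x * Φ x)) := by
    intro j
    rw [integral_add (i4 j) ((hi j _).const_mul _),
      integral_sub (hi j _) ((hi j _).const_mul _), integral_const_mul, integral_const_mul]
  simp_rw [e]
  rw [← integral_finsetSum _ fun j _ => i5 j, toDist_apply']
  refine integral_congr_ae ?_
  filter_upwards [nonlin_coe (α := α) hw i] with x hx
  rw [hx, Finset.sum_mul]
  exact Finset.sum_congr rfl fun j _ => by ring

lemma gradPair_eq {z : Field} (hz : ∀ i, Reg 1 (z i)) {φ : Fin 3 → Space → ℝ}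
    (hφ : ∀ i, ContDiff ℝ ∞ (φ i)) {Φ : Fin 3 → 𝓢(Space, ℂ)} (h : ∀ i x, Φ i x = φ i x) :
    gradPair z φ = ∑ i, mult (fun ξ => (ksq ξ : ℂ)) (toDist (z i)) (Φ i) := by
  unfold gradPair
  simp_rw [← sum_toDist_dL2 (hz _), toDist_apply', dTest_eq_lineDeriv (hφ _) (h _)]

/-- The weak form becomes the pairing of a vector distribution with the test field. The identity
holds for all smooth test fields with Schwartz representatives, and solenoidality plays no role in
it. -/
lemma weak_form_eq {α μ : ℝ} {u u' : Field} (hu : ∀ i, Reg 3 (u i)) (hu' : ∀ i, Reg 1 (u' i))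
    {φ : Fin 3 → Space → ℝ} (hφ : ∀ i, ContDiff ℝ ∞ (φ i)) {Φ : Fin 3 → 𝓢(Space, ℂ)}
    (h : ∀ i x, Φ i x = φ i x) :
    pair u' φ + α * gradPair u' φ + μ * gradPair u φ
        + trilinear (fun i x => u i x) (fun j i x => dL2 j (u i) x) (fun i x => (φ i x : ℂ))
        - α * trilinear (fun i x => u i x) (fun j i x => dLapL2 j (u i) x)
            (fun i x => (φ i x : ℂ))
        + α * trilinear (fun i x => (φ i x : ℂ)) (fun j i x => dLapL2 j (u i) x)
            (fun i x => u i x) =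
      ∑ i, (mult (fun ξ => (wt α ξ : ℂ)) (toDist (u' i)) (Φ i)
        + μ * mult (fun ξ => (ksq ξ : ℂ)) (toDist (u i)) (Φ i)
        + toDist (nonlin α u i) (Φ i)) := by
  have hu1 : ∀ i, Reg 1 (u i) := fun i => (hu i).mono (by norm_num)
  have hw : ∀ i, Wiener 0 (u i) := fun i => (Reg.wiener (n := 0) ((hu i).mono (by norm_num))).1
  have hwt : ∀ T Φ, mult (fun ξ => (wt α ξ : ℂ)) T Φ =
      T Φ + α * mult (fun ξ => (ksq ξ : ℂ)) T Φ := by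
    intro T Φ
    have e : (fun ξ => (wt α ξ : ℂ)) = fun ξ => (1 : ℂ) + (α : ℂ) * (ksq ξ : ℂ) := by
      ext ξ; simp [wt]
    have ht : (fun ξ => (α : ℂ) * (ksq ξ : ℂ)).HasTemperateGrowth :=
      (Function.HasTemperateGrowth.const _).mul ksq_temperate
    rw [e, mult_add (.const _) ht, mult_smul ksq_temperate, mult_one]
    rfl
  have e1 : pair u' φ = ∑ i, toDist (u' i) (Φ i) := by
    unfold pair
    simp_rw [toDist_apply', h]
  -- In this form the test field is the transporting field. Exchanging the indices makes it the i-th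
  -- component of a vector paired with φ.
  have e2 : trilinear (fun i x => (φ i x : ℂ)) (fun j i x => dLapL2 j (u i) x)
      (fun i x => u i x) = ∑ i, ∑ j, ∫ x, u j x * dLapL2 i (u j) x * Φ i x := by
    unfold trilinear
    rw [Finset.sum_comm]
    refine Finset.sum_congr rfl fun i _ => Finset.sum_congr rfl fun j _ => ?_
    congr 1
    ext x
    rw [h]
    ring
  rw [e1, e2, gradPair_eq hu' hφ h, gradPair_eq hu1 hφ h]
  unfold trilinear
  simp_rw [hwt, toDist_nonlin hw, ← h]
  simp only [Finset.sum_add_distrib, Finset.sum_sub_distrib, ← Finset.mul_sum]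
  ring

/-- The transform of the momentum balance, up to a gradient. -/
def balance (α μ : ℝ) (u' u G : Field) (i : Fin 3) (ξ : Space) : ℂ :=
  wt α ξ * (𝓕 (u' i) : L2) ξ + μ * ksq ξ * (𝓕 (u i) : L2) ξ + (𝓕 (G i) : L2) ξ

/-! ### Curls as test fields, and elimination of the pressure -/

lemma contDiff_dTest {ψ : Space → ℝ} (hψ : ContDiff ℝ ∞ ψ) (j : Fin 3) :
    ContDiff ℝ ∞ (dTest j ψ) := by
  unfold dTest
  exact (hψ.fderiv_right (m := ∞) (by simp)).clm_apply contDiff_const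

lemma hasCompactSupport_dTest {ψ : Space → ℝ} (hψ : HasCompactSupport ψ) (j : Fin 3) :
    HasCompactSupport (dTest j ψ) := by
  unfold dTest
  exact (hψ.fderiv (𝕜 := ℝ)).comp_left (g := fun L : Space →L[ℝ] ℝ =>
    L (EuclideanSpace.single j (1 : ℝ))) (by simp)

lemma dTest_comm {ψ : Space → ℝ} (hψ : ContDiff ℝ ∞ ψ) (a b : Fin 3) (x : Space) :
    dTest a (dTest b ψ) x = dTest b (dTest a ψ) x := by
  have hs : IsSymmSndFDerivAt ℝ ψ x := by
    refine ContDiffAt.isSymmSndFDerivAt (n := ∞) hψ.contDiffAt ?_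
    rw [minSmoothness_of_isRCLikeNormedField]
    exact WithTop.coe_le_coe.2 le_top
  have hd : DifferentiableAt ℝ (fderiv ℝ ψ) x :=
    ((hψ.fderiv_right (m := ∞) (by simp)).differentiable (by simp)) x
  have e : ∀ a b, dTest a (dTest b ψ) x = fderiv ℝ (fderiv ℝ ψ) x
      (EuclideanSpace.single a (1 : ℝ)) (EuclideanSpace.single b (1 : ℝ)) := by
    intro a b
    unfold dTest
    rw [fderiv_clm_apply hd (by fun_prop)]
    simp
  rw [e, e]
  exact hs _ _

/-- The solenoidal test field `curl (ψ e)`, for a coordinate vector `e`. -/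
def curlTest (a b : Fin 3) (ψ : Space → ℝ) (i : Fin 3) : Space → ℝ :=
  if i = a then dTest b ψ else if i = b then fun x => -dTest a ψ x else fun _ => 0

lemma isTestField_curlTest {a b : Fin 3} (hab : a ≠ b) {ψ : Space → ℝ} (hψ : ContDiff ℝ ∞ ψ)
    (hc : HasCompactSupport ψ) : IsTestField (curlTest a b ψ) where
  smooth i := by
    unfold curlTest
    split_ifs
    · exact contDiff_dTest hψ b
    · exact (contDiff_dTest hψ a).neg
    · exact contDiff_const
  compact i := by
    unfold curlTest
    split_ifs
    · exact hasCompactSupport_dTest hc b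
    · exact (hasCompactSupport_dTest hc a).neg
    · exact HasCompactSupport.zero
  divFree x := by
    have e : ∀ j, dTest j (curlTest a b ψ j) x = (if j = a then dTest a (dTest b ψ) x else 0)
        + (if j = b then -dTest b (dTest a ψ) x else 0) := by
      intro j
      unfold curlTest
      by_cases h1 : j = a
      · subst h1
        simp [hab]
      · by_cases h2 : j = b
        · subst h2
          simp only [h1, if_false, if_true, zero_add]
          rw [dTest, fderiv_fun_neg]
          rfl
        · simp [h1, h2, dTest]
    simp_rw [e, Finset.sum_add_distrib]
    simp [dTest_comm hψ a b]

/-- The test fields (∂_b ψ, -∂_a ψ) in the components a, b are solenoidal for every ψ. Testing with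
them says that the curl of the momentum balance vanishes, that is, its transform is parallel to ξ.
-/
lemma balance_parallel {α μ : ℝ} {u u' : Field} (hu : ∀ i, Reg 3 (u i)) (hu' : ∀ i, Reg 1 (u' i))
    (h : ∀ φ : Fin 3 → Space → ℝ, IsTestField φ →
      pair u' φ + α * gradPair u' φ + μ * gradPair u φ
        + trilinear (fun i x => u i x) (fun j i x => dL2 j (u i) x) (fun i x => (φ i x : ℂ))
        - α * trilinear (fun i x => u i x) (fun j i x => dLapL2 j (u i) x)
            (fun i x => (φ i x : ℂ))
        + α * trilinear (fun i x => (φ i x : ℂ)) (fun j i x => dLapL2 j (u i) x)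
            (fun i x => u i x) = 0) (a b : Fin 3) :
    ∀ᵐ ξ, dsym b ξ * balance α μ u' u (nonlin α u) a ξ =
      dsym a ξ * balance α μ u' u (nonlin α u) b ξ := by
  by_cases hab : a = b
  · subst hab
    exact Eventually.of_forall fun _ => rfl
  have hw := wt_temperate α
  have c1 : ∀ i, (fun ξ => (wt α ξ : ℂ) * dsym i ξ).HasTemperateGrowth :=
    fun i => hw.mul (dsym_temperate i)
  have c2 : ∀ i, (fun ξ => (ksq ξ : ℂ) * dsym i ξ).HasTemperateGrowth :=
    fun i => ksq_temperate.mul (dsym_temperate i)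
  have c3 : ∀ (c : ℂ) {σ : Space → ℂ}, σ.HasTemperateGrowth →
      (fun ξ => c * σ ξ).HasTemperateGrowth :=
    fun c _ hσ => (Function.HasTemperateGrowth.const _).mul hσ
  -- Six terms: the time derivative, the viscosity and the nonlinearity, in each of the components a
  -- and b.
  have key := symbol_sum_eq_zero_of_test (Finset.univ : Finset (Fin 6))
    (σ := ![fun ξ => (wt α ξ : ℂ) * dsym b ξ, fun ξ => μ * ((ksq ξ : ℂ) * dsym b ξ), dsym b,
      fun ξ => (-1) * ((wt α ξ : ℂ) * dsym a ξ), fun ξ => (-μ) * ((ksq ξ : ℂ) * dsym a ξ),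
      fun ξ => (-1) * dsym a ξ])
    (fun i => by
      fin_cases i
      · exact c1 b
      · exact c3 _ (c2 b)
      · exact dsym_temperate b
      · exact c3 _ (c1 a)
      · exact c3 _ (c2 a)
      · exact c3 _ (dsym_temperate a))
    ![u' a, u a, nonlin α u a, u' b, u b, nonlin α u b] (by
    intro ψ hψ hc φ hφ
    have h0 := h _ (isTestField_curlTest hab hψ hc)
    set Φ : Fin 3 → 𝓢(Space, ℂ) := fun i =>
      if i = a then ∂_{(EuclideanSpace.single b (1 : ℝ) : Space)} φ
      else if i = b then -∂_{(EuclideanSpace.single a (1 : ℝ) : Space)} φ else 0 with hΦ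
    rw [weak_form_eq (Φ := Φ) hu hu' (isTestField_curlTest hab hψ hc).smooth (by
      intro i x
      simp only [hΦ, curlTest]
      split_ifs
      · exact dTest_eq_lineDeriv hψ hφ b x
      · rw [neg_apply, dTest_eq_lineDeriv hψ hφ a x]
        simp
      · simp)] at h0
    have hsum : ∀ F : Fin 3 → ℂ, (∀ i, i ≠ a → i ≠ b → F i = 0) → ∑ i, F i = F a + F b := by
      intro F hF
      rw [← Finset.sum_pair hab]
      refine (Finset.sum_subset (Finset.subset_univ _) fun i _ hi => ?_).symm
      simp only [Finset.mem_insert, Finset.mem_singleton, not_or] at hi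
      exact hF i hi.1 hi.2
    rw [hsum _ (fun i h1 h2 => by simp [hΦ, h1, h2])] at h0
    have hΦa : Φ a = ∂_{(EuclideanSpace.single b (1 : ℝ) : Space)} φ := by simp [hΦ]
    have hΦb : Φ b = -∂_{(EuclideanSpace.single a (1 : ℝ) : Space)} φ := by
      simp [hΦ, Ne.symm hab]
    rw [hΦa, hΦb] at h0
    simp only [map_neg, toDist_lineDeriv, pd_eq_mult] at h0
    rw [mult_mult hw (dsym_temperate _), mult_mult ksq_temperate (dsym_temperate _),
      mult_mult hw (dsym_temperate _), mult_mult ksq_temperate (dsym_temperate _)] at h0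
    rw [Fin.sum_univ_six]
    simp only [Matrix.cons_val_zero, Matrix.cons_val_one, Matrix.cons_val]
    rw [mult_smul (c2 b), mult_smul (c1 a), mult_smul (c2 a), mult_smul (dsym_temperate a)]
    simp only [smul_apply, smul_eq_mul]
    linear_combination -h0)
  filter_upwards [key] with ξ hξ
  rw [Fin.sum_univ_six] at hξ
  simp only [Matrix.cons_val_zero, Matrix.cons_val_one, Matrix.cons_val] at hξ
  unfold balance
  linear_combination hξ

/-- The first hypothesis says that `W` is a multiple of ξ, the second that `a` is orthogonal to ξ.
-/
lemma sum_mul_conj_eq_zero {ξ : Space} (hξ : ξ ≠ 0) {W a : Fin 3 → ℂ}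
    (hW : ∀ i j, dsym j ξ * W i = dsym i ξ * W j) (ha : ∑ j, dsym j ξ * a j = 0) :
    ∑ i, W i * (starRingEnd ℂ) (a i) = 0 := by
  have hk : (ksq ξ : ℂ) ≠ 0 := by
    have : 0 < ‖ξ‖ := norm_pos_iff.2 hξ
    have : 0 < ksq ξ := by unfold ksq; have := Real.pi_pos; positivity
    exact_mod_cast this.ne'
  have h1 : ∀ i, -(ksq ξ : ℂ) * W i = dsym i ξ * ∑ j, dsym j ξ * W j := by
    intro i
    rw [← sum_dsym_sq, Finset.sum_mul, Finset.mul_sum]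
    refine Finset.sum_congr rfl fun j _ => ?_
    rw [mul_assoc, hW]
    ring
  have h2 : ∑ j, dsym j ξ * (starRingEnd ℂ) (a j) = 0 := by
    have := congrArg (starRingEnd ℂ) ha
    simp only [map_sum, map_mul, conj_dsym, map_zero, neg_mul, Finset.sum_neg_distrib,
      neg_eq_zero] at this
    exact this
  refine (mul_eq_zero.1 (?_ : -(ksq ξ : ℂ) * _ = 0)).resolve_left (neg_ne_zero.2 hk)
  rw [Finset.mul_sum]
  simp_rw [← mul_assoc, h1]
  calc _ = (∑ j, dsym j ξ * W j) * ∑ i, dsym i ξ * (starRingEnd ℂ) (a i) := by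
        rw [Finset.mul_sum]
        exact Finset.sum_congr rfl fun i _ => by ring
    _ = 0 := by rw [h2, mul_zero]

lemma ae_ne_zero : ∀ᵐ ξ : Space, ξ ≠ 0 := by
  simp [ae_iff]

/-- The momentum balance is orthogonal to solenoidal fields. -/
theorem balance_orthogonal {α μ : ℝ} {u u' : Field} (hu : ∀ i, Reg 3 (u i))
    (hu' : ∀ i, Reg 1 (u' i))
    (h : ∀ φ : Fin 3 → Space → ℝ, IsTestField φ →
      pair u' φ + α * gradPair u' φ + μ * gradPair u φ
        + trilinear (fun i x => u i x) (fun j i x => dL2 j (u i) x) (fun i x => (φ i x : ℂ))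
        - α * trilinear (fun i x => u i x) (fun j i x => dLapL2 j (u i) x)
            (fun i x => (φ i x : ℂ))
        + α * trilinear (fun i x => (φ i x : ℂ)) (fun j i x => dLapL2 j (u i) x)
            (fun i x => u i x) = 0) {z : Field} (hz : DivFree z) :
    ∀ᵐ ξ, ∑ i, balance α μ u' u (nonlin α u) i ξ * (starRingEnd ℂ) ((𝓕 (z i) : L2) ξ) = 0 := by
  have hp : ∀ᵐ ξ, ∀ a b, dsym b ξ * balance α μ u' u (nonlin α u) a ξ =
      dsym a ξ * balance α μ u' u (nonlin α u) b ξ :=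
    ae_all_iff.2 fun a => ae_all_iff.2 fun b => balance_parallel hu hu' h a b
  filter_upwards [hp, hz, ae_ne_zero] with ξ h1 h2 h3
  exact sum_mul_conj_eq_zero h3 h1 h2

lemma balance_linear {α μ : ℝ} {v v' : Field}
    (h : ∀ i, toDist (v' i) - (α : ℂ) • Δ (toDist (v' i)) - (μ : ℂ) • Δ (toDist (v i)) = 0)
    (i : Fin 3) : ∀ᵐ ξ, wt α ξ * (𝓕 (v' i) : L2) ξ + μ * ksq ξ * (𝓕 (v i) : L2) ξ = 0 := by
  have ht : (fun ξ => (μ : ℂ) * (ksq ξ : ℂ)).HasTemperateGrowth :=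
    (Function.HasTemperateGrowth.const _).mul ksq_temperate
  have e : ∀ T : 𝓢'(Space, ℂ), mult (fun ξ => (ksq ξ : ℂ)) T = -Δ T := by
    intro T
    rw [lap_eq_mult]
    have : (fun ξ => (ksq ξ : ℂ)) = fun ξ => (-1 : ℂ) * (-(ksq ξ : ℂ)) := by ext; simp
    rw [this, mult_smul neg_ksq_temperate]
    module
  have := (symbol_sum_eq_zero_iff (Finset.univ : Finset (Fin 2))
    (σ := ![fun ξ => (wt α ξ : ℂ), fun ξ => (μ : ℂ) * (ksq ξ : ℂ)])
    (fun i => by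
      fin_cases i
      · exact wt_temperate α
      · exact ht) ![v' i, v i]).1 (by
    rw [Fin.sum_univ_two]
    simp only [Matrix.cons_val_zero, Matrix.cons_val_one]
    rw [mult_smul ksq_temperate, ← filtered_eq_mult, e, ← h i]
    module)
  filter_upwards [this] with ξ hξ
  rw [Fin.sum_univ_two] at hξ
  simpa only [Matrix.cons_val_zero, Matrix.cons_val_one] using hξ

/-! ### Indefinite integrals in time -/

/-- On `[0, ∞)` the function `f` is an indefinite integral of `Y`. -/
def IsPrim (f Y : ℝ → ℝ) : Prop :=
  ∀ t ≥ 0, IntervalIntegrable Y volume 0 t ∧ f t = f 0 + ∫ s in (0 : ℝ)..t, Y s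

lemma IsPrim.congr {f Y Y' : ℝ → ℝ} (h : IsPrim f Y)
    (hY : ∀ᵐ s ∂(volume.restrict (Ioi (0 : ℝ))), Y s = Y' s) : IsPrim f Y' := by
  intro t ht
  have h' : ∀ᵐ s ∂(volume.restrict (Ioc 0 t)), Y s = Y' s :=
    ae_restrict_of_ae_restrict_of_subset (fun s hs => hs.1) hY
  refine ⟨(h t ht).1.congr_ae (by rwa [uIoc_of_le ht]), ?_⟩
  rw [(h t ht).2, intervalIntegral.integral_of_le ht, intervalIntegral.integral_of_le ht,
    integral_congr_ae h']

lemma IsPrim.sum {ι : Type*} (s : Finset ι) {f Y : ι → ℝ → ℝ} (h : ∀ i ∈ s, IsPrim (f i) (Y i)) :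
    IsPrim (fun t => ∑ i ∈ s, f i t) (fun t => ∑ i ∈ s, Y i t) := by
  intro t ht
  have h1 : ∀ i ∈ s, IntervalIntegrable (Y i) volume 0 t := fun i hi => (h i hi t ht).1
  refine ⟨?_, ?_⟩
  · have := IntervalIntegrable.sum s h1
    refine this.congr_ae (Eventually.of_forall fun x => ?_)
    simp
  · rw [intervalIntegral.integral_finsetSum h1, ← Finset.sum_add_distrib]
    exact Finset.sum_congr rfl fun i hi => (h i hi t ht).2

/-- A bounded derivative makes U Lipschitz, so ‖U‖² is absolutely continuous and is the integral of
its derivative. That derivative is computed at almost every time by Lebesgue differentiation of the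
Bochner integral. -/
lemma normSq_chain {T M : ℝ} (hT : 0 ≤ T) {U U' : ℝ → L2}
    (hi : IntervalIntegrable U' volume 0 T)
    (hU : ∀ t ∈ Icc 0 T, U t = U 0 + ∫ s in (0 : ℝ)..t, U' s)
    (hM : ∀ᵐ s, s ∈ Ioc 0 T → ‖U' s‖ ≤ M) :
    IntervalIntegrable (fun s => 2 * (inner ℂ (U s) (U' s)).re) volume 0 T ∧
      ‖U T‖ ^ 2 = ‖U 0‖ ^ 2 + ∫ s in (0 : ℝ)..T, 2 * (inner ℂ (U s) (U' s)).re := by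
  set M' := max M 0
  have hM0 : 0 ≤ M' := le_max_right _ _
  have hM' : ∀ᵐ s, s ∈ Ioc 0 T → ‖U' s‖ ≤ M' := by
    filter_upwards [hM] with s h hs using (h hs).trans (le_max_left _ _)
  have hsub : ∀ t ∈ Icc 0 T, IntervalIntegrable U' volume 0 t := fun t ht =>
    hi.mono_set (by rw [uIcc_of_le ht.1, uIcc_of_le hT]; exact Icc_subset_Icc_right ht.2)
  have hlip : ∀ s ∈ Icc 0 T, ∀ t ∈ Icc 0 T, ‖U t - U s‖ ≤ M' * |t - s| := by
    intro s hs t ht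
    rw [hU t ht, hU s hs, add_sub_add_left_eq_sub,
      intervalIntegral.integral_interval_sub_left (hsub t ht) (hsub s hs)]
    refine intervalIntegral.norm_integral_le_of_norm_le_const_ae ?_
    filter_upwards [hM'] with x hx hx'
    refine hx ⟨?_, ?_⟩
    · exact (le_min hs.1 ht.1).trans_lt hx'.1
    · exact hx'.2.trans (max_le hs.2 ht.2)
  have hbd : ∀ t ∈ Icc 0 T, ‖U t‖ ≤ ‖U 0‖ + M' * T := by
    intro t ht
    have h1 := hlip 0 ⟨le_rfl, hT⟩ t ht
    have h2 := norm_le_norm_add_norm_sub' (U t) (U 0)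
    rw [sub_zero, abs_of_nonneg ht.1] at h1
    nlinarith [ht.2]
  set B := ‖U 0‖ + M' * T
  have hB : 0 ≤ B := by positivity
  have hac : AbsolutelyContinuousOnInterval (fun t => ‖U t‖ ^ 2) 0 T := by
    refine LipschitzOnWith.absolutelyContinuousOnInterval (K := (2 * B * M').toNNReal) ?_
    rw [lipschitzOnWith_iff_dist_le_mul, uIcc_of_le hT]
    intro s hs t ht
    rw [Real.dist_eq, Real.dist_eq, sq_sub_sq, abs_mul]
    have h1 := (abs_norm_sub_norm_le (U s) (U t)).trans (hlip t ht s hs)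
    have h2 : |‖U s‖ + ‖U t‖| ≤ 2 * B := by
      rw [abs_of_nonneg (by positivity)]
      linarith [hbd s hs, hbd t ht]
    calc _ ≤ (2 * B) * (M' * |s - t|) := mul_le_mul h2 h1 (abs_nonneg _) (by positivity)
      _ = _ := by rw [Real.coe_toNNReal _ (by positivity)]; ring
  have hd : ∀ᵐ s, s ∈ Ioc 0 T → deriv (fun t => ‖U t‖ ^ 2) s =
      2 * (inner ℂ (U s) (U' s)).re := by
    have hne : ∀ᵐ s : ℝ, s ≠ T := by simp [ae_iff]
    filter_upwards [hi.ae_hasDerivAt_integral, hne] with s hs hsT hmem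
    have h1 := hs (by rw [uIcc_of_le hT]; exact ⟨hmem.1.le, hmem.2⟩) 0 left_mem_uIcc
    have h2 : HasDerivAt U (U' s) s := by
      refine (h1.const_add (U 0)).congr_of_eventuallyEq ?_
      filter_upwards [Ioo_mem_nhds hmem.1 (lt_of_le_of_ne hmem.2 hsT)] with t ht
      exact hU t ⟨ht.1.le, ht.2.le⟩
    have h3 := h2.inner ℂ h2
    have h4 : HasDerivAt (fun t => (inner ℂ (U t) (U t)).re)
        (inner ℂ (U s) (U' s) + inner ℂ (U' s) (U s)).re s :=
      Complex.reCLM.hasFDerivAt.comp_hasDerivAt s h3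
    have e : (fun t => (inner ℂ (U t) (U t)).re) = fun t => ‖U t‖ ^ 2 := by
      ext t; exact (norm_sq_eq_re_inner (𝕜 := ℂ) (U t)).symm
    rw [e] at h4
    rw [h4.deriv, Complex.add_re, two_mul]
    congr 1
    rw [← inner_conj_symm, Complex.conj_re]
  have hd' : ∀ᵐ s ∂(volume.restrict (uIoc 0 T)), deriv (fun t => ‖U t‖ ^ 2) s =
      2 * (inner ℂ (U s) (U' s)).re := by
    rw [uIoc_of_le hT, ae_restrict_iff' measurableSet_Ioc]
    exact hd
  refine ⟨hac.intervalIntegrable_deriv.congr_ae hd', ?_⟩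
  have h5 := hac.integral_deriv_eq_sub
  rw [intervalIntegral.integral_congr_ae_restrict hd'] at h5
  rw [h5]
  ring

/-! ### Evolution of weighted spectral energies -/

/-- The real part of the pointwise product of the transforms. -/
def fdot (f g : Field) (ξ : Space) : ℝ :=
  ∑ i, ((𝓕 (f i) : L2) ξ * (starRingEnd ℂ) ((𝓕 (g i) : L2) ξ)).re

lemma fdot_aesm (f g : Field) : AEStronglyMeasurable (fdot f g) := by
  unfold fdot
  have : ∀ i, AEStronglyMeasurable fun ξ =>
      ((𝓕 (f i) : L2) ξ * (starRingEnd ℂ) ((𝓕 (g i) : L2) ξ)).re :=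
    fun i => Complex.continuous_re.comp_aestronglyMeasurable
      ((Reg.aesm (f i)).mul (Complex.continuous_conj.comp_aestronglyMeasurable (Reg.aesm (g i))))
  exact Finset.aestronglyMeasurable_fun_sum _ fun i _ => this i

lemma abs_fdot_le (f g : Field) (ξ : Space) : |fdot f g ξ| ≤ dens f ξ + dens g ξ := by
  unfold fdot dens
  rw [← Finset.sum_add_distrib]
  refine (Finset.abs_sum_le_sum_abs _ _).trans (Finset.sum_le_sum fun i _ => ?_)
  refine (Complex.abs_re_le_norm _).trans ?_
  rw [norm_mul, RCLike.norm_conj]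
  nlinarith [sq_nonneg (‖(𝓕 (f i) : L2) ξ‖ - ‖(𝓕 (g i) : L2) ξ‖),
    sq_nonneg (‖(𝓕 (f i) : L2) ξ‖ + ‖(𝓕 (g i) : L2) ξ‖)]

lemma integrable_fdot (f g : Field) : Integrable (fdot f g) :=
  ((integrable_dens f).add (integrable_dens g)).mono' (fdot_aesm f g)
    (Eventually.of_forall fun ξ => abs_fdot_le f g ξ)

lemma integral_fdot (f g : Field) : ∫ ξ, fdot f g ξ = (pairing f g).re := by
  have hi : ∀ i, Integrable fun ξ => ((𝓕 (f i) : L2) ξ * (starRingEnd ℂ) ((𝓕 (g i) : L2) ξ)) :=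
    fun i => integrable_mul_conj _ _
  have e : ∀ a b : L2, ∫ x, a x * (starRingEnd ℂ) (b x) = inner ℂ b a := by
    intro a b
    rw [L2.inner_def]
    rfl
  unfold fdot pairing
  have hi' : ∀ i, Integrable fun ξ =>
      ((𝓕 (f i) : L2) ξ * (starRingEnd ℂ) ((𝓕 (g i) : L2) ξ)).re := fun i => (hi i).re
  rw [integral_finsetSum _ fun i _ => hi' i, Complex.re_sum]
  refine Finset.sum_congr rfl fun i _ => ?_
  rw [e (f i), ← Lp.inner_fourier_eq, ← e]
  exact integral_re (hi i)

lemma isTimeDeriv_apply {z z' : ℝ → Field} (hd : IsTimeDeriv z z') (Λ : L2 →L[ℂ] L2) (i : Fin 3)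
    {t : ℝ} (ht : 0 ≤ t) : IntervalIntegrable (fun s => Λ (z' s i)) volume 0 t ∧
      Λ (z t i) = Λ (z 0 i) + ∫ s in (0 : ℝ)..t, Λ (z' s i) := by
  have h1 : IntervalIntegrable z' volume 0 t := by
    rcases ht.eq_or_lt with rfl | h
    · exact IntervalIntegrable.refl
    · rw [intervalIntegrable_iff_integrableOn_Ioo_of_le ht]
      exact hd.2.1 t h
  let L : Field →L[ℂ] L2 := Λ ∘L (ContinuousLinearMap.proj i)
  have h2 : IntervalIntegrable (fun s => L (z' s)) volume 0 t :=
    ⟨L.integrable_comp h1.1, L.integrable_comp h1.2⟩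
  refine ⟨h2, ?_⟩
  have h3 := L.intervalIntegral_comp_comm h1
  have h4 := congrArg L (hd.2.2 t ht)
  rw [map_add, ← h3] at h4
  exact h4

/-- For a bounded weight the quantity is the squared norm of Λz, where Λ is the Fourier transform
followed by multiplication with √p. This Λ is a bounded operator, so the chain rule in L² applies.
-/
lemma weighted_energy {z z' : ℝ → Field} (hd : IsTimeDeriv z z')
    (hb : ∀ T > 0, ∃ M, ∀ᵐ s ∂(volume.restrict (Ioo 0 T)), ∀ i, ‖z' s i‖ ≤ M)
    {p : Space → ℝ} (hp : Measurable p) (h0 : ∀ ξ, 0 ≤ p ξ) {c : ℝ} (hc : ∀ ξ, p ξ ≤ c) :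
    IsPrim (fun t => ∫ ξ, p ξ * dens (z t) ξ) (fun s => 2 * ∫ ξ, p ξ * fdot (z' s) (z s) ξ) := by
  set θ : Space → ℂ := fun ξ => (Real.sqrt (p ξ) : ℂ)
  have hθ : MemLp θ ⊤ := by
    refine memLp_top_of_le (c := Real.sqrt c)
      (Complex.measurable_ofReal.comp hp.sqrt).aestronglyMeasurable fun ξ => ?_
    rw [Complex.norm_real, Real.norm_of_nonneg (Real.sqrt_nonneg _)]
    exact Real.sqrt_le_sqrt (hc ξ)
  set Λ : L2 →L[ℂ] L2 := (mulL θ hθ) ∘L (FourierTransform.fourierCLM ℂ L2)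
  have hΛ : ∀ f : L2, ∀ᵐ ξ, Λ f ξ = θ ξ * (𝓕 f : L2) ξ := fun f => mulL_coe hθ _
  have hsq : ∀ ξ, (θ ξ) * (starRingEnd ℂ) (θ ξ) = (p ξ : ℂ) := by
    intro ξ
    simp only [θ, Complex.conj_ofReal]
    rw [← Complex.ofReal_mul, Real.mul_self_sqrt (h0 ξ)]
  have hin : ∀ f g : L2, (inner ℂ (Λ g) (Λ f)).re =
      ∫ ξ, p ξ * ((𝓕 f : L2) ξ * (starRingEnd ℂ) ((𝓕 g : L2) ξ)).re := by
    intro f g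
    rw [L2.inner_def]
    have : (∫ ξ, inner ℂ (Λ g ξ) (Λ f ξ)) =
        ∫ ξ, (p ξ : ℂ) * ((𝓕 f : L2) ξ * (starRingEnd ℂ) ((𝓕 g : L2) ξ)) := by
      refine integral_congr_ae ?_
      filter_upwards [hΛ f, hΛ g] with ξ h1 h2
      rw [h1, h2, RCLike.inner_apply, map_mul, ← hsq]
      ring
    rw [this]
    have hi : Integrable fun ξ => (p ξ : ℂ) * ((𝓕 f : L2) ξ * (starRingEnd ℂ) ((𝓕 g : L2) ξ)) := by
      refine (integrable_mul_conj _ _).bdd_mul (c := c)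
        (Complex.measurable_ofReal.comp hp).aestronglyMeasurable (Eventually.of_forall fun ξ => ?_)
      simp only [Complex.norm_real, Real.norm_of_nonneg (h0 ξ)]
      exact hc ξ
    refine (integral_re hi).symm.trans ?_
    simp
  have hpi : ∀ f g : L2, Integrable fun ξ =>
      p ξ * ((𝓕 f : L2) ξ * (starRingEnd ℂ) ((𝓕 g : L2) ξ)).re := by
    intro f g
    have := (integrable_mul_conj (𝓕 f) (𝓕 g)).re
    refine this.bdd_mul (c := c) hp.aestronglyMeasurable (Eventually.of_forall fun ξ => ?_)
    rw [Real.norm_of_nonneg (h0 ξ)]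
    exact hc ξ
  have hn : ∀ f : L2, ‖Λ f‖ ^ 2 = ∫ ξ, p ξ * ‖(𝓕 f : L2) ξ‖ ^ 2 := by
    intro f
    have := norm_sq_eq_re_inner (𝕜 := ℂ) (Λ f)
    rw [this]
    refine (hin f f).trans ?_
    congr 1
    ext ξ
    rw [Complex.mul_conj, Complex.ofReal_re, Complex.normSq_eq_norm_sq]
  have key : ∀ i, IsPrim (fun t => ‖Λ (z t i)‖ ^ 2)
      (fun s => 2 * (inner ℂ (Λ (z s i)) (Λ (z' s i))).re) := by
    intro i T hT
    rcases hT.eq_or_lt with rfl | hT'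
    · exact ⟨IntervalIntegrable.refl, by simp⟩
    obtain ⟨M, hM⟩ := hb T hT'
    refine normSq_chain (M := ‖Λ‖ * M) hT (isTimeDeriv_apply hd Λ i hT).1
      (fun t ht => (isTimeDeriv_apply hd Λ i ht.1).2) ?_
    rw [Measure.restrict_congr_set (Ioo_ae_eq_Ioc (μ := volume)), ae_restrict_iff' measurableSet_Ioc] at hM
    filter_upwards [hM] with s hs hmem
    exact (Λ.le_opNorm _).trans (mul_le_mul_of_nonneg_left (hs hmem i) (norm_nonneg _))
  have hsum := IsPrim.sum Finset.univ fun i _ => key i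
  have e1 : (fun t => ∑ i, ‖Λ (z t i)‖ ^ 2) = fun t => ∫ ξ, p ξ * dens (z t) ξ := by
    ext t
    simp only [hn, dens, Finset.mul_sum]
    rw [integral_finsetSum _ fun i _ => ?_]
    have := hpi (z t i) (z t i)
    refine this.congr (Eventually.of_forall fun ξ => ?_)
    simp only [Complex.mul_conj, Complex.ofReal_re, Complex.normSq_eq_norm_sq]
  have e2 : (fun s => ∑ i, 2 * (inner ℂ (Λ (z s i)) (Λ (z' s i))).re) =
      fun s => 2 * ∫ ξ, p ξ * fdot (z' s) (z s) ξ := by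
    ext s
    simp only [hin, fdot, Finset.mul_sum]
    rw [integral_finsetSum _ fun i _ => hpi _ _, Finset.mul_sum]
  rwa [e1, e2] at hsum

/-- A curve of fields that satisfies the energy balance with forcing `G`. -/
structure Evolution (α μ : ℝ) (z z' G : ℝ → Field) : Prop where
  deriv : IsTimeDeriv z z'
  bounded_deriv : ∀ T > 0, ∃ M, ∀ᵐ s ∂(volume.restrict (Ioo 0 T)), ∀ i, ‖z' s i‖ ≤ M
  bounded : ∀ T > 0, ∃ M, ∀ᵐ s ∂(volume.restrict (Ioo 0 T)),
    (∀ i, Reg 1 (z s i)) ∧ energy α (z s) ≤ M ∧ ∫ ξ, dens (G s) ξ ≤ M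
  initial : ∀ i, Reg 1 (z 0 i)
  balance : ∀ᵐ s ∂(volume.restrict (Ioi (0 : ℝ))), ∀ᵐ ξ,
    ∑ i, balance α μ (z' s) (z s) (G s) i ξ * (starRingEnd ℂ) ((𝓕 (z s i) : L2) ξ) = 0

lemma fdot_of_balance {α μ : ℝ} {z' z G : Field} {ξ : Space}
    (h : ∑ i, balance α μ z' z G i ξ * (starRingEnd ℂ) ((𝓕 (z i) : L2) ξ) = 0) :
    wt α ξ * fdot z' z ξ = -(μ * (ksq ξ * dens z ξ)) - fdot G z ξ := by
  have h1 := congrArg Complex.re h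
  have e : ∀ i, (balance α μ z' z G i ξ * (starRingEnd ℂ) ((𝓕 (z i) : L2) ξ)).re =
      wt α ξ * ((𝓕 (z' i) : L2) ξ * (starRingEnd ℂ) ((𝓕 (z i) : L2) ξ)).re
      + μ * (ksq ξ * ‖(𝓕 (z i) : L2) ξ‖ ^ 2)
      + ((𝓕 (G i) : L2) ξ * (starRingEnd ℂ) ((𝓕 (z i) : L2) ξ)).re := by
    intro i
    have e1 : SecondGrade.balance α μ z' z G i ξ * (starRingEnd ℂ) ((𝓕 (z i) : L2) ξ) =
        (wt α ξ : ℂ) * ((𝓕 (z' i) : L2) ξ * (starRingEnd ℂ) ((𝓕 (z i) : L2) ξ))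
        + ((μ * (ksq ξ * ‖(𝓕 (z i) : L2) ξ‖ ^ 2) : ℝ) : ℂ)
        + (𝓕 (G i) : L2) ξ * (starRingEnd ℂ) ((𝓕 (z i) : L2) ξ) := by
      have := Complex.mul_conj ((𝓕 (z i) : L2) ξ)
      rw [Complex.normSq_eq_norm_sq] at this
      rw [SecondGrade.balance]
      push_cast at this ⊢
      linear_combination (μ * ksq ξ : ℂ) * this
    rw [e1, Complex.add_re, Complex.add_re, Complex.ofReal_re, Complex.re_ofReal_mul]
  rw [Complex.re_sum] at h1
  simp_rw [e] at h1
  rw [Finset.sum_add_distrib, Finset.sum_add_distrib, Complex.zero_re] at h1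
  unfold fdot dens
  simp only [Finset.mul_sum]
  linarith

/-- Evolution of the energy in the frequencies `|ξ| ≤ R`. -/
lemma Evolution.truncated {α μ : ℝ} (hα : 0 < α) {z z' G : ℝ → Field}
    (h : Evolution α μ z z' G) (R : ℝ) :
    IsPrim (fun t => ∫ ξ in Metric.closedBall (0 : Space) R, wt α ξ * dens (z t) ξ)
      (fun s => -(2 * μ) * (∫ ξ in Metric.closedBall (0 : Space) R, ksq ξ * dens (z s) ξ)
        - 2 * ∫ ξ in Metric.closedBall (0 : Space) R, fdot (G s) (z s) ξ) := by
  set S := Metric.closedBall (0 : Space) R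
  have hS : MeasurableSet S := Metric.isClosed_closedBall.measurableSet
  have hcomp : IsCompact S := isCompact_closedBall _ _
  obtain ⟨c, hc⟩ := hcomp.exists_bound_of_continuousOn (continuous_wt α).continuousOn
  obtain ⟨c', hc'⟩ := hcomp.exists_bound_of_continuousOn continuous_ksq.continuousOn
  have hmul : ∀ (f g : Space → ℝ) ξ, S.indicator f ξ * g ξ = S.indicator (fun ξ => f ξ * g ξ) ξ :=
    fun f g ξ => (Set.indicator_mul_left S f g).symm
  have h1 := weighted_energy h.deriv h.bounded_deriv (p := S.indicator (wt α))
    ((continuous_wt α).measurable.indicator hS)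
    (fun ξ => Set.indicator_nonneg (fun ξ _ => (wt_pos hα ξ).le) ξ) (c := max c 0) (fun ξ => by
      by_cases hξ : ξ ∈ S
      · rw [Set.indicator_of_mem hξ]
        exact ((le_abs_self _).trans (hc ξ hξ)).trans (le_max_left _ _)
      · rw [Set.indicator_of_notMem hξ]
        exact le_max_right _ _)
  simp_rw [hmul, integral_indicator hS] at h1
  refine h1.congr ?_
  filter_upwards [h.balance] with s hs
  have i1 : IntegrableOn (fun ξ => ksq ξ * dens (z s) ξ) S := by
    refine (integrable_dens (z s)).integrableOn.bdd_mul (c := c')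
      continuous_ksq.aestronglyMeasurable.restrict ?_
    rw [ae_restrict_iff' hS]
    exact Eventually.of_forall hc'
  have i2 : IntegrableOn (fdot (G s) (z s)) S := (integrable_fdot _ _).integrableOn
  have e : ∫ ξ in S, wt α ξ * fdot (z' s) (z s) ξ =
      ∫ ξ in S, (-(μ * (ksq ξ * dens (z s) ξ)) - fdot (G s) (z s) ξ) := by
    refine integral_congr_ae (ae_restrict_of_ae ?_)
    filter_upwards [hs] with ξ hξ using fdot_of_balance hξ
  have i3 : IntegrableOn (fun ξ => -(μ * (ksq ξ * dens (z s) ξ))) S := (i1.const_mul μ).neg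
  rw [e, integral_sub i3 i2, integral_neg, integral_const_mul]
  ring

lemma reg_one_of_integrable {α : ℝ} (hα : 0 < α) {z : Field}
    (h : Integrable fun ξ => wt α ξ * dens z ξ) (i : Fin 3) : Reg 1 (z i) := by
  refine (h.const_mul (2 * (1 + α⁻¹))).mono' ?_ (Eventually.of_forall fun ξ => ?_)
  · have := Reg.aesm (z i); fun_prop
  · rw [Real.norm_of_nonneg (by positivity), ← mul_assoc]
    refine mul_le_mul (sq_one_add_norm_le hα ξ) ?_ (by positivity) ?_
    · exact le_sum_fin (fun i => ‖(𝓕 (z i) : L2) ξ‖ ^ 2) (fun i => sq_nonneg ‖(𝓕 (z i) : L2) ξ‖) i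
    · have := wt_pos hα ξ
      positivity

/-- The dissipation rate. -/
def dissip (μ : ℝ) (z : Field) : ℝ := μ * ∫ ξ, ksq ξ * dens z ξ

/-- The energy equality. -/
theorem Evolution.energy {α μ : ℝ} (hα : 0 < α) (hμ : 0 < μ) {z z' G : ℝ → Field}
    (h : Evolution α μ z z' G) : (∀ t ≥ 0, ∀ i, Reg 1 (z t i)) ∧
      IsPrim (fun t => energy α (z t))
        (fun s => -2 * dissip μ (z s) - 2 * (pairing (G s) (z s)).re) := by
  -- The rates of change of the energies in |ξ| ≤ n. They are bounded uniformly in n on bounded time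
  -- intervals.
  set Y : ℕ → ℝ → ℝ := fun n s =>
    -(2 * μ) * (∫ ξ in Metric.closedBall (0 : Space) n, ksq ξ * dens (z s) ξ)
        - 2 * ∫ ξ in Metric.closedBall (0 : Space) n, fdot (G s) (z s) ξ with hY
  have hcov : AECover (volume : Measure Space) atTop
      (fun n : ℕ => Metric.closedBall (0 : Space) (n : ℝ)) :=
    aecover_closedBall tendsto_natCast_atTop_atTop
  have htr := fun n : ℕ => h.truncated hα n
  have hz0 := integrable_wt_dens hα h.initial
  have hloc : ∀ t > 0, ∃ B, 0 ≤ B ∧ ∀ᵐ s, s ∈ uIoc 0 t → (∀ i, Reg 1 (z s i)) ∧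
      ∀ n, ‖Y n s‖ ≤ B := by
    intro t ht
    obtain ⟨M, hM⟩ := h.bounded t ht
    refine ⟨2 * μ * (α⁻¹ * |M|) + 2 * (2 * |M|), by positivity, ?_⟩
    rw [Measure.restrict_congr_set (Ioo_ae_eq_Ioc (μ := volume)),
      ae_restrict_iff' measurableSet_Ioc] at hM
    filter_upwards [hM] with s hs hmem
    rw [uIoc_of_le ht.le] at hmem
    obtain ⟨h1, h2, h3⟩ := hs hmem
    refine ⟨h1, fun n => ?_⟩
    have k0 : ∀ ξ, 0 ≤ ksq ξ * dens (z s) ξ := fun ξ => mul_nonneg (ksq_nonneg ξ) (dens_nonneg _ ξ)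
    have k1 : ∫ ξ in Metric.closedBall (0 : Space) n, ksq ξ * dens (z s) ξ ≤ α⁻¹ * |M| := by
      calc _ ≤ ∫ ξ, ksq ξ * dens (z s) ξ :=
            setIntegral_le_integral (integrable_ksq_dens h1) (Eventually.of_forall k0)
        _ ≤ ∫ ξ, α⁻¹ * (wt α ξ * dens (z s) ξ) := by
            refine integral_mono (integrable_ksq_dens h1)
              ((integrable_wt_dens hα h1).const_mul _) fun ξ => ?_
            simp only
            rw [← mul_assoc]
            refine mul_le_mul_of_nonneg_right ?_ (dens_nonneg _ ξ)
            rw [← div_eq_inv_mul, le_div_iff₀ hα]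
            unfold wt; linarith
        _ ≤ _ := by
            rw [integral_const_mul]
            gcongr
            exact h2.trans (le_abs_self M)
    have k2 : 0 ≤ ∫ ξ in Metric.closedBall (0 : Space) n, ksq ξ * dens (z s) ξ :=
      integral_nonneg k0
    have k3 : ∫ ξ, dens (z s) ξ ≤ |M| := by
      refine le_trans (integral_mono (integrable_dens _) (integrable_wt_dens hα h1) fun ξ => ?_)
        (h2.trans (le_abs_self M))
      exact le_mul_of_one_le_left (dens_nonneg _ ξ) (one_le_wt hα ξ)
    have k4 : |∫ ξ in Metric.closedBall (0 : Space) n, fdot (G s) (z s) ξ| ≤ 2 * |M| := by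
      have i := (integrable_dens (G s)).add (integrable_dens (z s))
      calc _ ≤ ∫ ξ in Metric.closedBall (0 : Space) n, |fdot (G s) (z s) ξ| :=
            abs_integral_le_integral_abs
        _ ≤ ∫ ξ, |fdot (G s) (z s) ξ| := setIntegral_le_integral (integrable_fdot _ _).abs
            (Eventually.of_forall fun _ => abs_nonneg _)
        _ ≤ ∫ ξ, (dens (G s) ξ + dens (z s) ξ) :=
            integral_mono (integrable_fdot _ _).abs i fun ξ => abs_fdot_le _ _ ξ
        _ ≤ _ := by
            rw [integral_add (integrable_dens _) (integrable_dens _)]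
            linarith [h3.trans (le_abs_self M)]
    rw [Real.norm_eq_abs, hY]
    refine (abs_sub _ _).trans (add_le_add ?_ ?_)
    · rw [abs_mul, abs_neg, abs_of_pos (by positivity), abs_of_nonneg k2]
      gcongr
    · rw [abs_mul, abs_two]
      gcongr
  have hint : ∀ t ≥ 0, Integrable fun ξ => wt α ξ * dens (z t) ξ := by
    intro t ht
    rcases ht.eq_or_lt with rfl | ht'
    · exact hz0
    obtain ⟨B, hB, hb⟩ := hloc t ht'
    -- The truncated energies are bounded in n at this fixed t. Thus z(t) is in H¹ at every time,
    -- although the hypotheses give this only at almost every time.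
    refine hcov.integrable_of_integral_bounded_of_nonneg_ae
      (SecondGrade.energy α (z 0) + B * |t - 0|) (fun n => ?_)
      (Eventually.of_forall fun ξ => mul_nonneg (wt_pos hα ξ).le (dens_nonneg _ ξ))
      (Eventually.of_forall fun n => ?_)
    · obtain ⟨c, hc⟩ := (isCompact_closedBall (0 : Space) (n : ℝ)).exists_bound_of_continuousOn
        (continuous_wt α).continuousOn
      refine (integrable_dens (z t)).integrableOn.bdd_mul (c := c)
        (continuous_wt α).aestronglyMeasurable.restrict ?_
      rw [ae_restrict_iff' Metric.isClosed_closedBall.measurableSet]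
      exact Eventually.of_forall hc
    · have e := (htr n t ht).2
      simp only at e
      rw [e]
      refine add_le_add ?_ ?_
      · exact setIntegral_le_integral hz0
          (Eventually.of_forall fun ξ => mul_nonneg (wt_pos hα ξ).le (dens_nonneg _ ξ))
      · refine (le_abs_self _).trans ?_
        refine intervalIntegral.norm_integral_le_of_norm_le_const_ae (f := Y n) ?_
        filter_upwards [hb] with s hs hmem using (hs hmem).2 n
  have hreg : ∀ t ≥ 0, ∀ i, Reg 1 (z t i) := fun t ht i => reg_one_of_integrable hα (hint t ht) i
  refine ⟨hreg, fun t ht => ?_⟩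
  rcases ht.eq_or_lt with rfl | ht'
  · exact ⟨IntervalIntegrable.refl, by simp⟩
  obtain ⟨B, hB, hb⟩ := hloc t ht'
  set Ylim : ℝ → ℝ := fun s => -2 * dissip μ (z s) - 2 * (pairing (G s) (z s)).re with hYi
  have hlim : ∀ᵐ s, s ∈ uIoc 0 t → Tendsto (fun n => Y n s) atTop (𝓝 (Ylim s)) := by
    filter_upwards [hb] with s hs hmem
    have h1 := (hs hmem).1
    have t1 := hcov.integral_tendsto_of_countably_generated (integrable_ksq_dens h1)
    have t2 := hcov.integral_tendsto_of_countably_generated (integrable_fdot (G s) (z s))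
    have t3 := (t1.const_mul (-(2 * μ))).sub (t2.const_mul 2)
    rw [integral_fdot] at t3
    have e : Ylim s = -(2 * μ) * (∫ ξ, ksq ξ * dens (z s) ξ) - 2 * (pairing (G s) (z s)).re := by
      simp only [hYi, dissip]; ring
    rw [e]
    exact t3
  have hmeas : ∀ n, AEStronglyMeasurable (Y n) (volume.restrict (uIoc 0 t)) := fun n =>
    (intervalIntegrable_iff.1 (htr n t ht).1).1
  have hbn : ∀ n, ∀ᵐ s, s ∈ uIoc 0 t → ‖Y n s‖ ≤ B := by
    intro n
    filter_upwards [hb] with s hs hmem using (hs hmem).2 n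
  have hlim' : ∀ᵐ s ∂(volume.restrict (uIoc 0 t)), Tendsto (fun n => Y n s) atTop (𝓝 (Ylim s)) := by
    rwa [ae_restrict_iff' measurableSet_uIoc]
  have hYm : AEStronglyMeasurable Ylim (volume.restrict (uIoc 0 t)) :=
    aestronglyMeasurable_of_tendsto_ae atTop hmeas hlim'
  have hYint : IntervalIntegrable Ylim volume 0 t := by
    rw [intervalIntegrable_iff]
    refine Integrable.mono' (intervalIntegrable_iff.1 (intervalIntegrable_const (c := B))) hYm ?_
    rw [ae_restrict_iff' measurableSet_uIoc]
    filter_upwards [hb, hlim] with s hs hl hmem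
    exact le_of_tendsto (hl hmem).norm (Eventually.of_forall fun n => (hs hmem).2 n)
  refine ⟨hYint, ?_⟩
  have l1 := hcov.integral_tendsto_of_countably_generated (hint t ht)
  have l2 := hcov.integral_tendsto_of_countably_generated hz0
  -- Dominated convergence in time. With the convergence of the truncated energies at times 0 and t
  -- it gives the full energy equality.
  have l3 : Tendsto (fun n => ∫ s in (0 : ℝ)..t, Y n s) atTop (𝓝 (∫ s in (0 : ℝ)..t, Ylim s)) :=
    intervalIntegral.tendsto_integral_filter_of_dominated_convergence (fun _ => B)
      (Eventually.of_forall hmeas) (Eventually.of_forall hbn) (by simp) hlim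
  refine tendsto_nhds_unique (l1.congr fun n => (htr n t ht).2) (l2.add l3)

/-! ### The linear problem -/

/-- The symbol of the generator of the linear pseudo-parabolic evolution. -/
def msym (α μ : ℝ) (ξ : Space) : ℝ := μ * ksq ξ / wt α ξ

lemma msym_nonneg {α μ : ℝ} (hα : 0 < α) (hμ : 0 < μ) (ξ : Space) : 0 ≤ msym α μ ξ :=
  div_nonneg (mul_nonneg hμ.le (ksq_nonneg ξ)) (wt_pos hα ξ).le

lemma msym_le {α μ : ℝ} (hα : 0 < α) (hμ : 0 < μ) (ξ : Space) : msym α μ ξ ≤ μ / α := by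
  have := ksq_nonneg ξ
  rw [msym, div_le_div_iff₀ (wt_pos hα ξ) hα, wt]
  nlinarith

lemma continuous_msym {α : ℝ} (hα : 0 < α) (μ : ℝ) : Continuous (msym α μ) :=
  (continuous_const.mul continuous_ksq).div (continuous_wt α) fun ξ => (wt_pos hα ξ).ne'

lemma hasDerivAt_of_sq_bound {E : Type*} [NormedAddCommGroup E] [NormedSpace ℝ E] {f : ℝ → E}
    {f' : E} {x C δ : ℝ} (hδ : 0 < δ)
    (h : ∀ y, |y - x| ≤ δ → ‖f y - f x - (y - x) • f'‖ ≤ C * (y - x) ^ 2) : HasDerivAt f f' x := by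
  rw [hasDerivAt_iff_isLittleO]
  refine (Asymptotics.IsBigO.of_bound C ?_).trans_isLittleO
    (Asymptotics.isLittleO_pow_sub_sub x one_lt_two)
  filter_upwards [Metric.closedBall_mem_nhds x hδ] with y hy
  refine (h y (by simpa [Real.dist_eq] using hy)).trans_eq ?_
  simp

/-! ### Diagonal evolutions with a bounded symbol -/

section Exponential

variable {p : Space → ℝ} {c : ℝ}

lemma memLp_ofReal (hp : Continuous p) (h0 : ∀ ξ, 0 ≤ p ξ) (hc : ∀ ξ, p ξ ≤ c) :
    MemLp (fun ξ => (p ξ : ℂ)) ⊤ :=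
  memLp_top_of_le (c := c) (Complex.continuous_ofReal.comp hp).aestronglyMeasurable fun ξ => by
    rw [Complex.norm_real, Real.norm_of_nonneg (h0 ξ)]; exact hc ξ

lemma exp_neg_mul_le (h0 : ∀ ξ, 0 ≤ p ξ) (hc : ∀ ξ, p ξ ≤ c) (t : ℝ) (ξ : Space) :
    ‖((Real.exp (-(t * p ξ)) : ℝ) : ℂ)‖ ≤ Real.exp (|t| * c) := by
  rw [Complex.norm_real, Real.norm_of_nonneg (Real.exp_pos _).le, Real.exp_le_exp]
  calc -(t * p ξ) ≤ |t * p ξ| := neg_le_abs _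
    _ = |t| * p ξ := by rw [abs_mul, abs_of_nonneg (h0 ξ)]
    _ ≤ _ := by gcongr; exact hc ξ

lemma memLp_exp (hp : Continuous p) (h0 : ∀ ξ, 0 ≤ p ξ) (hc : ∀ ξ, p ξ ≤ c) (t : ℝ) :
    MemLp (fun ξ => ((Real.exp (-(t * p ξ)) : ℝ) : ℂ)) ⊤ :=
  memLp_top_of_le (by fun_prop) (exp_neg_mul_le h0 hc t)

/-- |eˣ - 1 - x| ≤ x² for |x| ≤ 1 gives a quadratic error, uniformly in ξ because the symbol is
bounded. The radius (1 + c)⁻¹ ensures |x| ≤ 1. -/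
lemma hasDerivAt_mulL_exp (hp : Continuous p) (h0 : ∀ ξ, 0 ≤ p ξ) (hc : ∀ ξ, p ξ ≤ c) (f : L2)
    (t : ℝ) : HasDerivAt (fun s => mulL _ (memLp_exp hp h0 hc s) f)
      (-mulL _ (memLp_ofReal hp h0 hc) (mulL _ (memLp_exp hp h0 hc t) f)) t := by
  have hc0 : 0 ≤ c := (h0 0).trans (hc 0)
  refine hasDerivAt_of_sq_bound (C := c ^ 2 * Real.exp (|t| * c) * ‖f‖) (δ := (1 + c)⁻¹)
    (by positivity) fun s hs => ?_
  refine (Lp.norm_le_mul_norm_of_ae_le_mul (c := c ^ 2 * Real.exp (|t| * c) * (s - t) ^ 2)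
    (g := f) ?_).trans_eq (by ring)
  set a := mulL _ (memLp_exp hp h0 hc s) f
  set b := mulL _ (memLp_exp hp h0 hc t) f
  filter_upwards [Lp.coeFn_sub (a - b) ((s - t) • -mulL _ (memLp_ofReal hp h0 hc) b),
    Lp.coeFn_sub a b, Lp.coeFn_smul (s - t) (-mulL _ (memLp_ofReal hp h0 hc) b),
    Lp.coeFn_neg (mulL _ (memLp_ofReal hp h0 hc) b), mulL_coe (memLp_ofReal hp h0 hc) b,
    mulL_coe (memLp_exp hp h0 hc s) f, mulL_coe (memLp_exp hp h0 hc t) f]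
    with ξ e1 e2 e3 e4 e5 e6 e7
  have key : (a - b - (s - t) • -mulL _ (memLp_ofReal hp h0 hc) b : L2) ξ =
      ((Real.exp (-(t * p ξ)) * (Real.exp (-((s - t) * p ξ)) - 1 - -((s - t) * p ξ)) : ℝ) : ℂ)
        * f ξ := by
    rw [e1, Pi.sub_apply, e2, Pi.sub_apply, e3, Pi.smul_apply, e4, Pi.neg_apply, e5, e6, e7]
    have : Real.exp (-(s * p ξ)) = Real.exp (-(t * p ξ)) * Real.exp (-((s - t) * p ξ)) := by
      rw [← Real.exp_add]; ring_nf
    rw [this, Complex.real_smul]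
    push_cast
    ring
  rw [key, norm_mul, Complex.norm_real, norm_mul, Real.norm_of_nonneg (Real.exp_pos _).le]
  have hx : |(-((s - t) * p ξ))| ≤ 1 := by
    rw [abs_neg, abs_mul, abs_of_nonneg (h0 ξ)]
    calc |s - t| * p ξ ≤ (1 + c)⁻¹ * (1 + c) := by
          gcongr
          · exact h0 ξ
          · linarith [hc ξ]
      _ = 1 := inv_mul_cancel₀ (by positivity)
  have h1 := Real.abs_exp_sub_one_sub_id_le hx
  have h2 := exp_neg_mul_le h0 hc t ξ
  rw [Complex.norm_real, Real.norm_of_nonneg (Real.exp_pos _).le] at h2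
  refine mul_le_mul_of_nonneg_right ?_ (norm_nonneg _)
  calc _ ≤ Real.exp (|t| * c) * ((-((s - t) * p ξ)) ^ 2) :=
        mul_le_mul h2 h1 (abs_nonneg _) (Real.exp_pos _).le
    _ = p ξ ^ 2 * Real.exp (|t| * c) * (s - t) ^ 2 := by ring
    _ ≤ _ := by
      gcongr
      · exact h0 ξ
      · exact hc ξ

/-- A bounded diagonal evolution is given by the exponential of its symbol. -/
lemma eq_exp_of_diagonal (hp : Continuous p) (h0 : ∀ ξ, 0 ≤ p ξ) (hc : ∀ ξ, p ξ ≤ c)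
    {U U' : ℝ → L2} (hi : ∀ t ≥ 0, IntervalIntegrable U' volume 0 t ∧
      U t = U 0 + ∫ s in (0 : ℝ)..t, U' s)
    (hb : ∀ T > 0, ∃ M, ∀ᵐ s, s ∈ Ioc 0 T → ‖U' s‖ ≤ M)
    (he : ∀ᵐ s, 0 < s → ∀ᵐ ξ, U' s ξ = -(p ξ * U s ξ)) {t : ℝ} (ht : 0 ≤ t) :
    ∀ᵐ ξ, U t ξ = ((Real.exp (-(t * p ξ)) : ℝ) : ℂ) * U 0 ξ := by
  set E : ℝ → L2 := fun s => mulL _ (memLp_exp hp h0 hc s) (U 0) with hE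
  set P := mulL _ (memLp_ofReal hp h0 hc) with hP
  have hE0 : E 0 = U 0 := by
    refine Lp.ext ?_
    filter_upwards [mulL_coe (memLp_exp hp h0 hc 0) (U 0)] with ξ h
    rw [hE]
    simp only
    rw [h]
    simp
  have hEd : ∀ s, HasDerivAt E (-P (E s)) s := hasDerivAt_mulL_exp hp h0 hc (U 0)
  have hEc : Continuous E := continuous_iff_continuousAt.2 fun s => (hEd s).continuousAt
  have hE'c : Continuous fun s => -P (E s) := (P.continuous.comp hEc).neg
  rcases ht.eq_or_lt with rfl | htp
  · simp
  obtain ⟨M, hM⟩ := hb t htp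
  obtain ⟨M', hM'⟩ := (isCompact_Icc (a := 0) (b := t)).exists_bound_of_continuousOn
    hE'c.continuousOn
  -- Uniqueness by an energy argument: the difference from the explicit evolution starts at 0, and
  -- its norm cannot grow because the symbol is nonnegative.
  have hch := normSq_chain (U := fun s => U s - E s) (U' := fun s => U' s - -P (E s))
    (M := M + M') ht ((hi t ht).1.sub (hE'c.intervalIntegrable _ _)) (fun s hs => by
      rw [intervalIntegral.integral_sub (hi s hs.1).1 (hE'c.intervalIntegrable _ _),
        intervalIntegral.integral_eq_sub_of_hasDerivAt (fun x _ => hEd x)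
          (hE'c.intervalIntegrable _ _)]
      nth_rewrite 1 [(hi s hs.1).2]
      abel) (by
      filter_upwards [hM] with s hs hmem
      exact (norm_sub_le _ _).trans (add_le_add (hs hmem) (hM' s ⟨hmem.1.le, hmem.2⟩)))
  have hneg : ∫ s in (0 : ℝ)..t, 2 * (inner ℂ (U s - E s) (U' s - -P (E s))).re ≤ 0 := by
    rw [intervalIntegral.integral_of_le ht]
    refine setIntegral_nonpos_of_ae_restrict ?_
    rw [EventuallyLE, ae_restrict_iff' measurableSet_Ioc]
    filter_upwards [he] with s hs hmem
    have h1 : (inner ℂ (U s - E s) (U' s - -P (E s)) : ℂ) =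
        ∫ ξ, ((-(p ξ * ‖(U s - E s : L2) ξ‖ ^ 2) : ℝ) : ℂ) := by
      rw [L2.inner_def]
      refine integral_congr_ae ?_
      filter_upwards [hs hmem.1, Lp.coeFn_sub (U s) (E s), Lp.coeFn_sub (U' s) (-P (E s)),
        Lp.coeFn_neg (P (E s)), mulL_coe (memLp_ofReal hp h0 hc) (E s)] with ξ e1 e2 e3 e4 e5
      have h2 := Complex.mul_conj ((U s - E s : L2) ξ)
      rw [Complex.normSq_eq_norm_sq] at h2
      have h3 : (U' s - -P (E s) : L2) ξ = -(p ξ * (U s - E s : L2) ξ) := by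
        rw [e3, Pi.sub_apply, e4, Pi.neg_apply, e5, e1, e2, Pi.sub_apply]
        ring
      rw [RCLike.inner_apply, h3]
      push_cast at h2 ⊢
      linear_combination (-(p ξ : ℂ)) * h2
    rw [h1, integral_complex_ofReal, Complex.ofReal_re]
    have : ∫ ξ, -(p ξ * ‖(U s - E s : L2) ξ‖ ^ 2) ≤ 0 :=
      integral_nonpos fun ξ => neg_nonpos.2 (mul_nonneg (h0 ξ) (sq_nonneg _))
    simp only [Pi.zero_apply]
    linarith
  have hz : U t - E t = 0 := by
    have h2 := hch.2
    simp only [hE0, sub_self, norm_zero] at h2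
    have : ‖U t - E t‖ ^ 2 ≤ 0 := by rw [h2]; linarith
    exact norm_eq_zero.1 (pow_eq_zero_iff (two_ne_zero)|>.1 (le_antisymm this (sq_nonneg _)))
  rw [sub_eq_zero.1 hz]
  exact mulL_coe (memLp_exp hp h0 hc t) (U 0)

end Exponential

lemma LocBoundedV.bound {α : ℝ} (hα : 0 < α) {z : ℝ → Field} (h : LocBoundedV α z) {T : ℝ}
    (hT : 0 < T) : ∃ M, ∀ᵐ s ∂(volume.restrict (Ioo 0 T)), MemV (z s) ∧ energy α (z s) ≤ M ^ 2 ∧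
      ∀ i, ‖z s i‖ ≤ M := by
  obtain ⟨M, hM⟩ := h T hT
  refine ⟨M, ?_⟩
  filter_upwards [hM] with s hs
  have hn : energy α (z s) ≤ M ^ 2 := by
    rw [← normSqH1_eq_energy hs.1.reg]
    have h0 : 0 ≤ normSqH1 α (z s) := by
      rw [normSqH1_eq_energy hs.1.reg]; exact energy_nonneg hα _
    exact (Real.sqrt_le_iff.1 hs.2).2
  have hM0 : 0 ≤ M := (Real.sqrt_nonneg _).trans hs.2
  exact ⟨hs.1, hn, fun i => le_of_sq_le_sq ((normSq_le_energy hα hs.1.reg i).trans hn) hM0⟩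

lemma ae_Ioi_of_ae_Ioo {P : ℝ → Prop} (h : ∀ T > 0, ∀ᵐ s ∂(volume.restrict (Ioo (0 : ℝ) T)), P s) :
    ∀ᵐ s ∂(volume.restrict (Ioi (0 : ℝ))), P s := by
  have h1 : ∀ n : ℕ, ∀ᵐ s ∂(volume.restrict (Ioo (0 : ℝ) (n + 1))), P s :=
    fun n => h (n + 1) (by positivity)
  simp_rw [ae_restrict_iff' measurableSet_Ioo] at h1
  rw [ae_restrict_iff' measurableSet_Ioi]
  filter_upwards [ae_all_iff.2 h1] with s hs hmem
  obtain ⟨n, hn⟩ := exists_nat_gt s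
  exact hs n ⟨hmem, hn.trans (by linarith)⟩

lemma LocBoundedV.ae_memV {α : ℝ} {z : ℝ → Field} (h : LocBoundedV α z) :
    ∀ᵐ s ∂(volume.restrict (Ioi (0 : ℝ))), MemV (z s) :=
  ae_Ioi_of_ae_Ioo fun T hT => by
    obtain ⟨M, hM⟩ := h T hT
    filter_upwards [hM] with s hs using hs.1

lemma LocBoundedV2.ae_memV2 {α : ℝ} {z : ℝ → Field} (h : LocBoundedV2 α z) :
    ∀ᵐ s ∂(volume.restrict (Ioi (0 : ℝ))), MemV2 α (z s) :=
  ae_Ioi_of_ae_Ioo fun T hT => by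
    obtain ⟨M, hM⟩ := h T hT
    filter_upwards [hM] with s hs using hs.1

/-- Division by 1 + α|k|², where k = 2πξ, makes the equation diagonal with the bounded symbol
`msym`, so no unbounded generator is involved. -/
lemma IsLinearSolution.fourier_eq {α μ : ℝ} (hα : 0 < α) (hμ : 0 < μ) {u₀ : Field}
    {v : ℝ → Field} (h : IsLinearSolution α μ u₀ v) {t : ℝ} (ht : 0 ≤ t) (i : Fin 3) :
    ∀ᵐ ξ, (𝓕 (v t i) : L2) ξ =
      ((Real.exp (-(t * msym α μ ξ)) : ℝ) : ℂ) * (𝓕 (u₀ i) : L2) ξ := by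
  obtain ⟨h0, hb, v', hd, hb', he⟩ := h
  rw [← h0]
  refine eq_exp_of_diagonal (c := μ / α) (continuous_msym hα μ) (msym_nonneg hα hμ)
    (msym_le hα hμ) (U := fun s => 𝓕 (v s i)) (U' := fun s => 𝓕 (v' s i))
    (fun s hs => isTimeDeriv_apply hd (FourierTransform.fourierCLM ℂ L2) i hs)
    (fun T hT => ?_) ?_ ht
  · obtain ⟨M, hM⟩ := hb'.bound hα hT
    refine ⟨M, ?_⟩
    rw [Measure.restrict_congr_set (Ioo_ae_eq_Ioc (μ := volume)),
      ae_restrict_iff' measurableSet_Ioc] at hM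
    filter_upwards [hM] with s hs hmem
    rw [Lp.norm_fourier_eq]
    exact (hs hmem).2.2 i
  · rw [ae_restrict_iff' measurableSet_Ioi] at he
    filter_upwards [he] with s hs hmem
    filter_upwards [balance_linear (hs hmem) i] with ξ hξ
    have hw : (wt α ξ : ℂ) ≠ 0 := by exact_mod_cast (wt_pos hα ξ).ne'
    rw [msym]
    push_cast
    field_simp
    linear_combination hξ

/-! ### Estimates for damped fields -/

/-- `g` arises from `f` by the damping `exp (-t p)` of its frequencies. -/
def Damped (p : Space → ℝ) (t : ℝ) (f g : L2) : Prop :=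
  ∀ᵐ ξ, (𝓕 g : L2) ξ = ((Real.exp (-(t * p ξ)) : ℝ) : ℂ) * (𝓕 f : L2) ξ

lemma Damped.norm_eq {p : Space → ℝ} {t : ℝ} {f g : L2} (h : Damped p t f g) :
    ∀ᵐ ξ, ‖(𝓕 g : L2) ξ‖ = Real.exp (-(t * p ξ)) * ‖(𝓕 f : L2) ξ‖ := by
  filter_upwards [h] with ξ hξ
  rw [hξ, norm_mul, Complex.norm_real, Real.norm_of_nonneg (Real.exp_pos _).le]

lemma Damped.norm_le {p : Space → ℝ} (h0 : ∀ ξ, 0 ≤ p ξ) {t : ℝ} (ht : 0 ≤ t) {f g : L2}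
    (h : Damped p t f g) : ∀ᵐ ξ, ‖(𝓕 g : L2) ξ‖ ≤ ‖(𝓕 f : L2) ξ‖ := by
  filter_upwards [h.norm_eq] with ξ hξ
  rw [hξ]
  refine mul_le_of_le_one_left (norm_nonneg _) (Real.exp_le_one_iff.2 ?_)
  have := mul_nonneg ht (h0 ξ)
  linarith

/-- The semigroup property. The second half of the time is spent on damping the derivatives, and the
first half keeps the decay of the energy available. -/
lemma Damped.half {p : Space → ℝ} {t : ℝ} {f g k : L2} (h : Damped p t f g)
    (h' : Damped p (t / 2) f k) : Damped p (t / 2) k g := by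
  filter_upwards [h, h'] with ξ e e'
  rw [e, e', ← mul_assoc, ← Complex.ofReal_mul, ← Real.exp_add]
  ring_nf

lemma Damped.reg {p : Space → ℝ} (h0 : ∀ ξ, 0 ≤ p ξ) {t : ℝ} (ht : 0 ≤ t) {f g : L2}
    (h : Damped p t f g) {n : ℕ} (hf : Reg n f) : Reg n g := by
  refine Integrable.mono' hf ?_ ?_
  · have := Reg.aesm g; fun_prop
  · filter_upwards [h.norm_le h0 ht] with ξ hξ
    rw [Real.norm_of_nonneg (by positivity)]
    gcongr

lemma dens_le_of_damped {p : Space → ℝ} (h0 : ∀ ξ, 0 ≤ p ξ) {t : ℝ} (ht : 0 ≤ t) {f g : Field}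
    (h : ∀ i, Damped p t (f i) (g i)) : ∀ᵐ ξ, dens g ξ ≤ dens f ξ := by
  filter_upwards [ae_all_iff.2 fun i => (h i).norm_le h0 ht] with ξ hξ
  unfold dens
  gcongr with i _
  exact hξ i

lemma DivFree.damped {p : Space → ℝ} {t : ℝ} {f g : Field} (hf : DivFree f)
    (h : ∀ i, Damped p t (f i) (g i)) : DivFree g := by
  filter_upwards [hf, ae_all_iff.2 h] with ξ h1 h2
  simp_rw [h2, mul_left_comm _ ((Real.exp _ : ℝ) : ℂ)]
  rw [← Finset.mul_sum, h1, mul_zero]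

/-- The least damping rate in the frequencies `|ξ| ≥ 1`. -/
def gapRate (α μ : ℝ) : ℝ := μ * (2 * Real.pi) ^ 2 / (1 + α * (2 * Real.pi) ^ 2)

lemma gapRate_pos {α μ : ℝ} (hα : 0 < α) (hμ : 0 < μ) : 0 < gapRate α μ := by
  have := Real.pi_pos
  unfold gapRate; positivity

/-- On the unit ball the denominator of `msym` is bounded, so low frequencies are damped as by a
heat flow. -/
lemma gapRate_mul_le {α μ : ℝ} (hα : 0 < α) (hμ : 0 < μ) {ξ : Space} (h : ‖ξ‖ ≤ 1) :
    gapRate α μ * ‖ξ‖ ^ 2 ≤ msym α μ ξ := by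
  have hp := Real.pi_pos
  have h1 : ‖ξ‖ ^ 2 ≤ 1 := pow_le_one₀ (norm_nonneg _) h
  rw [gapRate, msym, div_mul_eq_mul_div, wt, ksq, ← mul_assoc]
  gcongr
  exact mul_le_of_le_one_right (by positivity) h1

lemma gapRate_le {α μ : ℝ} (hα : 0 < α) (hμ : 0 < μ) {ξ : Space} (h : 1 ≤ ‖ξ‖) :
    gapRate α μ ≤ msym α μ ξ := by
  have hp := Real.pi_pos
  have h1 : (2 * Real.pi) ^ 2 ≤ ksq ξ := by
    rw [ksq]
    exact le_mul_of_one_le_right (by positivity) (one_le_pow₀ h)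
  rw [gapRate, msym, div_le_div_iff₀ (by positivity) (wt_pos hα ξ), wt]
  nlinarith

/-- The symbol is bounded below for |ξ| ≥ 1 but also bounded above, so there is exponential decay
and no gain of derivatives: the H³ norm of the datum appears on the right. -/
lemma Damped.highNorm_le {α μ : ℝ} (hα : 0 < α) (hμ : 0 < μ) {t : ℝ} (ht : 0 ≤ t) {f g : L2}
    (hf : Reg 3 f) (h : Damped (msym α μ) t f g) :
    highNorm g ≤ Real.exp (-(gapRate α μ * t)) * Real.sqrt (regSq 3 f) := by
  have h1 : ∫ ξ in lowBallᶜ, (1 + ‖ξ‖) ^ 6 * ‖(𝓕 g : L2) ξ‖ ^ 2 ≤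
      ∫ ξ in lowBallᶜ, Real.exp (-(gapRate α μ * t)) ^ 2 * ((1 + ‖ξ‖) ^ 6 * ‖(𝓕 f : L2) ξ‖ ^ 2) := by
    refine integral_mono_of_nonneg (Eventually.of_forall fun _ => by positivity)
      (Integrable.integrableOn (Integrable.const_mul hf _)) ?_
    rw [EventuallyLE, ae_restrict_iff' measurableSet_lowBall.compl]
    filter_upwards [h.norm_eq] with ξ hξ hmem
    have h2 : 1 ≤ ‖ξ‖ := by
      simp only [mem_compl_iff, Metric.mem_closedBall, dist_zero_right, not_le] at hmem
      exact hmem.le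
    have h3 : Real.exp (-(t * msym α μ ξ)) ≤ Real.exp (-(gapRate α μ * t)) := by
      rw [Real.exp_le_exp, mul_comm]
      gcongr
      exact gapRate_le hα hμ h2
    rw [hξ]
    calc (1 + ‖ξ‖) ^ 6 * (Real.exp (-(t * msym α μ ξ)) * ‖(𝓕 f : L2) ξ‖) ^ 2
        ≤ (1 + ‖ξ‖) ^ 6 * (Real.exp (-(gapRate α μ * t)) * ‖(𝓕 f : L2) ξ‖) ^ 2 := by gcongr
      _ = _ := by ring
  rw [highNorm, ← Real.sqrt_sq (Real.exp_pos (-(gapRate α μ * t))).le,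
    ← Real.sqrt_mul (sq_nonneg _)]
  refine Real.sqrt_le_sqrt (h1.trans ?_)
  rw [integral_const_mul]
  gcongr
  exact setIntegral_le_integral hf (Eventually.of_forall fun _ => by positivity)

lemma integrable_gaussian : Integrable fun ξ : Space => ‖ξ‖ ^ 2 * Real.exp (-‖ξ‖ ^ 2) := by
  refine Integrable.mono' (integrable_weight.const_mul 400) (by fun_prop)
    (Eventually.of_forall fun ξ => ?_)
  rw [Real.norm_of_nonneg (by positivity)]
  have hx := norm_nonneg ξ
  set x := ‖ξ‖
  have h1 : 1 + x ^ 2 + (x ^ 2) ^ 2 / 2 + (x ^ 2) ^ 3 / 6 ≤ Real.exp (x ^ 2) := by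
    have := Real.sum_le_exp_of_nonneg (sq_nonneg x) 4
    simp [Finset.sum_range_succ, Nat.factorial] at this
    linarith
  rw [Real.exp_neg, ← div_eq_mul_inv, ← inv_pow, ← pow_mul, inv_pow, ← div_eq_mul_inv,
    div_le_div_iff₀ (Real.exp_pos _) (by positivity)]
  have h2 : (1 + x) ^ 4 ≤ 8 * (1 + x ^ 4) := by
    have := add_pow_le (zero_le_one) hx 4
    norm_num at this
    linarith
  calc x ^ 2 * (1 + x) ^ (2 * 2) ≤ x ^ 2 * (8 * (1 + x ^ 4)) := by
        norm_num only; gcongr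
    _ ≤ 400 * (1 + x ^ 2 + (x ^ 2) ^ 2 / 2 + (x ^ 2) ^ 3 / 6) := by nlinarith [pow_nonneg hx 6, pow_nonneg hx 4, sq_nonneg x]
    _ ≤ _ := by gcongr

/-- The second moment of the Gaussian. -/
def gaussMoment : ℝ := ∫ ξ : Space, ‖ξ‖ ^ 2 * Real.exp (-‖ξ‖ ^ 2)

/-- The exponent 5/2 is half of 2 + 3, from the weight |ξ|² and the dimension. -/
lemma gaussian_scaling {a : ℝ} (ha : 0 < a) :
    Integrable (fun ξ : Space => ‖ξ‖ ^ 2 * Real.exp (-(a * ‖ξ‖ ^ 2))) ∧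
    ∫ ξ : Space, ‖ξ‖ ^ 2 * Real.exp (-(a * ‖ξ‖ ^ 2)) = a ^ (-(5 / 2) : ℝ) * gaussMoment := by
  have hs : 0 < Real.sqrt a := Real.sqrt_pos.2 ha
  have e : ∀ ξ : Space, ‖ξ‖ ^ 2 * Real.exp (-(a * ‖ξ‖ ^ 2)) =
      a⁻¹ * (‖Real.sqrt a • ξ‖ ^ 2 * Real.exp (-‖Real.sqrt a • ξ‖ ^ 2)) := by
    intro ξ
    rw [norm_smul, Real.norm_of_nonneg hs.le, mul_pow, Real.sq_sqrt ha.le]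
    field_simp
  simp_rw [e]
  refine ⟨((integrable_comp_smul_iff volume
    (fun ξ : Space => ‖ξ‖ ^ 2 * Real.exp (-‖ξ‖ ^ 2)) hs.ne').2 integrable_gaussian).const_mul _, ?_⟩
  rw [integral_const_mul, Measure.integral_comp_smul volume
    (fun ξ : Space => ‖ξ‖ ^ 2 * Real.exp (-‖ξ‖ ^ 2)), gaussMoment, smul_eq_mul, ← mul_assoc]
  congr 1
  rw [finrank_euclideanSpace_fin, abs_of_pos (by positivity), Real.sqrt_eq_rpow, ← Real.rpow_natCast,
    ← Real.rpow_mul ha.le, ← Real.rpow_neg ha.le, ← Real.rpow_neg_one, ← Real.rpow_add ha]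
  norm_num

/-- The constant in the decay of the low frequencies. -/
def lowDecayConst (α μ : ℝ) : ℝ :=
  Real.sqrt ((2 * Real.pi * (1 + 2 * Real.pi)) ^ 2 * Real.exp (gapRate α μ) *
    (gapRate α μ ^ (-(5 / 2) : ℝ) * gaussMoment))

/-- Cauchy-Schwarz: on the unit ball the weight is at most a multiple of |ξ|, and the square of |ξ|
times the damping is a Gaussian moment of order t^(-5/2). -/
lemma Damped.lowNorm_le {α μ : ℝ} (hα : 0 < α) (hμ : 0 < μ) {t : ℝ} (ht : 0 ≤ t) {f g : L2}
    (h : Damped (msym α μ) (t / 2) f g) :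
    lowNorm g ≤ lowDecayConst α μ * (1 + t) ^ (-(5 / 4) : ℝ) * ‖f‖ := by
  have hg := gapRate_pos hα hμ
  have hpi := Real.pi_pos
  set c := gapRate α μ
  set q : Space → ℝ := fun ξ =>
    (2 * Real.pi * ‖ξ‖ + (2 * Real.pi * ‖ξ‖) ^ 2) * Real.exp (-(t / 2 * msym α μ ξ))
  have hqc : Continuous q := by
    have := continuous_msym hα μ
    fun_prop
  set b := (2 * Real.pi * (1 + 2 * Real.pi)) ^ 2 * Real.exp c
  have hq : ∀ ξ ∈ lowBall, q ξ ^ 2 ≤ b * (‖ξ‖ ^ 2 * Real.exp (-((c * (1 + t)) * ‖ξ‖ ^ 2))) := by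
    intro ξ hξ
    have h1 : ‖ξ‖ ≤ 1 := by simpa using hξ
    have h2 := gapRate_mul_le hα hμ h1
    have h3 : 2 * Real.pi * ‖ξ‖ + (2 * Real.pi * ‖ξ‖) ^ 2 ≤
        2 * Real.pi * (1 + 2 * Real.pi) * ‖ξ‖ := by
      have : ‖ξ‖ ^ 2 ≤ ‖ξ‖ := by nlinarith [norm_nonneg ξ]
      nlinarith [mul_le_mul_of_nonneg_left this (sq_nonneg (2 * Real.pi))]
    -- The factor exp c replaces t by 1 + t, as |ξ| ≤ 1, and removes the singularity at t = 0.
    have h4 : Real.exp (-(t / 2 * msym α μ ξ)) ^ 2 ≤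
        Real.exp c * Real.exp (-((c * (1 + t)) * ‖ξ‖ ^ 2)) := by
      rw [← Real.exp_nat_mul, ← Real.exp_add, Real.exp_le_exp]
      have h5 : ‖ξ‖ ^ 2 ≤ 1 := pow_le_one₀ (norm_nonneg _) h1
      have h6 := mul_le_mul_of_nonneg_left h2 ht
      have h7 := mul_le_mul_of_nonneg_left h5 hg.le
      push_cast
      linarith
    calc q ξ ^ 2 = (2 * Real.pi * ‖ξ‖ + (2 * Real.pi * ‖ξ‖) ^ 2) ^ 2 *
          Real.exp (-(t / 2 * msym α μ ξ)) ^ 2 := mul_pow _ _ _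
      _ ≤ (2 * Real.pi * (1 + 2 * Real.pi) * ‖ξ‖) ^ 2 *
          (Real.exp c * Real.exp (-((c * (1 + t)) * ‖ξ‖ ^ 2))) := by gcongr
      _ = _ := by ring
  obtain ⟨i1, i2⟩ := gaussian_scaling (a := c * (1 + t)) (by positivity)
  have hqi : IntegrableOn (fun ξ => q ξ ^ 2) lowBall := by
    refine Integrable.mono' (i1.const_mul b).integrableOn (by fun_prop) ?_
    rw [ae_restrict_iff' measurableSet_lowBall]
    refine Eventually.of_forall fun ξ hξ => ?_
    rw [Real.norm_of_nonneg (sq_nonneg _)]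
    exact hq ξ hξ
  have h1 : ∫ ξ in lowBall, q ξ ^ 2 ≤ b * ((c * (1 + t)) ^ (-(5 / 2) : ℝ) * gaussMoment) := by
    rw [← i2, ← integral_const_mul]
    refine (setIntegral_mono_on hqi (i1.const_mul b).integrableOn measurableSet_lowBall hq).trans ?_
    exact setIntegral_le_integral (i1.const_mul b) (Eventually.of_forall fun ξ => by positivity)
  have h2 : lowNorm g = ∫ ξ in lowBall, q ξ * ‖(𝓕 f : L2) ξ‖ := by
    refine integral_congr_ae (ae_restrict_of_ae ?_)
    filter_upwards [h.norm_eq] with ξ hξ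
    rw [hξ]
    ring
  have hf := integrable_normSq (𝓕 f)
  have h3 : ∫ ξ in lowBall, ‖(𝓕 f : L2) ξ‖ ^ 2 ≤ ‖f‖ ^ 2 := by
    rw [← integral_normSq_fourier]
    exact setIntegral_le_integral hf (Eventually.of_forall fun ξ => sq_nonneg _)
  have hfm : AEStronglyMeasurable (fun ξ => ‖(𝓕 f : L2) ξ‖) (volume.restrict lowBall) :=
    (Reg.aesm f).norm.restrict
  have h4 := integral_mul_le_sqrt (ν := volume.restrict lowBall) (p := q)
    (q := fun ξ => ‖(𝓕 f : L2) ξ‖) hqc.aestronglyMeasurable hfm hqi hf.integrableOn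
  rw [h2]
  refine h4.trans ?_
  refine mul_le_mul ?_ (Real.sqrt_le_iff.2 ⟨norm_nonneg _, h3⟩) (Real.sqrt_nonneg _)
    (mul_nonneg (Real.sqrt_nonneg _) (by positivity))
  have e : b * ((c * (1 + t)) ^ (-(5 / 2) : ℝ) * gaussMoment) =
      b * (c ^ (-(5 / 2) : ℝ) * gaussMoment) * ((1 + t) ^ (-(5 / 4) : ℝ)) ^ 2 := by
    rw [Real.mul_rpow hg.le (by positivity), ← Real.rpow_natCast, ← Real.rpow_mul (by positivity)]
    norm_num
    ring
  rw [e] at h1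
  refine (Real.sqrt_le_sqrt h1).trans_eq ?_
  have hm : 0 ≤ gaussMoment := integral_nonneg fun ξ => by positivity
  rw [Real.sqrt_mul (by positivity), Real.sqrt_sq (by positivity)]
  rfl

lemma lowDecayConst_nonneg (α μ : ℝ) : 0 ≤ lowDecayConst α μ := Real.sqrt_nonneg _

lemma waveNorm_le_of_damped {α μ : ℝ} (hα : 0 < α) (hμ : 0 < μ) {t : ℝ} (ht : 0 ≤ t)
    {f g k : Field} (hf : ∀ i, Reg 3 (f i)) (hg : ∀ i, Damped (msym α μ) t (f i) (g i))
    (hk : ∀ i, Damped (msym α μ) (t / 2) (f i) (k i)) :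
    waveNorm g ≤ 3 * (lowDecayConst α μ * (1 + t) ^ (-(5 / 4) : ℝ) * Real.sqrt (energy α k)
      + Real.exp (-(gapRate α μ * t)) * Real.sqrt (∑ i, regSq 3 (f i))) := by
  have h : ∀ i ∈ Finset.univ, lowNorm (g i) + highNorm (g i) ≤
      lowDecayConst α μ * (1 + t) ^ (-(5 / 4) : ℝ) * Real.sqrt (energy α k)
      + Real.exp (-(gapRate α μ * t)) * Real.sqrt (∑ i, regSq 3 (f i)) := by
    intro i _
    refine add_le_add (((hg i).half (hk i)).lowNorm_le hα hμ ht |>.trans ?_)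
      (((hg i).highNorm_le hα hμ ht (hf i)).trans ?_)
    · have hk1 : ∀ i, Reg 1 (k i) := fun i =>
        ((hk i).reg (msym_nonneg hα hμ) (by positivity) (hf i)).mono (by norm_num)
      have := lowDecayConst_nonneg α μ
      gcongr
      exact Real.le_sqrt_of_sq_le (normSq_le_energy hα hk1 i)
    · gcongr
      exact le_sum_fin (fun i => regSq 3 (f i)) (fun i => regSq_nonneg _ _) i
  refine (Finset.sum_le_sum h).trans_eq ?_
  simp
  ring

/-! ### The evolutions of the two solutions and of their difference -/

lemma fourier_sub_ae (f g : L2) : ∀ᵐ ξ, (𝓕 (f - g) : L2) ξ = (𝓕 f : L2) ξ - (𝓕 g : L2) ξ := by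
  have e : 𝓕 (f - g) = 𝓕 f - 𝓕 g := (FourierTransform.fourierCLM ℂ L2).map_sub f g
  rw [e]
  exact Lp.coeFn_sub _ _

lemma dens_sub_le (f g : Field) : ∀ᵐ ξ, dens (f - g) ξ ≤ 2 * (dens f ξ + dens g ξ) := by
  filter_upwards [ae_all_iff.2 fun i => fourier_sub_ae (f i) (g i)] with ξ h
  unfold dens
  rw [← Finset.sum_add_distrib, Finset.mul_sum]
  refine Finset.sum_le_sum fun i _ => ?_
  rw [Pi.sub_apply, h i]
  have := norm_sub_le ((𝓕 (f i) : L2) ξ) ((𝓕 (g i) : L2) ξ)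
  nlinarith [norm_nonneg ((𝓕 (f i) : L2) ξ - (𝓕 (g i) : L2) ξ),
    sq_nonneg (‖(𝓕 (f i) : L2) ξ‖ - ‖(𝓕 (g i) : L2) ξ‖)]

lemma Reg.sub {n : ℕ} {f g : L2} (hf : Reg n f) (hg : Reg n g) : Reg n (f - g) := by
  refine Integrable.mono' ((Integrable.const_mul hf 2).add (Integrable.const_mul hg 2)) ?_ ?_
  · have := Reg.aesm (f - g); fun_prop
  · filter_upwards [fourier_sub_ae f g] with ξ h
    rw [h, Real.norm_of_nonneg (by positivity), Pi.add_apply]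
    have h1 := norm_sub_le ((𝓕 f : L2) ξ) ((𝓕 g : L2) ξ)
    have h2 : ‖(𝓕 f : L2) ξ - (𝓕 g : L2) ξ‖ ^ 2 ≤ 2 * ‖(𝓕 f : L2) ξ‖ ^ 2 + 2 * ‖(𝓕 g : L2) ξ‖ ^ 2 := by
      nlinarith [norm_nonneg ((𝓕 f : L2) ξ - (𝓕 g : L2) ξ),
        sq_nonneg (‖(𝓕 f : L2) ξ‖ - ‖(𝓕 g : L2) ξ‖)]
    have h3 : 0 ≤ (1 + ‖ξ‖) ^ (2 * n) := by positivity
    nlinarith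

lemma energy_sub_le {α : ℝ} (hα : 0 < α) {f g : Field} (hf : ∀ i, Reg 1 (f i))
    (hg : ∀ i, Reg 1 (g i)) : energy α (f - g) ≤ 2 * (energy α f + energy α g) := by
  have i1 := integrable_wt_dens hα hf
  have i2 := integrable_wt_dens hα hg
  unfold energy
  rw [← integral_add i1 i2, ← integral_const_mul]
  refine integral_mono_ae (integrable_wt_dens hα fun i => (hf i).sub (hg i))
    ((i1.add i2).const_mul 2) ?_
  filter_upwards [dens_sub_le f g] with ξ h
  have := mul_le_mul_of_nonneg_left h (wt_pos hα ξ).le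
  linarith

lemma DivFree.sub {f g : Field} (hf : DivFree f) (hg : DivFree g) : DivFree (f - g) := by
  filter_upwards [hf, hg, ae_all_iff.2 fun i => fourier_sub_ae (f i) (g i)] with ξ h1 h2 h
  have e : ∀ i, (𝓕 ((f - g) i) : L2) ξ = (𝓕 (f i) : L2) ξ - (𝓕 (g i) : L2) ξ := h
  simp_rw [e, mul_sub]
  rw [Finset.sum_sub_distrib, h1, h2, sub_zero]

lemma LocBoundedV2.bound {α : ℝ} (hα : 0 < α) {u : ℝ → Field} (h : LocBoundedV2 α u) {T : ℝ}
    (hT : 0 < T) : ∃ M, ∀ᵐ s ∂(volume.restrict (Ioo 0 T)), MemV2 α (u s) ∧ energy α (u s) ≤ M ∧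
      ∫ ξ, dens (nonlin α (u s)) ξ ≤ M := by
  obtain ⟨M, hM⟩ := h T hT
  obtain ⟨c, hc0, hc⟩ := norm_nonlin_le hα
  refine ⟨max (M ^ 2) (3 * (c * (v2Const α * M ^ 2)) ^ 2), ?_⟩
  filter_upwards [hM] with s hs
  have hr := hs.1.reg hα
  have hn : normV2 α (u s) ^ 2 ≤ M ^ 2 := pow_le_pow_left₀ (Real.sqrt_nonneg _) hs.2 2
  have h0 : 0 ≤ v2Const α := by unfold v2Const; positivity
  refine ⟨hs.1, le_max_of_le_left ?_, le_max_of_le_right ?_⟩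
  · refine le_trans ?_ hn
    have : 0 ≤ energy α (u s) := energy_nonneg hα _
    rw [normV2, normSqH1_eq_energy hs.1.1.reg, Real.sq_sqrt (by positivity)]
    exact le_add_of_nonneg_right (by positivity)
  · rw [integral_dens]
    have h1 : ∀ i ∈ Finset.univ, ‖nonlin α (u s) i‖ ^ 2 ≤ (c * (v2Const α * M ^ 2)) ^ 2 := by
      intro i _
      gcongr
      exact (hc _ hr.1 i).trans (by gcongr; exact hr.2.trans (by gcongr))
    refine (Finset.sum_le_sum h1).trans_eq ?_
    simp

lemma IsTimeDeriv.sub {u u' v v' : ℝ → Field} (hu : IsTimeDeriv u u') (hv : IsTimeDeriv v v') :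
    IsTimeDeriv (u - v) (u' - v') := by
  have hii : ∀ {z z' : ℝ → Field}, IsTimeDeriv z z' → ∀ t ≥ 0,
      IntervalIntegrable z' volume 0 t := by
    intro z z' hz t ht
    rcases ht.eq_or_lt with rfl | h
    · exact IntervalIntegrable.refl
    · rw [intervalIntegrable_iff_integrableOn_Ioo_of_le ht]
      exact hz.2.1 t h
  refine ⟨hu.1.sub hv.1, fun T hT => (hu.2.1 T hT).sub (hv.2.1 T hT), fun t ht => ?_⟩
  have := intervalIntegral.integral_sub (hii hu t ht) (hii hv t ht)
  simp only [Pi.sub_apply] at this ⊢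
  rw [this, hu.2.2 t ht, hv.2.2 t ht]
  abel

lemma energy_bound_of_locBoundedV {α : ℝ} (hα : 0 < α) {z' : ℝ → Field} (h : LocBoundedV α z') :
    ∀ T > 0, ∃ M, ∀ᵐ s ∂(volume.restrict (Ioo 0 T)), ∀ i, ‖z' s i‖ ≤ M := by
  intro T hT
  obtain ⟨M, hM⟩ := h.bound hα hT
  exact ⟨M, by filter_upwards [hM] with s hs using hs.2.2⟩

/-- The curve `u` solves the weak form of the equations with the time derivative `u'`. -/
def WeakForm (α μ : ℝ) (u u' : ℝ → Field) : Prop :=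
  ∀ᵐ t ∂(volume.restrict (Ioi (0 : ℝ))), ∀ φ : Fin 3 → Space → ℝ, IsTestField φ →
      pair (u' t) φ + α * gradPair (u' t) φ + μ * gradPair (u t) φ
        + trilinear (fun i x => u t i x) (fun j i x => dL2 j (u t i) x) (fun i x => (φ i x : ℂ))
        - α * trilinear (fun i x => u t i x) (fun j i x => dLapL2 j (u t i) x)
            (fun i x => (φ i x : ℂ))
        + α * trilinear (fun i x => (φ i x : ℂ)) (fun j i x => dLapL2 j (u t i) x)
            (fun i x => u t i x) = 0

section

variable {α μ : ℝ} {u u' v v' : ℝ → Field}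

lemma evolution_weak (hα : 0 < α) (hb : LocBoundedV2 α u) (hd : IsTimeDeriv u u') (hb' : LocBoundedV α u')
    (he : WeakForm α μ u u') (h0 : ∀ i, Reg 1 (u 0 i)) :
    Evolution α μ u u' fun t => nonlin α (u t) where
  deriv := hd
  bounded_deriv := energy_bound_of_locBoundedV hα hb'
  bounded T hT := by
    obtain ⟨M, hM⟩ := hb.bound hα hT
    exact ⟨M, by filter_upwards [hM] with s hs using ⟨hs.1.1.reg, hs.2⟩⟩
  initial := h0
  balance := by
    filter_upwards [he, hb.ae_memV2, hb'.ae_memV] with s h1 h2 h3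
    exact balance_orthogonal (h2.reg hα).1 h3.reg h1 h2.1.divFree

/-- The weak form of the linear problem. -/
def LinearForm (α μ : ℝ) (v v' : ℝ → Field) : Prop :=
  ∀ᵐ t ∂(volume.restrict (Ioi (0 : ℝ))), ∀ i,
      toDist (v' t i) - (α : ℂ) • Δ (toDist (v' t i)) - (μ : ℂ) • Δ (toDist (v t i)) = 0

lemma evolution_linear (hα : 0 < α) (hb : LocBoundedV α v) (hd : IsTimeDeriv v v') (hb' : LocBoundedV α v')
    (he : LinearForm α μ v v') (h0 : ∀ i, Reg 1 (v 0 i)) : Evolution α μ v v' fun _ => 0 where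
  deriv := hd
  bounded_deriv := energy_bound_of_locBoundedV hα hb'
  bounded T hT := by
    obtain ⟨M, hM⟩ := hb.bound hα hT
    refine ⟨M ^ 2, ?_⟩
    filter_upwards [hM] with s hs
    refine ⟨hs.1.reg, hs.2.1, ?_⟩
    rw [integral_dens]
    simpa using sq_nonneg M
  initial := h0
  balance := by
    filter_upwards [he] with s hs
    filter_upwards [ae_all_iff.2 fun i => balance_linear hs i,
      Lp.coeFn_zero ℂ 2 (volume : Measure Space)] with ξ h1 h2
    refine Finset.sum_eq_zero fun i _ => ?_
    have e : 𝓕 ((0 : Field) i) = (0 : L2) := FourierTransform.fourier_zero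
    rw [balance, e, h2, Pi.zero_apply, add_zero, h1 i, zero_mul]

lemma evolution_difference (hα : 0 < α) (hbu : LocBoundedV2 α u) (hdu : IsTimeDeriv u u')
    (hbu' : LocBoundedV α u') (heu : WeakForm α μ u u') (hbv : LocBoundedV α v)
    (hdv : IsTimeDeriv v v') (hbv' : LocBoundedV α v') (hev : LinearForm α μ v v')
    (h0 : u 0 = v 0) :
    Evolution α μ (u - v) (u' - v') fun t => nonlin α (u t) where
  deriv := hdu.sub hdv
  bounded_deriv T hT := by
    obtain ⟨M, hM⟩ := energy_bound_of_locBoundedV hα hbu' T hT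
    obtain ⟨M', hM'⟩ := energy_bound_of_locBoundedV hα hbv' T hT
    refine ⟨M + M', ?_⟩
    filter_upwards [hM, hM'] with s h1 h2 i
    exact (norm_sub_le _ _).trans (add_le_add (h1 i) (h2 i))
  bounded T hT := by
    obtain ⟨M, hM⟩ := hbu.bound hα hT
    obtain ⟨M', hM'⟩ := hbv.bound hα hT
    refine ⟨max (2 * (M + M' ^ 2)) M, ?_⟩
    filter_upwards [hM, hM'] with s h1 h2
    refine ⟨fun i => (h1.1.1.reg i).sub (h2.1.reg i), le_max_of_le_left ?_,
      le_max_of_le_right h1.2.2⟩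
    refine (energy_sub_le hα h1.1.1.reg h2.1.reg).trans ?_
    linarith [h1.2.1, h2.2.1]
  initial i := by
    simp only [Pi.sub_apply, h0, sub_self]
    have e : (𝓕 (0 : L2) : L2) = 0 := FourierTransform.fourier_zero
    refine (integrable_zero Space ℝ volume).congr ?_
    filter_upwards [Lp.coeFn_zero ℂ 2 (volume : Measure Space)] with ξ h
    rw [e, h]
    simp
  balance := by
    filter_upwards [heu, hev, hbu.ae_memV2, hbu'.ae_memV, hbv.ae_memV] with s h1 h2 h3 h4 h5
    have hz := h3.1.divFree.sub h5.divFree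
    filter_upwards [balance_orthogonal (h3.reg hα).1 h4.reg h1 hz,
      ae_all_iff.2 fun i => balance_linear h2 i,
      ae_all_iff.2 fun i => fourier_sub_ae (u s i) (v s i),
      ae_all_iff.2 fun i => fourier_sub_ae (u' s i) (v' s i)] with ξ e1 e2 e3 e4
    rw [← e1]
    refine Finset.sum_congr rfl fun i _ => ?_
    -- The linear equation holds at almost every frequency without a gradient, so subtracting v does
    -- not change the balance. Only the field it is tested with becomes u - v.
    have e5 : SecondGrade.balance α μ ((u' - v') s) ((u - v) s) (nonlin α (u s)) i ξ =
        SecondGrade.balance α μ (u' s) (u s) (nonlin α (u s)) i ξ := by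
      have e6 := e3 i
      have e7 := e4 i
      unfold SecondGrade.balance
      simp only [Pi.sub_apply] at e6 e7 ⊢
      rw [e6, e7]
      linear_combination -(e2 i)
    rw [e5]
    rfl

end

/-! ### Low frequencies of the difference -/

lemma IsPrim.continuousOn {f Y : ℝ → ℝ} (h : IsPrim f Y) (T : ℝ) : ContinuousOn f (Icc 0 T) := by
  rcases lt_or_ge T 0 with hT | hT
  · rw [Icc_eq_empty (not_le.2 hT)]; exact continuousOn_empty _
  have h1 : ContinuousOn (fun t => f 0 + ∫ s in (0 : ℝ)..t, Y s) (uIcc 0 T) :=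
    continuousOn_const.add
      (intervalIntegral.continuousOn_primitive_interval ((intervalIntegrable_iff' (by finiteness)).1 (h T hT).1))
  rw [uIcc_of_le hT] at h1
  exact h1.congr fun t ht => (h t ht.1).2

lemma ae_Ioc_of_ae_Ioi {P : ℝ → Prop} (h : ∀ᵐ s ∂(volume.restrict (Ioi (0 : ℝ))), P s) {t : ℝ} :
    ∀ᵐ s ∂(volume.restrict (Ioc 0 t)), P s :=
  ae_restrict_of_ae_restrict_of_subset (fun _ hs => hs.1) h

lemma integral_mono_of_ae_Ioi {f g : ℝ → ℝ} {t : ℝ} (ht : 0 ≤ t)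
    (hf : IntervalIntegrable f volume 0 t) (hg : IntervalIntegrable g volume 0 t)
    (h : ∀ᵐ s ∂(volume.restrict (Ioi (0 : ℝ))), f s ≤ g s) :
    ∫ s in (0 : ℝ)..t, f s ≤ ∫ s in (0 : ℝ)..t, g s := by
  rw [intervalIntegral.integral_of_le ht, intervalIntegral.integral_of_le ht]
  exact integral_mono_ae hf.1 hg.1 (ae_Ioc_of_ae_Ioi h)

/-- A differential inequality `y' ≤ 2 a √y` with `y 0 = 0`. -/
lemma IsPrim.le_of_sqrt {y Y a : ℝ → ℝ} (h : IsPrim y Y) (h0 : y 0 = 0) (hy : ∀ t, 0 ≤ y t)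
    (ha : ∀ t, 0 ≤ a t) (hai : ∀ t ≥ 0, IntervalIntegrable a volume 0 t)
    (hY : ∀ᵐ s ∂(volume.restrict (Ioi (0 : ℝ))), Y s ≤ 2 * (a s * Real.sqrt (y s))) {t : ℝ}
    (ht : 0 ≤ t) : y t ≤ 4 * (∫ s in (0 : ℝ)..t, a s) ^ 2 := by
  -- Working at a maximum of y on [0, t] avoids the division by √y, at the price of the factor 4:
  -- there y ≤ 2 √y ∫a, hence √y ≤ 2 ∫a.
  obtain ⟨m, hm, hmax⟩ := (isCompact_Icc (a := 0) (b := t)).exists_isMaxOn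
    ⟨0, le_rfl, ht⟩ (h.continuousOn t)
  have hle : ∀ s ∈ Icc 0 t, y s ≤ y m := fun s hs => hmax hs
  have hmono : ∫ s in (0 : ℝ)..m, a s ≤ ∫ s in (0 : ℝ)..t, a s := by
    rw [← intervalIntegral.integral_add_adjacent_intervals (hai m hm.1)
      ((hai m hm.1).symm.trans (hai t ht))]
    have := intervalIntegral.integral_nonneg (μ := volume) hm.2 fun s _ => ha s
    linarith
  have hA : 0 ≤ ∫ s in (0 : ℝ)..m, a s := intervalIntegral.integral_nonneg hm.1 fun _ _ => ha _
  set A := ∫ s in (0 : ℝ)..t, a s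
  have h1 : y m ≤ 2 * (Real.sqrt (y m) * A) := by
    rw [(h m hm.1).2, h0, zero_add]
    have h2 : ∫ s in (0 : ℝ)..m, Y s ≤ ∫ s in (0 : ℝ)..m, 2 * Real.sqrt (y m) * a s := by
      rw [intervalIntegral.integral_of_le hm.1, intervalIntegral.integral_of_le hm.1]
      refine integral_mono_ae (h m hm.1).1.1 ((hai m hm.1).1.const_mul _) ?_
      filter_upwards [ae_Ioc_of_ae_Ioi hY, ae_restrict_mem measurableSet_Ioc] with s hs hmem
      refine hs.trans ?_
      have := Real.sqrt_le_sqrt (hle s ⟨hmem.1.le, hmem.2.trans hm.2⟩)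
      nlinarith [mul_le_mul_of_nonneg_left this (ha s)]
    rw [intervalIntegral.integral_const_mul] at h2
    have h3 := mul_le_mul_of_nonneg_left hmono (Real.sqrt_nonneg (y m))
    have h4 : y m = ∫ s in (0 : ℝ)..m, Y s := by
      have := (h m hm.1).2
      rwa [h0, zero_add] at this
    rw [← h4] at h2 ⊢
    linarith
  have h5 := Real.sq_sqrt (hy m)
  have h6 : Real.sqrt (y m) ≤ 2 * A := by
    by_contra hc
    push Not at hc
    have : 0 ≤ A := hA.trans hmono
    nlinarith [Real.sqrt_nonneg (y m)]
  calc y t ≤ y m := hle t ⟨ht, le_rfl⟩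
    _ = Real.sqrt (y m) ^ 2 := h5.symm
    _ ≤ (2 * A) ^ 2 := pow_le_pow_left₀ (Real.sqrt_nonneg _) h6 2
    _ = _ := by ring

/-- The mass in the frequencies `|ξ| ≤ R`. -/
def lowMass (R : ℝ) (z : Field) : ℝ := ∫ ξ in Metric.closedBall (0 : Space) R, dens z ξ

/-- The constant in the low-frequency bound of the nonlinearity. -/
def ballConst (α : ℝ) : ℝ := 3 * nlConst α *
  Real.sqrt ((2 * Real.pi * (1 + 2 * Real.pi)) ^ 2 * volume.real (Metric.closedBall (0 : Space) 1))

/-- Cauchy-Schwarz on the ball of radius R. The weight is at most a multiple of R there, and its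
square times the volume gives R⁵. -/
lemma lowNorm_proj_le {R : ℝ} (h0 : 0 ≤ R) (h1 : R ≤ 1) (f : L2) :
    lowNorm (proj (Metric.closedBall 0 R) Metric.isClosed_closedBall.measurableSet f) ≤
      Real.sqrt ((2 * Real.pi * (1 + 2 * Real.pi)) ^ 2 *
        volume.real (Metric.closedBall (0 : Space) 1) * R ^ 5) *
      Real.sqrt (∫ ξ in Metric.closedBall (0 : Space) R, ‖(𝓕 f : L2) ξ‖ ^ 2) := by
  have hpi := Real.pi_pos
  set S := Metric.closedBall (0 : Space) R
  have hS : MeasurableSet S := Metric.isClosed_closedBall.measurableSet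
  set q : Space → ℝ := fun ξ => 2 * Real.pi * ‖ξ‖ + (2 * Real.pi * ‖ξ‖) ^ 2 with hqdef
  have hqc : Continuous q := by fun_prop
  have hfin : volume S ≠ ⊤ := (isCompact_closedBall (0 : Space) R).measure_lt_top.ne
  have hSB : S ∩ lowBall = S := inter_eq_left.2 (Metric.closedBall_subset_closedBall h1)
  have e : lowNorm (proj S hS f) = ∫ ξ in S, q ξ * ‖(𝓕 f : L2) ξ‖ := by
    have : ∀ᵐ ξ, q ξ * ‖(𝓕 (proj S hS f) : L2) ξ‖ =
        S.indicator (fun ξ => q ξ * ‖(𝓕 f : L2) ξ‖) ξ := by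
      filter_upwards [fourier_proj hS f] with ξ h
      rw [h]
      by_cases hξ : ξ ∈ S <;> simp [hξ]
    rw [lowNorm, integral_congr_ae (ae_restrict_of_ae this), setIntegral_indicator hS,
      inter_comm, hSB]
  have hq : ∀ ξ ∈ S, q ξ ^ 2 ≤ (2 * Real.pi * (1 + 2 * Real.pi)) ^ 2 * R ^ 2 := by
    intro ξ hξ
    have h2 : ‖ξ‖ ≤ R := by simpa [S] using hξ
    have h3 : q ξ ≤ 2 * Real.pi * (1 + 2 * Real.pi) * R := by
      have : ‖ξ‖ ^ 2 ≤ R := by nlinarith [norm_nonneg ξ]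
      simp only [hqdef]
      nlinarith [mul_le_mul_of_nonneg_left this (sq_nonneg (2 * Real.pi))]
    rw [← mul_pow]
    exact pow_le_pow_left₀ (by positivity) h3 2
  have hqi : IntegrableOn (fun ξ => q ξ ^ 2) S :=
    (hqc.pow 2).continuousOn.integrableOn_compact (isCompact_closedBall _ _)
  have hv : volume.real S = R ^ 3 * volume.real (Metric.closedBall (0 : Space) 1) := by
    have := Measure.addHaar_real_closedBall' (volume : Measure Space) 0 h0
    rw [finrank_euclideanSpace_fin] at this
    exact this
  have h4 : ∫ ξ in S, q ξ ^ 2 ≤ (2 * Real.pi * (1 + 2 * Real.pi)) ^ 2 *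
        volume.real (Metric.closedBall (0 : Space) 1) * R ^ 5 := by
    refine (setIntegral_mono_on hqi (integrableOn_const hfin) hS hq).trans_eq ?_
    rw [setIntegral_const, hv, smul_eq_mul]
    ring
  have hfm : AEStronglyMeasurable (fun ξ => ‖(𝓕 f : L2) ξ‖) (volume.restrict S) :=
    (Reg.aesm f).norm.restrict
  rw [e]
  refine (integral_mul_le_sqrt (ν := volume.restrict S) (p := q)
    (q := fun ξ => ‖(𝓕 f : L2) ξ‖) hqc.aestronglyMeasurable hfm hqi
    (integrable_normSq (𝓕 f)).integrableOn).trans ?_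
  gcongr

lemma highNorm_proj {R : ℝ} (h1 : R ≤ 1) (f : L2) :
    highNorm (proj (Metric.closedBall 0 R) Metric.isClosed_closedBall.measurableSet f) = 0 := by
  set S := Metric.closedBall (0 : Space) R
  have hS : MeasurableSet S := Metric.isClosed_closedBall.measurableSet
  have : ∫ ξ in lowBallᶜ, (1 + ‖ξ‖) ^ 6 * ‖(𝓕 (proj S hS f) : L2) ξ‖ ^ 2 =
      ∫ ξ in lowBallᶜ, (0 : ℝ) := by
    refine setIntegral_congr_ae measurableSet_lowBall.compl ?_
    filter_upwards [fourier_proj hS f] with ξ h hξ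
    rw [h, indicator_of_notMem fun h' => hξ (Metric.closedBall_subset_closedBall h1 h')]
    simp
  rw [highNorm, this]
  simp

/-- The truncated integral is the pairing of the nonlinearity with the projection of `w` onto |ξ| ≤
R. This projection is a smooth solenoidal field, so the weak form applies, and its `waveNorm` is of
order R^(5/2) because it has no frequencies above 1. -/
lemma abs_setIntegral_fdot_nonlin_le {α : ℝ} (hα : 0 < α) {u w : Field} (hu : ∀ i, Reg 3 (u i))
    (hdu : DivFree u) (hw : ∀ i, Reg 1 (w i)) (hdw : DivFree w) {R : ℝ} (h0 : 0 ≤ R) (h1 : R ≤ 1) :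
    |∫ ξ in Metric.closedBall (0 : Space) R, fdot (nonlin α u) w ξ| ≤
      ballConst α * Real.sqrt (R ^ 5) * energy α u *
        Real.sqrt (∫ ξ in Metric.closedBall (0 : Space) R, wt α ξ * dens w ξ) := by
  set S := Metric.closedBall (0 : Space) R
  have hS : MeasurableSet S := Metric.isClosed_closedBall.measurableSet
  set ψ : Field := fun i => proj S hS (w i)
  have hψ : ∀ᵐ ξ, ∀ i, (𝓕 (ψ i) : L2) ξ = S.indicator (fun ξ => (𝓕 (w i) : L2) ξ) ξ :=
    ae_all_iff.2 fun i => fourier_proj hS (w i)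
  have hψn : ∀ n i, Reg n (ψ i) := by
    intro n i
    have h2 : IntegrableOn (fun ξ => ‖(𝓕 (w i) : L2) ξ‖ ^ 2) S :=
      (integrable_normSq (𝓕 (w i))).integrableOn
    have h3 : IntegrableOn (fun ξ => (1 + ‖ξ‖) ^ (2 * n) * ‖(𝓕 (w i) : L2) ξ‖ ^ 2) S := by
      refine h2.bdd_mul (c := (1 + R) ^ (2 * n)) (by fun_prop) ?_
      rw [ae_restrict_iff' hS]
      refine Eventually.of_forall fun ξ hξ => ?_
      rw [Real.norm_of_nonneg (by positivity)]
      have : ‖ξ‖ ≤ R := by simpa [S] using hξ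
      gcongr
    refine ((integrable_indicator_iff hS).2 h3).congr ?_
    filter_upwards [hψ] with ξ h
    rw [h i]
    by_cases hξ : ξ ∈ S <;> simp [hξ]
  have hψw : ∀ i, Wiener 2 (ψ i) := fun i => (Reg.wiener (n := 2) (hψn 4 i)).1
  have hdψ : DivFree ψ := by
    filter_upwards [hψ, hdw] with ξ h h'
    simp_rw [h]
    by_cases hξ : ξ ∈ S
    · simpa [hξ] using h'
    · simp [hξ]
  have e : ∫ ξ in S, fdot (nonlin α u) w ξ = (pairing (nonlin α u) ψ).re := by
    rw [← integral_fdot, ← integral_indicator hS]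
    refine integral_congr_ae ?_
    filter_upwards [hψ] with ξ h
    unfold fdot
    simp_rw [h]
    by_cases hξ : ξ ∈ S <;> simp [hξ]
  set y := ∫ ξ in S, wt α ξ * dens w ξ
  have hy : ∀ i, ∫ ξ in S, ‖(𝓕 (w i) : L2) ξ‖ ^ 2 ≤ y := by
    intro i
    refine integral_mono (integrable_normSq (𝓕 (w i))).integrableOn
      (integrable_wt_dens hα hw).integrableOn fun ξ => ?_
    exact (le_sum_fin (fun i => ‖(𝓕 (w i) : L2) ξ‖ ^ 2) (fun i => sq_nonneg _) i).trans
      (le_mul_of_one_le_left (dens_nonneg w ξ) (one_le_wt hα ξ))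
  have hu1 : ∀ i, Reg 1 (u i) := fun i => (hu i).mono (by norm_num)
  have hwn : waveNorm ψ ≤ 3 * (Real.sqrt ((2 * Real.pi * (1 + 2 * Real.pi)) ^ 2 *
        volume.real (Metric.closedBall (0 : Space) 1) * R ^ 5) * Real.sqrt y) := by
    have : ∀ i ∈ Finset.univ, lowNorm (ψ i) + highNorm (ψ i) ≤
        Real.sqrt ((2 * Real.pi * (1 + 2 * Real.pi)) ^ 2 *
        volume.real (Metric.closedBall (0 : Space) 1) * R ^ 5) * Real.sqrt y := by
      intro i _
      rw [highNorm_proj h1, add_zero]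
      refine (lowNorm_proj_le h0 h1 _).trans ?_
      gcongr
      exact hy i
    refine (Finset.sum_le_sum this).trans_eq ?_
    simp
  have hnl := norm_weakNonlin_le hα hu1 (fun i => (Reg.wiener (n := 0) ((hu i).mono (by norm_num))).1)
    hu1 hψw (hψn 3)
  have hc0 : 0 ≤ nlConst α := by
    have := zero_le_one.trans one_le_waveConst
    unfold nlConst; positivity
  rw [e, pairing_nonlin_eq hu hdu (hψn 2) hψw hdψ]
  refine (Complex.abs_re_le_norm _).trans (hnl.trans ?_)
  rw [Real.mul_self_sqrt (energy_nonneg hα u)]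
  have hE := energy_nonneg hα u
  calc _ ≤ nlConst α * (energy α u * (3 * (Real.sqrt ((2 * Real.pi * (1 + 2 * Real.pi)) ^ 2 *
        volume.real (Metric.closedBall (0 : Space) 1) * R ^ 5) * Real.sqrt y))) := by gcongr
    _ = _ := by
      rw [ballConst, Real.sqrt_mul (by positivity)]
      ring

/-- The low frequencies of the difference of the two solutions. -/
lemma lowMass_difference_le {α μ : ℝ} (hα : 0 < α) (hμ : 0 < μ) {u w w' : ℝ → Field}
    (hw : Evolution α μ w w' fun t => nonlin α (u t)) (h0 : w 0 = 0)
    (hu : ∀ᵐ s ∂(volume.restrict (Ioi (0 : ℝ))),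
      (∀ i, Reg 3 (u s i)) ∧ DivFree (u s) ∧ DivFree (w s))
    (hi : ∀ t ≥ 0, IntervalIntegrable (fun s => energy α (u s)) volume 0 t)
    {R : ℝ} (hR0 : 0 ≤ R) (hR1 : R ≤ 1) {t : ℝ} (ht : 0 ≤ t) :
    lowMass R (w t) ≤ 4 * ballConst α ^ 2 * R ^ 5 * (∫ s in (0 : ℝ)..t, energy α (u s)) ^ 2 := by
  have hreg := (hw.energy hα hμ).1
  -- The dissipation has the good sign and is dropped.
  have h1 := IsPrim.le_of_sqrt (hw.truncated hα R)
    (a := fun s => ballConst α * Real.sqrt (R ^ 5) * energy α (u s)) (by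
      simp [h0, dens])
    (fun s => integral_nonneg fun ξ => mul_nonneg (wt_pos hα ξ).le (dens_nonneg _ ξ))
    (fun s => by
      have := energy_nonneg hα (u s)
      have := zero_le_one.trans one_le_waveConst
      unfold ballConst nlConst
      positivity)
    (fun s hs => (hi s hs).const_mul _) (by
      filter_upwards [hu, ae_restrict_mem measurableSet_Ioi] with s hs hmem
      have k := abs_setIntegral_fdot_nonlin_le hα hs.1 hs.2.1 (hreg s (le_of_lt hmem)) hs.2.2 hR0 hR1
      have k1 : 0 ≤ ∫ ξ in Metric.closedBall (0 : Space) R, ksq ξ * dens (w s) ξ :=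
        integral_nonneg fun ξ => mul_nonneg (ksq_nonneg ξ) (dens_nonneg _ ξ)
      have k2 := mul_nonneg hμ.le k1
      have k3 := (neg_le_abs _).trans k
      linarith) ht
  rw [intervalIntegral.integral_const_mul] at h1
  refine le_trans ?_ (h1.trans_eq ?_)
  · refine integral_mono (integrable_dens _).integrableOn
      (integrable_wt_dens hα (hreg t ht)).integrableOn fun ξ => ?_
    exact le_mul_of_one_le_left (dens_nonneg _ ξ) (one_le_wt hα ξ)
  · rw [mul_pow, mul_pow, Real.sq_sqrt (by positivity)]
    ring

/-! ### Fourier splitting -/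

/-- The part gα|k|² of g(1 + α|k|²) is at most μ|k|² everywhere, where k = 2πξ. The part g is at
most μ|k|² outside the ball, by the choice of R, and inside the ball it is paid for by the mass
there. -/
lemma dissip_splitting {α μ : ℝ} (hα : 0 < α) (hμ : 0 < μ) {z : Field} (hz : ∀ i, Reg 1 (z i))
    {g R : ℝ} (hg : g * α ≤ μ) (hg0 : 0 ≤ g) (hR0 : 0 ≤ R) (hR : μ * (2 * Real.pi * R) ^ 2 = g) :
    -2 * dissip μ z ≤ -g * energy α z + 2 * g * lowMass R z := by
  set S := Metric.closedBall (0 : Space) R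
  have hS : MeasurableSet S := Metric.isClosed_closedBall.measurableSet
  have i1 := integrable_ksq_dens hz
  have i2 := integrable_wt_dens hα hz
  have i3 := (integrable_dens z).indicator hS
  have key : ∫ ξ, g * (wt α ξ * dens z ξ) ≤
      ∫ ξ, (2 * μ * (ksq ξ * dens z ξ) + 2 * g * S.indicator (dens z) ξ) := by
    refine integral_mono (i2.const_mul g) ((i1.const_mul _).add (i3.const_mul _)) fun ξ => ?_
    have hd := dens_nonneg z ξ
    have hk := ksq_nonneg ξ
    by_cases hξ : ξ ∈ S
    · simp only [indicator_of_mem hξ]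
      have : g * wt α ξ ≤ 2 * μ * ksq ξ + 2 * g := by
        unfold wt
        nlinarith [mul_le_mul_of_nonneg_right hg hk, mul_nonneg hμ.le hk]
      nlinarith
    · simp only [indicator_of_notMem hξ, mul_zero, add_zero]
      have h1 : R ≤ ‖ξ‖ := by
        simp only [S, Metric.mem_closedBall, dist_zero_right, not_le] at hξ
        exact hξ.le
      have h2 : g ≤ μ * ksq ξ := by
        rw [← hR, ksq, mul_pow]
        gcongr
      have : g * wt α ξ ≤ 2 * μ * ksq ξ := by
        unfold wt
        nlinarith [mul_le_mul_of_nonneg_right hg hk]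
      nlinarith
  rw [integral_const_mul, integral_add (i1.const_mul _) (i3.const_mul _), integral_const_mul,
    integral_const_mul, integral_indicator hS] at key
  unfold dissip energy lowMass
  linarith

/-! ### Uniform decay rates -/

lemma integral_shift_rpow {t₀ t r : ℝ} (h0 : 1 ≤ t₀) (ht : 0 ≤ t) (hr : r ≠ -1) :
    ∫ s in (0 : ℝ)..t, (s + t₀) ^ r = ((t + t₀) ^ (r + 1) - t₀ ^ (r + 1)) / (r + 1) := by
  rw [intervalIntegral.integral_comp_add_right (fun x => x ^ r), zero_add, integral_rpow]
  refine Or.inr ⟨hr, ?_⟩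
  rw [uIcc_of_le (by linarith)]
  intro h
  linarith [h.1]

lemma intervalIntegrable_shift_rpow {t₀ t : ℝ} (h0 : 1 ≤ t₀) (ht : 0 ≤ t) (r : ℝ) :
    IntervalIntegrable (fun s => (s + t₀) ^ r) volume 0 t := by
  refine ContinuousOn.intervalIntegrable ?_
  refine ContinuousOn.rpow_const (by fun_prop) fun s hs => Or.inl ?_
  rw [uIcc_of_le ht] at hs
  linarith [hs.1]

/-- The differential inequality `f' ≤ -(3/τ) f + K τ^(-d-1)`, where `τ = t + t₀`. -/
lemma IsPrim.decay {f Y : ℝ → ℝ} (h : IsPrim f Y) {t₀ K d : ℝ} (h0 : 1 ≤ t₀) (hK : 0 ≤ K)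
    (hd : d ≤ 5 / 2) (hf : 0 ≤ f 0)
    (hY : ∀ᵐ s ∂(volume.restrict (Ioi (0 : ℝ))),
      Y s ≤ -(3 / (s + t₀)) * f s + K * (s + t₀) ^ (-(d + 1))) {t : ℝ} (ht : 0 ≤ t) :
    f t ≤ (t₀ ^ 3 * f 0 + 2 * K) * (t + t₀) ^ (-d) := by
  have hτ : 0 < t + t₀ := by linarith
  set g : ℝ → ℝ := fun x => f 0 + ∫ s in (0 : ℝ)..x, Y s with hg
  have hgf : ∀ s ∈ Icc 0 t, g s = f s := fun s hs => ((h s hs.1).2).symm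
  have hi := (h t ht).1
  have hgac : AbsolutelyContinuousOnInterval g 0 t := by
    have h1 := hi.absolutelyContinuousOnInterval_intervalIntegral (c := 0) left_mem_uIcc
    have h2 : AbsolutelyContinuousOnInterval (fun _ : ℝ => f 0) 0 t :=
      (LipschitzWith.const (f 0)).lipschitzOnWith.absolutelyContinuousOnInterval
    exact h2.fun_add h1
  -- The integrating factor τ³ cancels the damping term -(3/τ) f and leaves K τ^(2-d) to integrate.
  have hpac : AbsolutelyContinuousOnInterval (fun s : ℝ => (s + t₀) ^ 3) 0 t := by
    have h1 : AbsolutelyContinuousOnInterval (fun s : ℝ => s + t₀) 0 t :=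
      (LipschitzWith.id.add (LipschitzWith.const t₀)).lipschitzOnWith.absolutelyContinuousOnInterval
    have h2 := (h1.fun_mul h1).fun_mul h1
    have e : (fun s : ℝ => (s + t₀) ^ 3) = fun s => (s + t₀) * (s + t₀) * (s + t₀) := by
      ext s; ring
    rwa [e]
  have hpd : ∀ s : ℝ, deriv (fun s : ℝ => (s + t₀) ^ 3) s = 3 * (s + t₀) ^ 2 := by
    intro s
    simp
  have key := hpac.integral_deriv_mul_eq_sub hgac
  have hle : ∫ s in (0 : ℝ)..t, (deriv (fun s : ℝ => (s + t₀) ^ 3) s * g s + (s + t₀) ^ 3 * deriv g s) ≤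
      ∫ s in (0 : ℝ)..t, K * (s + t₀) ^ (2 - d) := by
    have i1 : IntervalIntegrable (fun s => deriv (fun s : ℝ => (s + t₀) ^ 3) s * g s
        + (s + t₀) ^ 3 * deriv g s) volume 0 t := by
      refine IntervalIntegrable.add ?_ ?_
      · simp_rw [hpd]
        refine ContinuousOn.intervalIntegrable (ContinuousOn.mul (by fun_prop) ?_)
        exact hgac.continuousOn
      · exact hgac.intervalIntegrable_deriv.continuousOn_mul (by fun_prop)
    rw [intervalIntegral.integral_of_le ht, intervalIntegral.integral_of_le ht]
    refine integral_mono_ae i1.1 ((intervalIntegrable_shift_rpow h0 ht _).const_mul K).1 ?_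
    rw [EventuallyLE, ae_restrict_iff' measurableSet_Ioc]
    rw [ae_restrict_iff' measurableSet_Ioi] at hY
    filter_upwards [hY, hi.ae_hasDerivAt_integral] with s h1 h2 hmem
    have hs : 0 < s + t₀ := by linarith [hmem.1]
    have h3 : deriv g s = Y s := ((h2 (by rw [uIcc_of_le ht]; exact ⟨hmem.1.le, hmem.2⟩) 0
      left_mem_uIcc).const_add (f 0)).deriv
    rw [h3, hpd, hgf s ⟨hmem.1.le, hmem.2⟩]
    have h4 := mul_le_mul_of_nonneg_left (h1 hmem.1) (pow_pos hs 3).le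
    have h5 : (s + t₀) ^ 3 * (K * (s + t₀) ^ (-(d + 1))) = K * (s + t₀) ^ (2 - d) := by
      rw [mul_left_comm, ← Real.rpow_natCast, ← Real.rpow_add hs]
      congr 2
      push_cast
      ring
    have h6 : (s + t₀) ^ 3 * (-(3 / (s + t₀)) * f s) = -(3 * (s + t₀) ^ 2 * f s) := by
      field_simp
    rw [mul_add, h5, h6] at h4
    linarith
  rw [key, hgf t ⟨ht, le_rfl⟩, hgf 0 ⟨le_rfl, ht⟩, zero_add, intervalIntegral.integral_const_mul,
    integral_shift_rpow h0 ht (by linarith)] at hle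
  have e1 : 2 - d + 1 = 3 - d := by ring
  rw [e1] at hle
  -- Here d ≤ 5/2 enters: 3 - d ≥ 1/2, hence the constant 2.
  have h1 : ((t + t₀) ^ (3 - d) - t₀ ^ (3 - d)) / (3 - d) ≤ 2 * (t + t₀) ^ (3 - d) := by
    rw [div_le_iff₀ (by linarith)]
    have p1 : 0 < (t + t₀) ^ (3 - d) := Real.rpow_pos_of_pos hτ _
    have p2 : 0 < t₀ ^ (3 - d) := Real.rpow_pos_of_pos (by linarith) _
    nlinarith
  have h2 : 1 ≤ (t + t₀) ^ (3 - d) := Real.one_le_rpow (by linarith) (by linarith)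
  have h3 : (t + t₀) ^ 3 * f t ≤ (t₀ ^ 3 * f 0 + 2 * K) * (t + t₀) ^ (3 - d) := by
    have := mul_le_mul_of_nonneg_left h1 hK
    have : 0 ≤ t₀ ^ 3 * f 0 := by positivity
    nlinarith
  have h4 : (t + t₀) ^ (3 - d) = (t + t₀) ^ 3 * (t + t₀) ^ (-d) := by
    rw [sub_eq_add_neg, Real.rpow_add hτ]
    norm_cast
  rw [h4, mul_left_comm] at h3
  exact le_of_mul_le_mul_left h3 (by positivity)

/-- The members of the family `f` decay like `(t + t₀)^(-d)`, with a uniform constant. -/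
def UDecay {ι : Type*} (t₀ : ℝ) (f : ι → ℝ → ℝ) (d : ℝ) : Prop :=
  ∃ C, 0 ≤ C ∧ ∀ i t, 0 ≤ t → f i t ≤ C * (t + t₀) ^ (-d)

namespace UDecay

variable {ι : Type*} {t₀ : ℝ} {f g : ι → ℝ → ℝ} {d e : ℝ}

lemma mono (h0 : 1 ≤ t₀) (h : UDecay t₀ f d) (hle : e ≤ d) : UDecay t₀ f e := by
  obtain ⟨C, hC, h⟩ := h
  refine ⟨C, hC, fun i t ht => (h i t ht).trans ?_⟩
  gcongr
  linarith

lemma of_le (h : UDecay t₀ g d) (hle : ∀ i t, 0 ≤ t → f i t ≤ g i t) : UDecay t₀ f d := by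
  obtain ⟨C, hC, h⟩ := h
  exact ⟨C, hC, fun i t ht => (hle i t ht).trans (h i t ht)⟩

lemma add (hf : UDecay t₀ f d) (hg : UDecay t₀ g d) : UDecay t₀ (fun i t => f i t + g i t) d := by
  obtain ⟨C, hC, h⟩ := hf
  obtain ⟨C', hC', h'⟩ := hg
  refine ⟨C + C', by positivity, fun i t ht => ?_⟩
  rw [add_mul]
  exact add_le_add (h i t ht) (h' i t ht)

lemma const_mul (hf : UDecay t₀ f d) {c : ℝ} (hc : 0 ≤ c) : UDecay t₀ (fun i t => c * f i t) d := by
  obtain ⟨C, hC, h⟩ := hf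
  refine ⟨c * C, by positivity, fun i t ht => ?_⟩
  rw [mul_assoc]
  exact mul_le_mul_of_nonneg_left (h i t ht) hc

lemma mul (h0 : 1 ≤ t₀) (hf : UDecay t₀ f d) (hg : UDecay t₀ g e)
    (hg0 : ∀ i t, 0 ≤ t → 0 ≤ g i t) : UDecay t₀ (fun i t => f i t * g i t) (d + e) := by
  obtain ⟨C, hC, h⟩ := hf
  obtain ⟨C', hC', h'⟩ := hg
  refine ⟨C * C', by positivity, fun i t ht => ?_⟩
  have hτ : 0 < t + t₀ := by linarith
  have hp : 0 ≤ (t + t₀) ^ (-d) := (Real.rpow_pos_of_pos hτ _).le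
  calc f i t * g i t ≤ (C * (t + t₀) ^ (-d)) * (C' * (t + t₀) ^ (-e)) :=
        mul_le_mul (h i t ht) (h' i t ht) (hg0 i t ht) (by positivity)
    _ = _ := by
      rw [neg_add, Real.rpow_add hτ]
      ring

lemma sqrt (h0 : 1 ≤ t₀) (hf : UDecay t₀ f d) :
    UDecay t₀ (fun i t => Real.sqrt (f i t)) (d / 2) := by
  obtain ⟨C, hC, h⟩ := hf
  refine ⟨Real.sqrt C, Real.sqrt_nonneg _, fun i t ht => ?_⟩
  have hτ : 0 < t + t₀ := by linarith
  refine (Real.sqrt_le_sqrt (h i t ht)).trans_eq ?_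
  rw [Real.sqrt_mul hC, Real.sqrt_eq_rpow ((t + t₀) ^ (-d)), ← Real.rpow_mul hτ.le]
  congr 2
  ring

lemma rpow (d : ℝ) : UDecay t₀ (fun (_ : ι) t => (t + t₀) ^ (-d)) d :=
  ⟨1, zero_le_one, fun _ _ _ => by rw [one_mul]⟩

lemma half (h0 : 1 ≤ t₀) (hd : 0 ≤ d) (hf : UDecay t₀ f d) :
    UDecay t₀ (fun i t => f i (t / 2)) d := by
  obtain ⟨C, hC, h⟩ := hf
  refine ⟨C * 2 ^ d, by positivity, fun i t ht => (h i (t / 2) (by positivity)).trans ?_⟩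
  have hτ : 0 < t + t₀ := by linarith
  have h1 : (t / 2 + t₀) ^ (-d) ≤ ((t + t₀) / 2) ^ (-d) :=
    Real.rpow_le_rpow_of_nonpos (by linarith) (by linarith) (by linarith)
  rw [Real.div_rpow hτ.le zero_le_two, Real.rpow_neg zero_le_two, div_inv_eq_mul] at h1
  rw [mul_assoc, mul_comm ((2 : ℝ) ^ d)]
  gcongr

lemma exp (h0 : 1 ≤ t₀) {c : ℝ} (hc : 0 < c) (d : ℝ) :
    UDecay t₀ (fun (_ : ι) t => Real.exp (-(c * t))) d := by
  obtain ⟨n, hn⟩ := exists_nat_ge d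
  refine mono h0 (d := n) ⟨n.factorial / c ^ n * Real.exp (c * t₀), by positivity,
    fun _ t ht => ?_⟩ hn
  have hτ : 0 < t + t₀ := by linarith
  have h1 := Real.pow_div_factorial_le_exp (c * (t + t₀)) (by positivity) n
  rw [Real.rpow_neg hτ.le, Real.rpow_natCast, ← div_eq_mul_inv, le_div_iff₀ (by positivity)]
  rw [div_le_iff₀ (by positivity), mul_pow, mul_add, Real.exp_add] at h1
  simp only [Real.exp_neg]
  rw [inv_mul_le_iff₀ (Real.exp_pos _)]
  have h2 : (t + t₀) ^ n = (c ^ n * (t + t₀) ^ n) / c ^ n := by field_simp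
  rw [h2, div_le_iff₀ (by positivity)]
  refine h1.trans_eq ?_
  field_simp

/-- Time integrals lose one power for d < 1, while for d > 1 they are merely bounded. The
logarithmic case d = 1 is avoided by the choice of the rate q. -/
lemma integral_of_lt (h0 : 1 ≤ t₀) (hf : UDecay t₀ f d)
    (hi : ∀ i, ∀ t ≥ 0, IntervalIntegrable (f i) volume 0 t) (hd : d < 1) :
    UDecay t₀ (fun i t => ∫ s in (0 : ℝ)..t, f i s) (d - 1) := by
  obtain ⟨C, hC, h⟩ := hf
  refine ⟨C / (1 - d), div_nonneg hC (by linarith), fun i t ht => ?_⟩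
  have h1 := intervalIntegral.integral_mono_on ht (hi i t ht)
    ((intervalIntegrable_shift_rpow h0 ht (-d)).const_mul C) fun s hs => h i s hs.1
  rw [intervalIntegral.integral_const_mul, integral_shift_rpow h0 ht (by linarith)] at h1
  refine h1.trans ?_
  have e : -d + 1 = 1 - d := by ring
  have p : 0 < t₀ ^ (1 - d) := Real.rpow_pos_of_pos (by linarith) _
  rw [e, neg_sub, div_mul_eq_mul_div, ← mul_div_assoc]
  refine div_le_div_of_nonneg_right (mul_le_mul_of_nonneg_left (by linarith) hC) (by linarith)

lemma integral_of_gt (h0 : 1 ≤ t₀) (hf : UDecay t₀ f d)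
    (hi : ∀ i, ∀ t ≥ 0, IntervalIntegrable (f i) volume 0 t) (hd : 1 < d) :
    UDecay t₀ (fun i t => ∫ s in (0 : ℝ)..t, f i s) 0 := by
  obtain ⟨C, hC, h⟩ := hf
  refine ⟨C / (d - 1), div_nonneg hC (by linarith), fun i t ht => ?_⟩
  have hτ : 0 < t + t₀ := by linarith
  have h1 := intervalIntegral.integral_mono_on ht (hi i t ht)
    ((intervalIntegrable_shift_rpow h0 ht (-d)).const_mul C) fun s hs => h i s hs.1
  rw [intervalIntegral.integral_const_mul, integral_shift_rpow h0 ht (by linarith)] at h1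
  refine h1.trans ?_
  have e : -d + 1 = -(d - 1) := by ring
  have p : 0 < (t + t₀) ^ (-(d - 1)) := Real.rpow_pos_of_pos hτ _
  have p' : t₀ ^ (-(d - 1)) ≤ 1 := Real.rpow_le_one_of_one_le_of_nonpos h0 (by linarith)
  rw [e, neg_zero, Real.rpow_zero, mul_one, div_neg, ← neg_div, neg_sub, ← mul_div_assoc]
  refine div_le_div_of_nonneg_right (mul_le_of_le_one_right hC (by linarith)) (by linarith)

/-- One round of the bootstrap: a source of rate d + 1 gives decay of rate d. The constant depends
on the member of the family only through the bound of the initial value. -/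
lemma of_isPrim {Y B : ι → ℝ → ℝ} (h0 : 1 ≤ t₀) (h : ∀ i, IsPrim (f i) (Y i))
    (hf : ∀ i t, 0 ≤ f i t) {X : ℝ} (hX : ∀ i, f i 0 ≤ X) (hd : d ≤ 5 / 2)
    (hY : ∀ i, ∀ᵐ s ∂(volume.restrict (Ioi (0 : ℝ))), Y i s ≤ -(3 / (s + t₀)) * f i s + B i s)
    (hB : UDecay t₀ B (d + 1)) : UDecay t₀ f d := by
  obtain ⟨K, hK, hB⟩ := hB
  refine ⟨t₀ ^ 3 * |X| + 2 * K, by positivity, fun i t ht => ?_⟩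
  refine ((h i).decay h0 hK hd (hf i 0) ?_ ht).trans ?_
  · filter_upwards [hY i, ae_restrict_mem measurableSet_Ioi] with s hs hmem
    exact hs.trans (by linarith [hB i s (le_of_lt hmem)])
  · have : 0 ≤ t + t₀ := by linarith
    gcongr
    exact (hX i).trans (le_abs_self X)

end UDecay

/-- Decay of the energies of a family of solutions `u`, of solutions `v` of the linear problem, and
of their differences `w`, from their energy inequalities; `q` is the rate of the low
frequencies of the initial data. -/
theorem difference_decay {ι : Type*} {t₀ q D X K c : ℝ} (h0 : 1 ≤ t₀) (hK : 0 ≤ K) (hc : 0 < c)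
    (hq0 : 0 ≤ q) (hq : q ≤ 3 / 2) (hq1 : q ≠ 1) (hD : D ≤ 5 / 2) (hDq : D ≤ 3 / 8 + 7 / 4 * q)
    (hDq' : q < 1 → D ≤ 1 / 2 + 2 * q)
    {U V W U' V' W' B P : ι → ℝ → ℝ} (hU : ∀ i, IsPrim (U i) (U' i)) (hV : ∀ i, IsPrim (V i) (V' i))
    (hW : ∀ i, IsPrim (W i) (W' i)) (pU : ∀ i t, 0 ≤ U i t) (pV : ∀ i t, 0 ≤ V i t)
    (pW : ∀ i t, 0 ≤ W i t) (pP : ∀ i t, 0 ≤ P i t) (iU : ∀ i, U i 0 ≤ X) (iV : ∀ i, V i 0 ≤ X)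
    (iW : ∀ i, W i 0 ≤ X) (hWUV : ∀ i t, 0 ≤ t → W i t ≤ 2 * (U i t + V i t))
    (hB : UDecay t₀ B (q + 1))
    (hP : ∀ i t, 0 ≤ t →
      P i t ≤ K * ((1 + t) ^ (-(5 / 4) : ℝ) * Real.sqrt (V i (t / 2)) + Real.exp (-(c * t))))
    (eV : ∀ i, ∀ᵐ s ∂(volume.restrict (Ioi (0 : ℝ))),
      V' i s ≤ -(3 / (s + t₀)) * V i s + B i s)
    (eU0 : ∀ i, ∀ᵐ s ∂(volume.restrict (Ioi (0 : ℝ))), U' i s ≤ 0)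
    (eU : ∀ i, ∀ᵐ s ∂(volume.restrict (Ioi (0 : ℝ))), U' i s ≤ -(3 / (s + t₀)) * U i s +
      (B i s + K * ((s + t₀) ^ (-(7 / 2) : ℝ) * (∫ r in (0 : ℝ)..s, U i r) ^ 2)))
    (eW : ∀ i, ∀ᵐ s ∂(volume.restrict (Ioi (0 : ℝ))), W' i s ≤ -(3 / (s + t₀)) * W i s +
      (K * ((s + t₀) ^ (-(7 / 2) : ℝ) * (∫ r in (0 : ℝ)..s, U i r) ^ 2) +
        K * (Real.sqrt (W i s) * (Real.sqrt (U i s) + Real.sqrt (V i s)) * P i s))) :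
    UDecay t₀ W D := by
  have dV : UDecay t₀ V q := .of_isPrim h0 hV pV iV (by linarith) eV hB
  have dP : UDecay t₀ P (5 / 4 + q / 2) := by
    have h1 : UDecay t₀ (fun (_ : ι) t => (1 + t) ^ (-(5 / 4) : ℝ)) (5 / 4) := by
      -- From t + t₀ ≤ t₀ (1 + t).
      refine ⟨t₀ ^ (5 / 4 : ℝ), by positivity, fun i t ht => ?_⟩
      have e : t₀ ^ (5 / 4 : ℝ) * (t + t₀) ^ (-(5 / 4) : ℝ) = ((t + t₀) / t₀) ^ (-(5 / 4) : ℝ) := by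
        rw [Real.div_rpow (by linarith) (by linarith), Real.rpow_neg (by linarith : (0:ℝ) ≤ t₀),
          div_inv_eq_mul, mul_comm]
      rw [e]
      refine Real.rpow_le_rpow_of_nonpos (by positivity) ?_ (by norm_num)
      rw [div_le_iff₀ (by linarith)]
      nlinarith
    have h2 := h1.mul h0 ((dV.half h0 hq0).sqrt h0) fun i t _ => Real.sqrt_nonneg _
    exact ((h2.add (.exp h0 hc _)).const_mul hK).of_le hP
  have hint : ∀ i, ∀ t ≥ 0, IntervalIntegrable (U i) volume 0 t := fun i t ht => by
    have := (hU i).continuousOn t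
    rw [← uIcc_of_le ht] at this
    exact this.intervalIntegrable
  have pI : ∀ i t, 0 ≤ t → 0 ≤ ∫ r in (0 : ℝ)..t, U i r := fun i t ht =>
    intervalIntegral.integral_nonneg ht fun r _ => pU i r
  -- The low-frequency source: 7/2 is 5/2 from R⁵ plus 1 from the factor of the splitting.
  have low : ∀ {e : ℝ}, UDecay t₀ (fun i t => ∫ r in (0 : ℝ)..t, U i r) e →
      UDecay t₀ (fun i s => K * ((s + t₀) ^ (-(7 / 2) : ℝ) * (∫ r in (0 : ℝ)..s, U i r) ^ 2))
        (7 / 2 + (e + e)) := by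
    intro e h
    refine UDecay.const_mul ?_ hK
    have h1 := (UDecay.rpow (ι := ι) (t₀ := t₀) (7 / 2)).mul h0 (h.mul h0 h pI)
      fun i t ht => mul_nonneg (pI i t ht) (pI i t ht)
    simpa only [sq] using h1
  have dU0 : UDecay t₀ U 0 := by
    refine ⟨|X|, abs_nonneg X, fun i t ht => ?_⟩
    rw [neg_zero, Real.rpow_zero, mul_one, (hU i t ht).2]
    have h1 := integral_mono_of_ae_Ioi ht (hU i t ht).1 intervalIntegrable_const (eU0 i)
    rw [intervalIntegral.integral_zero] at h1
    linarith [iU i, le_abs_self X]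
  have stepU : ∀ {d e : ℝ}, d ≤ q → UDecay t₀ (fun i t => ∫ r in (0 : ℝ)..t, U i r) e →
      d + 1 ≤ 7 / 2 + (e + e) → UDecay t₀ U d := fun hd he hde =>
    .of_isPrim h0 hU pU iU (by linarith) eU
      ((hB.mono h0 (by linarith)).add ((low he).mono h0 hde))
  -- Bounded energy gives ∫U = O(τ), a source of rate 7/2 - 2 = 3/2, hence the rate 1/2 at most.
  have dU1 : UDecay t₀ U (min q (1 / 2)) :=
    stepU (min_le_left _ _) (dU0.integral_of_lt h0 hint (by norm_num))
      (by linarith [min_le_right q (1 / 2)])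
  -- With m = min q (1/2) the source now has rate 3/2 + 2m, and 1/2 + 2m ≥ q because q ≤ 3/2.
  have dU : UDecay t₀ U q :=
    stepU le_rfl (dU1.integral_of_lt h0 hint ((min_le_right _ _).trans_lt (by norm_num))) (by
      rcases le_total q (1 / 2) with h | h
      · rw [min_eq_left h]; linarith
      · rw [min_eq_right h]; linarith)
  -- A is the rate permitted by the low frequencies of w: 1/2 + 2q while ∫U may grow, and 5/2 once
  -- it is bounded.
  obtain ⟨A, hA, hA1, hA2⟩ : ∃ A, UDecay t₀ (fun i s =>
      K * ((s + t₀) ^ (-(7 / 2) : ℝ) * (∫ r in (0 : ℝ)..s, U i r) ^ 2)) (A + 1) ∧ D ≤ A ∧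
      1 / 4 + 3 / 2 * q ≤ A := by
    rcases lt_or_gt_of_ne hq1 with h | h
    · refine ⟨1 / 2 + 2 * q, (low (dU.integral_of_lt h0 hint h)).mono h0 (by linarith), hDq' h,
        by linarith⟩
    · exact ⟨5 / 2, (low (dU.integral_of_gt h0 hint h)).mono h0 (by linarith), hD, by linarith⟩
  have dW0 : UDecay t₀ W q := ((dU.add dV).const_mul zero_le_two).of_le hWUV
  -- A rate e of W makes the nonlinear term decay with rate e/2 + q/2 + (5/4 + q/2), which improves
  -- e to e/2 + q + 1/4.
  have stepW : ∀ {d e : ℝ}, UDecay t₀ W e → d ≤ 5 / 2 → d ≤ A →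
      d + 1 ≤ e / 2 + q / 2 + (5 / 4 + q / 2) → UDecay t₀ W d := by
    intro d e he hd hdA hde
    refine .of_isPrim h0 hW pW iW hd eW ((hA.mono h0 (by linarith)).add (UDecay.const_mul ?_ hK))
    refine UDecay.mono h0 ?_ hde
    refine UDecay.mul h0 (UDecay.mul h0 (he.sqrt h0) ((dU.sqrt h0).add (dV.sqrt h0)) ?_) dP ?_
    · exact fun i t _ => add_nonneg (Real.sqrt_nonneg _) (Real.sqrt_nonneg _)
    · exact fun i t _ => pP i t
  -- From e = q one gets 1/4 + 3q/2, and from this 3/8 + 7q/4 in the last step.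
  have dW1 : UDecay t₀ W (1 / 4 + 3 / 2 * q) := stepW dW0 (by linarith) hA2 (by linarith)
  exact stepW dW1 hD hA1 (by linarith)

/-! ### The decay character -/

lemma lowMass_nonneg (R : ℝ) (z : Field) : 0 ≤ lowMass R z :=
  integral_nonneg fun ξ => dens_nonneg z ξ

lemma lowMass_le (R : ℝ) (z : Field) : lowMass R z ≤ ∑ i, ‖z i‖ ^ 2 := by
  rw [← integral_dens]
  exact setIntegral_le_integral (integrable_dens z) (Eventually.of_forall fun ξ => dens_nonneg z ξ)

lemma lowFreqMass_eq (z : Field) (ρ : ℝ) :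
    lowFreqMass z ρ = (2 * Real.pi) ^ 3 * lowMass (ρ / (2 * Real.pi)) z := by
  have hp : 0 < (2 * Real.pi)⁻¹ := by have := Real.pi_pos; positivity
  have h := Measure.setIntegral_comp_smul_of_pos (volume : Measure Space) (dens z)
    (Metric.closedBall (0 : Space) ρ) hp
  rw [smul_closedBall' hp.ne', smul_zero, Real.norm_of_nonneg hp.le, finrank_euclideanSpace_fin,
    inv_pow, inv_inv, smul_eq_mul, ← div_eq_inv_mul] at h
  exact h

lemma lowFreqMass_nonneg (z : Field) (ρ : ℝ) : 0 ≤ lowFreqMass z ρ := by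
  rw [lowFreqMass_eq]
  have := lowMass_nonneg (ρ / (2 * Real.pi)) z
  have := Real.pi_pos
  positivity

lemma lowFreqMass_le (z : Field) (ρ : ℝ) :
    lowFreqMass z ρ ≤ (2 * Real.pi) ^ 3 * ∑ i, ‖z i‖ ^ 2 := by
  rw [lowFreqMass_eq]
  have := Real.pi_pos
  gcongr
  exact lowMass_le _ z

/-- For r = -3/2 the power of ρ is 1 and the low-frequency mass is at most a multiple of the squared
L² norm. -/
lemma le_upperDecayCharacter (z : Field) : ((-(3 / 2) : ℝ) : EReal) ≤ upperDecayCharacter z := by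
  refine le_sSup ⟨-(3 / 2), ?_, rfl⟩
  refine lt_of_le_of_lt (limsup_le_of_le (h := Eventually.of_forall fun ρ => ?_))
    (ENNReal.ofReal_lt_top (r := (2 * Real.pi) ^ 3 * ∑ i, ‖z i‖ ^ 2))
  norm_num
  exact ENNReal.ofReal_le_ofReal (lowFreqMass_le z ρ)

/-- The supremum need not be attained, hence the strict inequality. The indicator only sees small ρ,
and for ρ bounded below the total mass suffices, at the price of the constant. The case q = 0 is the
bound by the total mass. -/
lemma exists_lowFreqMass_le (z : Field) {q : ℝ} (hq : 0 ≤ q)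
    (h : q = 0 ∨ ((q - 3 / 2 : ℝ) : EReal) < upperDecayCharacter z) :
    ∃ C, 0 ≤ C ∧ ∀ ρ > 0, lowFreqMass z ρ ≤ C * ρ ^ (2 * q) := by
  have hpi := Real.pi_pos
  set M := (2 * Real.pi) ^ 3 * ∑ i, ‖z i‖ ^ 2
  have hM : 0 ≤ M := by positivity
  rcases h with rfl | h
  · exact ⟨M, hM, fun ρ _ => by simpa using lowFreqMass_le z ρ⟩
  obtain ⟨_, ⟨r, hr, rfl⟩, hlt⟩ := lt_sSup_iff.1 h
  have hqr : q - 3 / 2 < r := EReal.coe_lt_coe_iff.1 hlt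
  obtain ⟨c, hc1, hc2⟩ := ENNReal.lt_iff_exists_nnreal_btwn.1 (show upperDecayIndicator r z < ⊤ from hr)
  have hev := eventually_lt_of_limsup_lt hc1
  obtain ⟨δ, hδ, hsub⟩ := mem_nhdsGT_iff_exists_Ioo_subset.1 hev
  have hδ0 : 0 < min δ 1 := lt_min hδ one_pos
  refine ⟨max (c : ℝ) (M / (min δ 1) ^ (2 * q)), le_max_of_le_left c.2, fun ρ hρ => ?_⟩
  have hρq : 0 < ρ ^ (2 * q) := Real.rpow_pos_of_pos hρ _
  rcases lt_or_ge ρ (min δ 1) with hlt | hge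
  · have h1 := hsub ⟨hρ, hlt.trans_le (min_le_left _ _)⟩
    have h2 : ρ ^ (-2 * r - 3) * lowFreqMass z ρ ≤ c := by
      have h3 : ENNReal.ofReal (ρ ^ (-2 * r - 3) * lowFreqMass z ρ) ≤ (c : ENNReal) := le_of_lt h1
      have h4 := ENNReal.toReal_mono (by simp) h3
      rwa [ENNReal.toReal_ofReal (mul_nonneg (by positivity) (lowFreqMass_nonneg z ρ)),
        ENNReal.coe_toReal] at h4
    have e : lowFreqMass z ρ = ρ ^ (2 * r + 3) * (ρ ^ (-2 * r - 3) * lowFreqMass z ρ) := by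
      rw [← mul_assoc, ← Real.rpow_add hρ]
      ring_nf
      simp
    have h5 : ρ ^ (2 * r + 3) ≤ ρ ^ (2 * q) :=
      Real.rpow_le_rpow_of_exponent_ge hρ (hlt.trans_le (min_le_right _ _)).le (by linarith)
    rw [e]
    calc ρ ^ (2 * r + 3) * (ρ ^ (-2 * r - 3) * lowFreqMass z ρ) ≤ ρ ^ (2 * q) * c :=
          mul_le_mul h5 h2 (mul_nonneg (by positivity) (lowFreqMass_nonneg z ρ)) hρq.le
      _ ≤ _ := by
        rw [mul_comm]
        gcongr
        exact le_max_left _ _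
  · have h1 : (min δ 1) ^ (2 * q) ≤ ρ ^ (2 * q) :=
      Real.rpow_le_rpow hδ0.le hge (by linarith)
    have h2 : 0 < (min δ 1) ^ (2 * q) := Real.rpow_pos_of_pos hδ0 _
    calc lowFreqMass z ρ ≤ M := lowFreqMass_le z ρ
      _ = M / (min δ 1) ^ (2 * q) * (min δ 1) ^ (2 * q) := by field_simp
      _ ≤ max (c : ℝ) (M / (min δ 1) ^ (2 * q)) * ρ ^ (2 * q) :=
        mul_le_mul (le_max_right _ _) h1 h2.le (le_max_of_le_left c.2)

lemma decayRate_coe (x : ℝ) : decayRate x = min (5 / 2 + 3 / 2 * x) (5 / 2) := by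
  rw [decayRate, ← EReal.coe_mul, ← EReal.coe_add, ← EReal.coe_strictMono.monotone.map_min,
    EReal.toReal_coe]

lemma decayRate_top : decayRate ⊤ = 5 / 2 := by
  rw [decayRate, EReal.coe_mul_top_of_pos (by norm_num), EReal.coe_add_top, min_eq_right le_top,
    EReal.toReal_coe]

/-- The rate of the low frequencies that is used for a given decay character. -/
lemma exists_rate {r : EReal} (hr : ((-(3 / 2) : ℝ) : EReal) ≤ r) :
    1 / 4 ≤ decayRate r ∧ decayRate r ≤ 5 / 2 ∧ ∃ q : ℝ, 0 ≤ q ∧ q ≤ 3 / 2 ∧ q ≠ 1 ∧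
      (q = 0 ∨ ((q - 3 / 2 : ℝ) : EReal) < r) ∧ decayRate r ≤ 3 / 8 + 7 / 4 * q ∧
      (q < 1 → decayRate r ≤ 1 / 2 + 2 * q) := by
  induction r with
  | bot => simp at hr
  | top =>
    rw [decayRate_top]
    -- For r > 0 the largest useful value q = 3/2 is strictly admissible, and 3/8 + 7q/4 = 3 exceeds
    -- 5/2.
    refine ⟨by norm_num, by norm_num, 3 / 2, by norm_num, le_rfl, by norm_num, Or.inr ?_,
      by norm_num, by norm_num⟩
    exact EReal.coe_lt_top _
  | coe x =>
    have hx : -(3 / 2) ≤ x := EReal.coe_le_coe_iff.1 hr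
    rw [decayRate_coe]
    simp only [EReal.coe_lt_coe_iff]
    refine ⟨le_min (by linarith) (by norm_num), min_le_right _ _, ?_⟩
    rcases lt_or_ge 0 x with h | h
    · refine ⟨3 / 2, by norm_num, le_rfl, by norm_num, Or.inr (by linarith), ?_, by norm_num⟩
      exact (min_le_right _ _).trans (by norm_num)
    · have hm : min (5 / 2 + 3 / 2 * x) (5 / 2) ≤ 5 / 2 + 3 / 2 * x := min_le_left _ _
      rcases hx.eq_or_lt with rfl | hx'
      -- For r = -3/2 no q below r + 3/2 is nonnegative. The trivial value q = 0 gives 3/8, more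
      -- than the required 1/4.
      · refine ⟨0, le_rfl, by norm_num, by norm_num, Or.inl rfl, ?_, fun _ => ?_⟩ <;> linarith
      -- With q = x + 3/2 - δ the available rate exceeds 5/2 + 3x/2 by 1/2 + x/4 - 7δ/4, which is at
      -- least 1/8 - 7δ/4 for x ≥ -3/2. So δ ≤ 1/14 is allowed, which leaves an interval in which q
      -- = 1 can be avoided.
      · obtain ⟨a, ha1, ha2⟩ := exists_between
          (show max 0 (x + 3 / 2 - 1 / 14) < x + 3 / 2 from max_lt (by linarith) (by linarith))
        obtain ⟨b, hb1, hb2⟩ := exists_between ha2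
        have hq : ∃ q, max 0 (x + 3 / 2 - 1 / 14) < q ∧ q < x + 3 / 2 ∧ q ≠ 1 := by
          by_cases h1 : a = 1
          · exact ⟨b, ha1.trans hb1, hb2, fun h2 => by linarith⟩
          · exact ⟨a, ha1, ha2, h1⟩
        obtain ⟨q, hq1, hq2, hq3⟩ := hq
        have h1 := (le_max_left _ _).trans_lt hq1
        have h2 := (le_max_right _ _).trans_lt hq1
        exact ⟨q, h1.le, by linarith, hq3, Or.inr (by linarith), by linarith,
          fun _ => by linarith⟩

/-! ### Comparison of a weak solution with the linear solution -/

/-- The radius of the Fourier splitting at the shifted time `τ`. -/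
def splitRadius (μ τ : ℝ) : ℝ := Real.sqrt (3 / (μ * τ)) / (2 * Real.pi)

lemma splitRadius_pos {μ τ : ℝ} (hμ : 0 < μ) (hτ : 0 < τ) : 0 < splitRadius μ τ := by
  have := Real.pi_pos
  unfold splitRadius; positivity

lemma two_pi_mul_splitRadius (μ τ : ℝ) :
    2 * Real.pi * splitRadius μ τ = Real.sqrt (3 / (μ * τ)) := by
  have := Real.pi_pos
  unfold splitRadius; field_simp

/-- A time shift after which the splitting radius is at most one. -/
def timeShift (α μ : ℝ) : ℝ := max 1 (max (3 * α / μ) (3 / μ))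

section

variable {α μ : ℝ}

lemma one_le_timeShift : 1 ≤ timeShift α μ := le_max_left _ _

lemma split_rate_le (hμ : 0 < μ) {s : ℝ} (hs : 0 ≤ s) :
    3 / (s + timeShift α μ) * α ≤ μ := by
  have h1 : 3 * α / μ ≤ timeShift α μ := (le_max_left _ _).trans (le_max_right _ _)
  have h2 := one_le_timeShift (α := α) (μ := μ)
  rw [div_le_iff₀ hμ] at h1
  rw [div_mul_eq_mul_div, div_le_iff₀ (by linarith)]
  nlinarith

lemma splitRadius_sq (hμ : 0 < μ) {τ : ℝ} (hτ : 0 < τ) :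
    μ * (2 * Real.pi * splitRadius μ τ) ^ 2 = 3 / τ := by
  rw [two_pi_mul_splitRadius, Real.sq_sqrt (by positivity)]
  field_simp

lemma splitRadius_le_one (hμ : 0 < μ) {s : ℝ} (hs : 0 ≤ s) :
    splitRadius μ (s + timeShift α μ) ≤ 1 := by
  have h1 : 3 / μ ≤ timeShift α μ := (le_max_right _ _).trans (le_max_right _ _)
  have h2 := one_le_timeShift (α := α) (μ := μ)
  rw [div_le_iff₀ hμ] at h1
  rw [splitRadius, div_le_one (by have := Real.pi_pos; positivity)]
  refine Real.sqrt_le_iff.2 ⟨by have := Real.pi_pos; positivity, ?_⟩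
  calc 3 / (μ * (s + timeShift α μ)) ≤ 1 := by
        rw [div_le_one (by positivity)]
        nlinarith
    _ ≤ (2 * Real.pi) ^ 2 := by nlinarith [Real.pi_gt_three]

lemma splitRadius_pow_five (hμ : 0 < μ) {τ : ℝ} (hτ : 0 < τ) :
    splitRadius μ τ ^ 5 = splitRadius μ 1 ^ 5 * τ ^ (-(5 / 2) : ℝ) := by
  have e : splitRadius μ τ = splitRadius μ 1 * τ ^ (-(1 / 2) : ℝ) := by
    have h : Real.sqrt (3 / (μ * τ)) = Real.sqrt (3 / μ) / Real.sqrt τ := by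
      rw [← div_div, Real.sqrt_div (by positivity : 0 ≤ 3 / μ)]
    rw [splitRadius, splitRadius, mul_one, h, Real.rpow_neg hτ.le, ← Real.sqrt_eq_rpow]
    ring
  rw [e, mul_pow, ← Real.rpow_natCast (τ ^ (-(1 / 2) : ℝ)), ← Real.rpow_mul hτ.le]
  norm_num

end

/-- The constant in the energy inequalities. -/
def comparisonConst (α μ : ℝ) : ℝ :=
  48 * ballConst α ^ 2 * splitRadius μ 1 ^ 5 + 2 * nlConst α +
    3 * (lowDecayConst α μ + Real.sqrt (v2Const α))

lemma nlConst_nonneg {α : ℝ} (hα : 0 < α) : 0 ≤ nlConst α := by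
  have := zero_le_one.trans one_le_waveConst
  unfold nlConst; positivity

lemma comparisonConst_bounds {α μ : ℝ} (hα : 0 < α) (hμ : 0 < μ) :
    0 ≤ comparisonConst α μ ∧
    48 * ballConst α ^ 2 * splitRadius μ 1 ^ 5 ≤ comparisonConst α μ ∧
    2 * nlConst α ≤ comparisonConst α μ ∧
    3 * (lowDecayConst α μ + Real.sqrt (v2Const α)) ≤ comparisonConst α μ := by
  have h1 : 0 ≤ 48 * ballConst α ^ 2 * splitRadius μ 1 ^ 5 := by
    have := (splitRadius_pos hμ one_pos).le
    positivity
  have h2 := nlConst_nonneg hα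
  have h3 : 0 ≤ lowDecayConst α μ + Real.sqrt (v2Const α) :=
    add_nonneg (lowDecayConst_nonneg α μ) (Real.sqrt_nonneg _)
  unfold comparisonConst
  refine ⟨?_, ?_, ?_, ?_⟩ <;> linarith

/-- The data of the comparison: an initial field, a weak solution and a linear solution. -/
structure Comparison (α μ : ℝ) where
  /-- the initial field -/
  u₀ : Field
  /-- the weak solution -/
  u : ℝ → Field
  /-- the solution of the linear problem -/
  v : ℝ → Field
  reg : ∀ i, Reg 4 (u₀ i)
  divFree : DivFree u₀
  small : ∑ i, regSq 3 (u₀ i) ≤ v2Const α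
  weak : IsWeakSolution α μ u₀ u
  linear : IsLinearSolution α μ u₀ v

namespace Comparison

variable {α μ : ℝ} (x : Comparison α μ)

lemma damped (hα : 0 < α) (hμ : 0 < μ) {t : ℝ} (ht : 0 ≤ t) (i : Fin 3) :
    Damped (msym α μ) t (x.u₀ i) (x.v t i) := x.linear.fourier_eq hα hμ ht i

lemma reg_v (hα : 0 < α) (hμ : 0 < μ) {t : ℝ} (ht : 0 ≤ t) (i : Fin 3) : Reg 4 (x.v t i) :=
  (x.damped hα hμ ht i).reg (msym_nonneg hα hμ) ht (x.reg i)

lemma divFree_v (hα : 0 < α) (hμ : 0 < μ) {t : ℝ} (ht : 0 ≤ t) : DivFree (x.v t) :=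
  x.divFree.damped (x.damped hα hμ ht)

lemma lowMass_v_le (hα : 0 < α) (hμ : 0 < μ) {t : ℝ} (ht : 0 ≤ t) (R : ℝ) :
    lowMass R (x.v t) ≤ lowMass R x.u₀ :=
  integral_mono_ae (integrable_dens _).integrableOn (integrable_dens _).integrableOn
    (ae_restrict_of_ae (dens_le_of_damped (msym_nonneg hα hμ) ht (x.damped hα hμ ht)))

lemma ae_u (hα : 0 < α) : ∀ᵐ s ∂(volume.restrict (Ioi (0 : ℝ))),
    (∀ i, Reg 3 (x.u s i)) ∧ DivFree (x.u s) ∧ IsRealValued (x.u s) := by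
  filter_upwards [x.weak.2.1.ae_memV2] with s h
  exact ⟨(h.reg hα).1, h.1.divFree, h.1.1⟩

lemma reg_zero (i : Fin 3) : Reg 1 (x.u₀ i) := (x.reg i).mono (by norm_num)

lemma exists_evolution (hα : 0 < α) : ∃ u' v', Evolution α μ x.u u' (fun t => nonlin α (x.u t)) ∧
    Evolution α μ x.v v' (fun _ => 0) ∧
    Evolution α μ (x.u - x.v) (u' - v') (fun t => nonlin α (x.u t)) := by
  obtain ⟨h0, hb, u', hd, hb', he⟩ := x.weak
  obtain ⟨k0, kb, v', kd, kb', ke⟩ := x.linear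
  have hu : ∀ i, Reg 1 (x.u 0 i) := by rw [h0]; exact x.reg_zero
  have hv : ∀ i, Reg 1 (x.v 0 i) := by rw [k0]; exact x.reg_zero
  exact ⟨u', v', evolution_weak hα hb hd hb' he hu, evolution_linear hα kb kd kb' ke hv,
    evolution_difference hα hb hd hb' he kb kd kb' ke (h0.trans k0.symm)⟩

lemma reg_u (hα : 0 < α) (hμ : 0 < μ) {t : ℝ} (ht : 0 ≤ t) (i : Fin 3) : Reg 1 (x.u t i) := by
  obtain ⟨u', v', hu, -, -⟩ := x.exists_evolution hα
  exact (hu.energy hα hμ).1 t ht i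

lemma reg_sub (hα : 0 < α) (hμ : 0 < μ) {t : ℝ} (ht : 0 ≤ t) (i : Fin 3) :
    Reg 1 ((x.u t - x.v t) i) :=
  (x.reg_u hα hμ ht i).sub ((x.reg_v hα hμ ht i).mono (by norm_num))

lemma isPrim_u (hα : 0 < α) (hμ : 0 < μ) :
    IsPrim (fun t => energy α (x.u t)) (fun s => -2 * dissip μ (x.u s)) := by
  obtain ⟨u', v', hu, -, -⟩ := x.exists_evolution hα
  refine (hu.energy hα hμ).2.congr ?_
  filter_upwards [x.ae_u hα] with s h
  rw [pairing_nonlin_self h.1 h.2.1 h.2.2]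
  simp

lemma isPrim_v (hα : 0 < α) (hμ : 0 < μ) :
    IsPrim (fun t => energy α (x.v t)) (fun s => -2 * dissip μ (x.v s)) := by
  obtain ⟨u', v', -, hv, -⟩ := x.exists_evolution hα
  refine (hv.energy hα hμ).2.congr (Eventually.of_forall fun s => ?_)
  have : pairing 0 (x.v s) = 0 := by
    refine Finset.sum_eq_zero fun i _ => ?_
    rw [← integral_zero Space ℂ]
    refine integral_congr_ae ?_
    filter_upwards [Lp.coeFn_zero ℂ 2 (volume : Measure Space)] with y h
    rw [Pi.zero_apply, h, Pi.zero_apply, zero_mul]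
  rw [this]
  simp

lemma isPrim_sub (hα : 0 < α) (hμ : 0 < μ) :
    IsPrim (fun t => energy α (x.u t - x.v t)) (fun s => -2 * dissip μ (x.u s - x.v s)
      - 2 * (pairing (nonlin α (x.u s)) (x.u s - x.v s)).re) := by
  obtain ⟨u', v', -, -, hw⟩ := x.exists_evolution hα
  exact (hw.energy hα hμ).2

lemma lowMass_sub_le (hα : 0 < α) (hμ : 0 < μ) {R : ℝ} (hR0 : 0 ≤ R) (hR1 : R ≤ 1) {t : ℝ}
    (ht : 0 ≤ t) : lowMass R (x.u t - x.v t) ≤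
      4 * ballConst α ^ 2 * R ^ 5 * (∫ s in (0 : ℝ)..t, energy α (x.u s)) ^ 2 := by
  obtain ⟨u', v', -, -, hw⟩ := x.exists_evolution hα
  refine lowMass_difference_le hα hμ hw ?_ ?_ ?_ hR0 hR1 ht
  · rw [Pi.sub_apply, x.weak.1, x.linear.1, sub_self]
  · filter_upwards [x.ae_u hα, ae_restrict_mem measurableSet_Ioi] with s h hs
    exact ⟨h.1, h.2.1, h.2.1.sub (x.divFree_v hα hμ (le_of_lt hs))⟩
  · intro s hs
    have := (x.isPrim_u hα hμ).continuousOn s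
    rw [← uIcc_of_le hs] at this
    exact this.intervalIntegrable

lemma lowMass_u_le (hα : 0 < α) (hμ : 0 < μ) {t : ℝ} (ht : 0 ≤ t) (R : ℝ) :
    lowMass R (x.u t) ≤ 2 * (lowMass R x.u₀ + lowMass R (x.u t - x.v t)) := by
  refine le_trans ?_ (mul_le_mul_of_nonneg_left
    (add_le_add (x.lowMass_v_le hα hμ ht R) le_rfl) zero_le_two)
  unfold lowMass
  have i1 : ∀ z : Field, IntegrableOn (dens z) (Metric.closedBall (0 : Space) R) := fun z =>
    (integrable_dens z).integrableOn
  rw [← integral_add (i1 _) (i1 _), ← integral_const_mul]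
  refine integral_mono_ae (i1 _) (((i1 _).add (i1 _)).const_mul 2) (ae_restrict_of_ae ?_)
  filter_upwards [ae_all_iff.2 fun i => fourier_sub_ae (x.u t i) (x.v t i)] with ξ h
  unfold dens
  rw [← Finset.sum_add_distrib, Finset.mul_sum]
  refine Finset.sum_le_sum fun i _ => ?_
  have e : (𝓕 (x.u t i) : L2) ξ = (𝓕 (x.v t i) : L2) ξ + (𝓕 ((x.u t - x.v t) i) : L2) ξ := by
    rw [Pi.sub_apply, h i]; ring
  rw [e]
  have := norm_add_le ((𝓕 (x.v t i) : L2) ξ) ((𝓕 ((x.u t - x.v t) i) : L2) ξ)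
  nlinarith [norm_nonneg ((𝓕 (x.v t i) : L2) ξ + (𝓕 ((x.u t - x.v t) i) : L2) ξ),
    sq_nonneg (‖(𝓕 (x.v t i) : L2) ξ‖ - ‖(𝓕 ((x.u t - x.v t) i) : L2) ξ‖)]

/-- The source term of the energy inequalities that is due to the initial data. -/
def source (s : ℝ) : ℝ :=
  -- Twice the factor 6/τ of the splitting, since the mass of u is at most twice the sum of the
  -- masses of v and w.
  12 / (s + timeShift α μ) * lowMass (splitRadius μ (s + timeShift α μ)) x.u₀

lemma splitting (hα : 0 < α) (hμ : 0 < μ) {z : Field} (hz : ∀ i, Reg 1 (z i)) {s : ℝ}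
    (hs : 0 ≤ s) : -2 * dissip μ z ≤ -(3 / (s + timeShift α μ)) * energy α z +
      6 / (s + timeShift α μ) * lowMass (splitRadius μ (s + timeShift α μ)) z := by
  have h1 := one_le_timeShift (α := α) (μ := μ)
  have hτ : 0 < s + timeShift α μ := by linarith
  refine (dissip_splitting hα hμ hz (split_rate_le hμ hs) (by positivity)
    (splitRadius_pos hμ hτ).le (splitRadius_sq hμ hτ)).trans_eq ?_
  ring

lemma lowMass_split_sub_le (hα : 0 < α) (hμ : 0 < μ) {s : ℝ} (hs : 0 ≤ s) :
    12 / (s + timeShift α μ) * lowMass (splitRadius μ (s + timeShift α μ)) (x.u s - x.v s) ≤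
      comparisonConst α μ * ((s + timeShift α μ) ^ (-(7 / 2) : ℝ) *
        (∫ r in (0 : ℝ)..s, energy α (x.u r)) ^ 2) := by
  have h1 := one_le_timeShift (α := α) (μ := μ)
  have hτ : 0 < s + timeShift α μ := by linarith
  have h2 := x.lowMass_sub_le hα hμ (splitRadius_pos hμ hτ).le (splitRadius_le_one hμ hs) hs
  rw [splitRadius_pow_five hμ hτ] at h2
  refine (mul_le_mul_of_nonneg_left h2 (by positivity)).trans ?_
  have e : (s + timeShift α μ) ^ (-(7 / 2) : ℝ) =
      (s + timeShift α μ)⁻¹ * (s + timeShift α μ) ^ (-(5 / 2) : ℝ) := by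
    rw [← Real.rpow_neg_one, ← Real.rpow_add hτ]
    norm_num
  calc _ = 48 * ballConst α ^ 2 * splitRadius μ 1 ^ 5 * ((s + timeShift α μ) ^ (-(7 / 2) : ℝ) *
        (∫ r in (0 : ℝ)..s, energy α (x.u r)) ^ 2) := by rw [e]; ring
    _ ≤ _ := by
      gcongr
      exact (comparisonConst_bounds hα hμ).2.1

lemma lowMass_div_le {s : ℝ} (hs : 0 ≤ s) (z : Field) (R : ℝ) :
    6 / (s + timeShift α μ) * lowMass R z ≤ 12 / (s + timeShift α μ) * lowMass R z := by
  have h1 := one_le_timeShift (α := α) (μ := μ)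
  have hτ : 0 < s + timeShift α μ := by linarith
  have := lowMass_nonneg R z
  gcongr
  norm_num

lemma energy_v_le (hα : 0 < α) (hμ : 0 < μ) {s : ℝ} (hs : 0 ≤ s) :
    -2 * dissip μ (x.v s) ≤ -(3 / (s + timeShift α μ)) * energy α (x.v s) + x.source s := by
  have h1 := one_le_timeShift (α := α) (μ := μ)
  have hτ : 0 < s + timeShift α μ := by linarith
  refine (splitting hα hμ (fun i => (x.reg_v hα hμ hs i).mono (by norm_num)) hs).trans ?_
  gcongr
  refine (lowMass_div_le hs _ _).trans ?_
  rw [source]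
  gcongr
  exact x.lowMass_v_le hα hμ hs _

lemma energy_u_le (hα : 0 < α) (hμ : 0 < μ) {s : ℝ} (hs : 0 ≤ s) :
    -2 * dissip μ (x.u s) ≤ -(3 / (s + timeShift α μ)) * energy α (x.u s) +
      (x.source s + comparisonConst α μ * ((s + timeShift α μ) ^ (-(7 / 2) : ℝ) *
        (∫ r in (0 : ℝ)..s, energy α (x.u r)) ^ 2)) := by
  have h1 := one_le_timeShift (α := α) (μ := μ)
  have hτ : 0 < s + timeShift α μ := by linarith
  refine (splitting hα hμ (x.reg_u hα hμ hs) hs).trans ?_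
  gcongr
  refine le_trans ?_ (add_le_add le_rfl (x.lowMass_split_sub_le hα hμ hs))
  have h2 := mul_le_mul_of_nonneg_left (x.lowMass_u_le hα hμ hs (splitRadius μ (s + timeShift α μ)))
    (by positivity : 0 ≤ 6 / (s + timeShift α μ))
  refine h2.trans_eq ?_
  rw [source]
  ring

lemma energy_sub_le (hα : 0 < α) (hμ : 0 < μ) : ∀ᵐ s ∂(volume.restrict (Ioi (0 : ℝ))),
    -2 * dissip μ (x.u s - x.v s) - 2 * (pairing (nonlin α (x.u s)) (x.u s - x.v s)).re ≤
      -(3 / (s + timeShift α μ)) * energy α (x.u s - x.v s) +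
      (comparisonConst α μ * ((s + timeShift α μ) ^ (-(7 / 2) : ℝ) *
        (∫ r in (0 : ℝ)..s, energy α (x.u r)) ^ 2) +
      comparisonConst α μ * (Real.sqrt (energy α (x.u s - x.v s)) *
        (Real.sqrt (energy α (x.u s)) + Real.sqrt (energy α (x.v s))) * waveNorm (x.v s))) := by
  filter_upwards [x.ae_u hα, x.linear.2.1.ae_memV, ae_restrict_mem measurableSet_Ioi]
    with s hu hv hs
  -- The pointwise bound of the work of the nonlinearity needs u(s) in H³ and v(s) real valued,
  -- which is known at almost every time only.
  have hs' : 0 ≤ s := le_of_lt hs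
  have hv4 := x.reg_v hα hμ hs'
  have k1 := norm_pairing_nonlin_sub_le hα hu.1 hu.2.1 hu.2.2 hv4 hv.divFree hv.1
    fun i => (hu.1 i).sub ((hv4 i).mono (by norm_num))
  have k2 := (neg_le_abs _).trans
    (Complex.abs_re_le_norm (pairing (nonlin α (x.u s)) (x.u s - x.v s)))
  have k3 := splitting hα hμ (x.reg_sub hα hμ hs') hs'
  have k4 := (lowMass_div_le (α := α) (μ := μ) hs' (x.u s - x.v s)
    (splitRadius μ (s + timeShift α μ))).trans (x.lowMass_split_sub_le hα hμ hs')
  have k5 := mul_le_mul_of_nonneg_right (comparisonConst_bounds hα hμ).2.2.1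
    (mul_nonneg (mul_nonneg (Real.sqrt_nonneg (energy α (x.u s - x.v s)))
      (add_nonneg (Real.sqrt_nonneg (energy α (x.u s))) (Real.sqrt_nonneg (energy α (x.v s)))))
      (waveNorm_nonneg (x.v s)))
  linarith

/-- The field `small` of the comparison replaces the H³ norm of the datum by a constant that depends
on α alone. This is what the bound on the norm of V₂ is for. -/
lemma waveNorm_v_le (hα : 0 < α) (hμ : 0 < μ) {t : ℝ} (ht : 0 ≤ t) : waveNorm (x.v t) ≤
    comparisonConst α μ * ((1 + t) ^ (-(5 / 4) : ℝ) * Real.sqrt (energy α (x.v (t / 2))) +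
      Real.exp (-(gapRate α μ * t))) := by
  have h1 := waveNorm_le_of_damped hα hμ ht (fun i => (x.reg i).mono (by norm_num))
    (x.damped hα hμ ht) (x.damped hα hμ (by positivity : 0 ≤ t / 2))
  refine h1.trans ?_
  have hE : 0 ≤ (1 + t) ^ (-(5 / 4) : ℝ) * Real.sqrt (energy α (x.v (t / 2))) := by positivity
  have hL := lowDecayConst_nonneg α μ
  have hS := Real.sqrt_nonneg (v2Const α)
  have hs := Real.sqrt_le_sqrt x.small
  have he := (Real.exp_pos (-(gapRate α μ * t))).le
  refine le_trans ?_ (mul_le_mul_of_nonneg_right (comparisonConst_bounds hα hμ).2.2.2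
    (add_nonneg hE he))
  have p1 := mul_le_mul_of_nonneg_left hs he
  have p2 := mul_nonneg hL he
  have p3 := mul_nonneg hS hE
  linarith

end Comparison

/-! ### The main estimate -/

lemma exists_pd_filtered {α : ℝ} (hα : 0 < α) {f : L2} (hf : Reg 3 f) (j : Fin 3) :
    ∃ g : L2, toDist g = pd j (toDist f - (α : ℂ) • Δ (toDist f)) := by
  have ht := (wt_temperate α).mul (dsym_temperate j)
  obtain ⟨g, hg⟩ := exists_symbol hf (σ := fun ξ => (wt α ξ : ℂ) * dsym j ξ) ht.1.continuous
    (c := (1 + α * (2 * Real.pi) ^ 2) * (2 * Real.pi)) fun ξ => by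
      rw [norm_mul, Complex.norm_real, Real.norm_of_nonneg (wt_pos hα ξ).le]
      calc _ ≤ ((1 + α * (2 * Real.pi) ^ 2) * (1 + ‖ξ‖) ^ 2) * ((2 * Real.pi) * (1 + ‖ξ‖) ^ 1) :=
            mul_le_mul (wt_le hα ξ) (norm_dsym_le' j ξ) (norm_nonneg _) (by positivity)
        _ = _ := by ring
  refine ⟨g, ?_⟩
  rw [filtered_eq_mult, pd_eq_mult, mult_mult (wt_temperate α) (dsym_temperate j)]
  exact ((mult_toDist_eq_iff ht f g).2 hg).symm

/-- `normV2` is defined through `rep`, so it controls third derivatives only if the curl of the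
filtered field is represented by square integrable functions. -/
lemma memV2_of_reg {α : ℝ} (hα : 0 < α) {v : Field} (hr : IsRealValued v) (hd : divergence v = 0)
    (hv : ∀ i, Reg 3 (v i)) : MemV2 α v := by
  refine ⟨⟨hr, fun i => ?_, hd⟩, fun i => ?_⟩
  · simpa using ((hv i).mono (by norm_num : 1 ≤ 3)).memSobolev
  · have key : ∀ a b, ∃ g : L2, toDist g = pd a (toDist (v b) - (α : ℂ) • Δ (toDist (v b)))
        - pd b (toDist (v a) - (α : ℂ) • Δ (toDist (v a))) := by
      intro a b
      obtain ⟨g, hg⟩ := exists_pd_filtered hα (hv b) a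
      obtain ⟨k, hk⟩ := exists_pd_filtered hα (hv a) b
      exact ⟨g - k, by rw [toDist_sub, hg, hk]⟩
    fin_cases i
    · exact key 1 2
    · exact key 2 0
    · exact key 0 1

/-- The squared splitting radius is proportional to 1/τ, so ρ^(2q) becomes τ^(-q), and the prefactor
contributes one more power. -/
lemma uDecay_source {α μ : ℝ} (hμ : 0 < μ) {ι : Type*} (x : ι → Comparison α μ)
    {C q : ℝ} (hC : 0 ≤ C)
    (h : ∀ i, ∀ ρ > 0, lowFreqMass (x i).u₀ ρ ≤ C * ρ ^ (2 * q)) :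
    UDecay (timeShift α μ) (fun i => (x i).source) (q + 1) := by
  have hpi := Real.pi_pos
  refine ⟨12 * (((2 * Real.pi) ^ 3)⁻¹ * (C * (3 / μ) ^ q)), by positivity, fun i t ht => ?_⟩
  have h1 := one_le_timeShift (α := α) (μ := μ)
  have hτ : 0 < t + timeShift α μ := by linarith
  set τ := t + timeShift α μ
  have hR := splitRadius_pos hμ hτ
  have h2 := h i (2 * Real.pi * splitRadius μ τ) (by positivity)
  rw [lowFreqMass_eq, mul_div_cancel_left₀ _ (by positivity), two_pi_mul_splitRadius,
    Real.sqrt_eq_rpow, ← Real.rpow_mul (by positivity)] at h2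
  have e : (1 / 2 * (2 * q)) = q := by ring
  rw [e, ← div_div, Real.div_rpow (by positivity) hτ.le] at h2
  have h3 : lowMass (splitRadius μ τ) (x i).u₀ ≤
      ((2 * Real.pi) ^ 3)⁻¹ * (C * ((3 / μ) ^ q / τ ^ q)) := by
    rwa [← div_eq_inv_mul, le_div_iff₀' (by positivity)]
  calc (x i).source t = 12 / τ * lowMass (splitRadius μ τ) (x i).u₀ := rfl
    _ ≤ 12 / τ * (((2 * Real.pi) ^ 3)⁻¹ * (C * ((3 / μ) ^ q / τ ^ q))) := by gcongr
    _ = _ := by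
      rw [Real.rpow_neg hτ.le, Real.rpow_add hτ, Real.rpow_one]
      field_simp

/-- The constant must precede the solutions, so the decay theorem is applied to the family of all
comparisons with the prescribed norm, decay character and profile. These three data determine every
bound that varies with the initial field. -/
theorem exists_comparison_bound {α μ : ℝ} (hα : 0 < α) (hμ : 0 < μ) (N : ℝ) (r : EReal)
    (E : ℝ → ℝ) : ∃ C, 0 < C ∧ ∀ x : Comparison α μ, normH1 α x.u₀ = N →
      upperDecayCharacter x.u₀ = r → lowFreqMass x.u₀ = E → ∀ t ≥ 0,
        energy α (x.u t - x.v t) ≤ C * (t + 1) ^ (-decayRate r) := by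
  set ι := {x : Comparison α μ // normH1 α x.u₀ = N ∧ upperDecayCharacter x.u₀ = r ∧
    lowFreqMass x.u₀ = E}
  -- If no initial field has these data, any constant will do. Otherwise one member fixes the rate q
  -- and the low-frequency constant, and the common profile passes them on to all.
  rcases isEmpty_or_nonempty ι with hι | ⟨⟨x₀, -, hr₀, hE₀⟩⟩
  · exact ⟨1, one_pos, fun x h1 h2 h3 => (hι.false ⟨x, h1, h2, h3⟩).elim⟩
  obtain ⟨hD0, hD, q, hq0, hq, hq1, hqr, hDq, hDq'⟩ := exists_rate (hr₀ ▸ le_upperDecayCharacter x₀.u₀)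
  obtain ⟨C₀, hC₀, hlow⟩ := exists_lowFreqMass_le x₀.u₀ hq0 (by rwa [hr₀])
  rw [hE₀] at hlow
  have hEn : ∀ i : ι, energy α i.1.u₀ = N ^ 2 := fun i => by
    have h : normH1 α i.1.u₀ ^ 2 = energy α i.1.u₀ := by
      rw [normH1, normSqH1_eq_energy i.1.reg_zero, Real.sq_sqrt (energy_nonneg hα _)]
    rw [← h, i.2.1]
  obtain ⟨C, hC, hW⟩ := difference_decay (ι := ι) (t₀ := timeShift α μ) (q := q)
    (D := decayRate r) (X := N ^ 2) (K := comparisonConst α μ) (c := gapRate α μ)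
    (U := fun i t => energy α (i.1.u t)) (V := fun i t => energy α (i.1.v t))
    (W := fun i t => energy α (i.1.u t - i.1.v t)) (B := fun i => i.1.source)
    (P := fun i t => waveNorm (i.1.v t)) one_le_timeShift (comparisonConst_bounds hα hμ).1
    (gapRate_pos hα hμ) hq0 hq hq1 hD hDq hDq'
    (fun i => i.1.isPrim_u hα hμ) (fun i => i.1.isPrim_v hα hμ) (fun i => i.1.isPrim_sub hα hμ)
    (fun _ _ => energy_nonneg hα _) (fun _ _ => energy_nonneg hα _) (fun _ _ => energy_nonneg hα _)
    (fun _ _ => waveNorm_nonneg _) (fun i => by rw [i.1.weak.1, hEn i])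
    (fun i => by rw [i.1.linear.1, hEn i])
    (fun i => by
      rw [i.1.weak.1, i.1.linear.1, sub_self]
      simp only [energy, dens]
      simpa using sq_nonneg N)
    (fun i t ht => energy_sub_le hα (i.1.reg_u hα hμ ht)
      fun j => (i.1.reg_v hα hμ ht j).mono (by norm_num))
    (uDecay_source hμ (fun i : ι => i.1) hC₀ fun i => by rw [i.2.2.2]; exact hlow)
    (fun i t ht => i.1.waveNorm_v_le hα hμ ht)
    (fun i => by
      filter_upwards [ae_restrict_mem measurableSet_Ioi] with s hs
      exact i.1.energy_v_le hα hμ (le_of_lt hs))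
    (fun i => Eventually.of_forall fun s => by
      have : 0 ≤ dissip μ (i.1.u s) := mul_nonneg hμ.le
        (integral_nonneg fun ξ => mul_nonneg (ksq_nonneg ξ) (dens_nonneg _ ξ))
      linarith)
    (fun i => by
      filter_upwards [ae_restrict_mem measurableSet_Ioi] with s hs
      exact i.1.energy_u_le hα hμ (le_of_lt hs))
    (fun i => i.1.energy_sub_le hα hμ)
  refine ⟨C + 1, by positivity, fun x h1 h2 h3 t ht => ?_⟩
  refine (hW ⟨x, h1, h2, h3⟩ t ht).trans ?_
  -- The shift is at least 1, so it only improves the bound.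
  have h4 : (t + timeShift α μ) ^ (-decayRate r) ≤ (t + 1) ^ (-decayRate r) :=
    Real.rpow_le_rpow_of_nonpos (by positivity) (by linarith [one_le_timeShift (α := α) (μ := μ)])
      (by linarith)
  have h5 : 0 ≤ (t + 1) ^ (-decayRate r) := by positivity
  nlinarith

end SecondGrade

end

/-! ### The theorem -/

theorem theorem2 (α μ : ℝ) (hα : 0 < α) (hμ : 0 < μ) :
    ∃ ε : ℝ, 0 < ε ∧
    ∃ C : ℝ → EReal → (ℝ → ℝ) → ℝ, (∀ N r E, 0 < C N r E) ∧
    ∀ u₀ : SecondGrade.Field,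
      SecondGrade.IsRealValued u₀ → SecondGrade.MemH 4 u₀ → SecondGrade.divergence u₀ = 0 →
      SecondGrade.normV2 α u₀ < ε →
    ∀ u v : ℝ → SecondGrade.Field,
      SecondGrade.IsWeakSolution α μ u₀ u → SecondGrade.IsLinearSolution α μ u₀ v →
      (∀ t : ℝ, 0 ≤ t →
        SecondGrade.MemH 1 (u t - v t) ∧
        SecondGrade.normSqH1 α (u t - v t) ≤
          C (SecondGrade.normH1 α u₀) (SecondGrade.upperDecayCharacter u₀)
              (SecondGrade.lowFreqMass u₀)
            * (t + 1) ^ (-SecondGrade.decayRate (SecondGrade.upperDecayCharacter u₀))) ∧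
      Filter.Tendsto (fun t : ℝ => SecondGrade.normSqH1 α (u t - v t)) Filter.atTop (nhds 0) := by
  choose C hC hbound using SecondGrade.exists_comparison_bound hα hμ
  -- The value ε = 1 has no significance: the bound on the norm of V₂ is used only to bound the H³
  -- norm of the initial field by a fixed constant.
  refine ⟨1, one_pos, C, hC, fun u₀ hr h4 hd hsmall u v hu hv => ?_⟩
  have hreg : ∀ i, SecondGrade.Reg 4 (u₀ i) := fun i =>
    SecondGrade.reg_of_memSobolev (by simpa using h4 i)
  have hV2 := SecondGrade.memV2_of_reg hα hr hd fun i => (hreg i).mono (by norm_num)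
  have h0 : 0 ≤ SecondGrade.normV2 α u₀ := Real.sqrt_nonneg _
  have hc : 0 ≤ SecondGrade.v2Const α := by unfold SecondGrade.v2Const; positivity
  let x : SecondGrade.Comparison α μ :=
    { u₀ := u₀, u := u, v := v, reg := hreg, divFree := (SecondGrade.divFree_iff u₀).1 hd
      small := (hV2.reg hα).2.trans (mul_le_of_le_one_right hc (pow_le_one₀ h0 hsmall.le))
      weak := hu, linear := hv }
  have hreg1 : ∀ t : ℝ, 0 ≤ t → ∀ i, SecondGrade.Reg 1 ((u t - v t) i) :=
    fun t ht => x.reg_sub hα hμ ht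
  have hle : ∀ t : ℝ, 0 ≤ t → SecondGrade.normSqH1 α (u t - v t) ≤
      C (SecondGrade.normH1 α u₀) (SecondGrade.upperDecayCharacter u₀) (SecondGrade.lowFreqMass u₀)
        * (t + 1) ^ (-SecondGrade.decayRate (SecondGrade.upperDecayCharacter u₀)) := by
    intro t ht
    rw [SecondGrade.normSqH1_eq_energy (hreg1 t ht)]
    exact hbound _ _ _ x rfl rfl rfl t ht
  refine ⟨fun t ht => ⟨fun i => by simpa using (hreg1 t ht i).memSobolev, hle t ht⟩, ?_⟩
  -- The exponent is at least 1/4, its value at r*₊ = -3/2, so the bound tends to zero in every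
  -- case.
  have hrate := (SecondGrade.exists_rate (SecondGrade.le_upperDecayCharacter u₀)).1
  have hlim := (((tendsto_rpow_neg_atTop (by linarith : 0 < SecondGrade.decayRate
    (SecondGrade.upperDecayCharacter u₀))).comp
    (tendsto_atTop_add_const_right atTop (1 : ℝ) tendsto_id)).const_mul
    (C (SecondGrade.normH1 α u₀) (SecondGrade.upperDecayCharacter u₀) (SecondGrade.lowFreqMass u₀)))
  rw [mul_zero] at hlim
  refine squeeze_zero' ?_ ?_ hlim
  · filter_upwards [eventually_ge_atTop (0 : ℝ)] with t ht
    rw [SecondGrade.normSqH1_eq_energy (hreg1 t ht)]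
    exact SecondGrade.energy_nonneg hα _
  · filter_upwards [eventually_ge_atTop (0 : ℝ)] with t ht using hle t ht
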